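/- Let $E$ be a completely regular Hausdorff space and $\rho:E\to(0,\infty)$ an admissible weight function, i.e. $\{\rho\le R\}$ is compact for every $R\ge 0$. Put $\|f\|_\rho=\sup_{x\in E}|f(x)|/\rho(x)$, let $B^\rho(E)$ be the space of all $f:E\to\mathbb R$ with $\|f\|_\rho<\infty$, and let $\mathscr B^\rho(E)$ be the $\|\cdot\|_\rho$-closure of $C_b(E)$ in $B^\rho(E)$. A generalized Feller semigroup on $\mathscr B^\rho(E)$ is a family $(P(t))_{t\ge0}$ of bounded linear positive operators on $\mathscr B^\rho(E)$ with $P(0)=\mathrm{Id}$, $P(t+s)=P(s)P(t)$, $\lim_{t\searrow0}P(t)f(x)=f(x)$ for all $f\in\mathscr B^\rho(E)$, $x\in E$, and $\sup_{t\in[0,\varepsilon]}\|P(t)\|<\infty$ for some $\varepsilon>0$. Assume that $\rho$ is measurable with respect to the Baire $\sigma$-algebra of $E$ (the smallest one making all continuous real functions measurable), and let $(P(t))_{t\ge 0}$ be a generalized Feller semigroup on $\mathscr B^\rho(E)$. Then for all $t\ge0$, $x\in E$ there is a unique finite (positive) Radon measure $p(t)(x,\cdot)$ on $E$ with $\int\rho\,dp(t)(x,\cdot)<\infty$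 and $P(t)f(x)=\int f\,dp(t)(x,\cdot)$ for all $f\in\mathscr B^\rho(E)$. For more general functions $g$ on $E$, write $P(t)g(x)=\int g\,dp(t)(x,\cdot)$. Let $E_\Delta=E\cup\{\Delta\}$ be $E$ with an isolated cemetery point $\Delta$, with $\sigma$-algebra $\mathcal B(E_\Delta)=\sigma(\mathcal B(E),\{\Delta\})$. Let $(\gamma_t)_{t\ge0}$ be the canonical process on $(E_\Delta^{\mathbb R_+},\mathcal B(E_\Delta)^{\mathbb R_+})$, $(\mathcal F^0_t)$ its natural filtration, and $\mathcal F^0_{t+}=\bigcap_{r>t}\mathcal F^0_r$. For $f:E_\Delta\to\mathbb R$, the function $\frac{P(t)(f\rho)}{\rho}$ on $E$ is extended to $E_\Delta$ by the value $0$ at $\Delta$. (1) Suppose $\|P(t)\|\le1$ for all $t\ge0$. Then for every probability measure $\nu$ on $(E_\Delta,\mathcal B(E_\Delta))$ there is a probability measure $\mathbb P'_\nu$ on $(E_\Delta^{\mathbb R_+},\mathcal B(E_\Delta)^{\mathbb R_+})$ such that $(\gamma_t)$ is an extended Feller process with respect to $(\mathcal F^0_t)$ and $(P(t))$ with initial distribution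 $\nu$. That is, $(\gamma_t)$ is adapted to $(\mathcal F^0_t)$, $\mathbb P'_\nu\circ\gamma_0^{-1}=\nu$, and, for all $0\le s\le t$ and every bounded Baire measurable $f:E_\Delta\to\mathbb R$ with $f(\Delta)=0$, $$\mathbb E_{\mathbb P'_\nu}\left[f(\gamma_t)\mid\mathcal F^0_s\right]=\frac{P(t-s)(f\rho)}{\rho}(\gamma_s)\qquad\mathbb P'_\nu\text{-a.s.}$$ If $f(\Delta)=0$ and $(f\rho)|_E\in\mathscr B^\rho(E)$, this identity also holds with $\mathcal F^0_s$ replaced by $\mathcal F^0_{s+}$, and, on the completed probability space, with $\mathcal F^0_s$ replaced by the completion of $\mathcal F^0_{s+}$ by all $\mathbb P'_\nu$-null sets. (2) Suppose instead that, for some $\omega\in\mathbb R$, $\|P(t)\|\le e^{\omega t}$ for all $t\ge0$. Then for every probability measure $\nu$ on $(E_\Delta,\mathcal B(E_\Delta))$ there is a probability measure $\mathbb P'_\nu$ on $(E_\Delta^{\mathbb R_+},\mathcal B(E_\Delta)^{\mathbb R_+})$ with $\mathbb P'_\nu\circ\gamma_0^{-1}=\nu$ such that, for all $0\le s\le t$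 and every bounded Baire measurable $f:E_\Delta\to\mathbb R$ with $f(\Delta)=0$, $$\mathbb E_{\mathbb P'_\nu}\left[f(\gamma_t)\mid\mathcal F^0_s\right]=\frac{e^{-\omega(t-s)}P(t-s)(f\rho)}{\rho}(\gamma_s)\qquad\mathbb P'_\nu\text{-a.s.},$$ and if $f(\Delta)=0$ and $(f\rho)|_E\in\mathscr B^\rho(E)$, this identity also holds with $\mathcal F^0_s$ replaced by $\mathcal F^0_{s+}$ and by its completion. -/

import Mathlib

open MeasureTheory Filter Topology
open scoped NNReal

namespace GeneralizedFeller

/-- An admissible weight function `ρ : E → (0, ∞)`: all sublevel sets `{ρ ≤ R}`, `R ≥ 0`,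
are compact. -/
structure AdmissibleWeight (E : Type*) [TopologicalSpace E] where
  toFun : E → ℝ
  pos : ∀ x, 0 < toFun x
  isCompact_sublevel : ∀ R : ℝ, 0 ≤ R → IsCompact {x | toFun x ≤ R}

instance (E : Type*) [TopologicalSpace E] : CoeFun (AdmissibleWeight E) (fun _ => E → ℝ) :=
  ⟨AdmissibleWeight.toFun⟩

section Spaces

variable {E : Type*} [TopologicalSpace E]

/-- The functions `f : E → ℝ` with `sup |f| / ρ < ∞`, as a linear subspace of all functions. -/
def weightedBoundedSubmodule (ρ : AdmissibleWeight E) : Submodule ℝ (E → ℝ) where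
  carrier := {f | ∃ C : ℝ, ∀ x, |f x| / ρ x ≤ C}
  zero_mem' := ⟨0, fun x => by simp⟩
  add_mem' := by
    rintro f g ⟨C, hC⟩ ⟨D, hD⟩
    refine ⟨C + D, fun x => ?_⟩
    calc |(f + g) x| / ρ x ≤ (|f x| + |g x|) / ρ x :=
          div_le_div_of_nonneg_right (abs_add_le _ _) (ρ.pos x).le
      _ = |f x| / ρ x + |g x| / ρ x := add_div _ _ _
      _ ≤ C + D := add_le_add (hC x) (hD x)
  smul_mem' := by
    rintro c f ⟨C, hC⟩
    refine ⟨|c| * C, fun x => ?_⟩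
    have h : |(c • f) x| / ρ x = |c| * (|f x| / ρ x) := by
      simp [abs_mul, mul_div_assoc]
    rw [h]
    exact mul_le_mul_of_nonneg_left (hC x) (abs_nonneg c)

/-- The space `B^ρ(E)` of all functions `f : E → ℝ` with `‖f‖_ρ = sup |f| / ρ < ∞`. -/
def WeightedBounded (ρ : AdmissibleWeight E) : Type _ := weightedBoundedSubmodule ρ

namespace WeightedBounded

variable {ρ : AdmissibleWeight E}

instance : AddCommGroup (WeightedBounded ρ) :=
  inferInstanceAs (AddCommGroup (weightedBoundedSubmodule ρ))

instance : Module ℝ (WeightedBounded ρ) :=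
  inferInstanceAs (Module ℝ (weightedBoundedSubmodule ρ))

instance : CoeFun (WeightedBounded ρ) (fun _ => E → ℝ) := ⟨fun f => f.1⟩

theorem bddAbove (f : WeightedBounded ρ) : BddAbove (Set.range fun x => |f x| / ρ x) := by
  obtain ⟨C, hC⟩ := f.2
  exact ⟨C, by rintro _ ⟨x, rfl⟩; exact hC x⟩

/-- The norm `‖f‖_ρ = sup_x |f x| / ρ x`. -/
noncomputable instance : Norm (WeightedBounded ρ) := ⟨fun f => ⨆ x, |f x| / ρ x⟩

theorem norm_def (f : WeightedBounded ρ) : ‖f‖ = ⨆ x, |f x| / ρ x := rfl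

theorem le_norm (f : WeightedBounded ρ) (x : E) : |f x| / ρ x ≤ ‖f‖ := le_ciSup f.bddAbove x

theorem norm_nonneg' (f : WeightedBounded ρ) : 0 ≤ ‖f‖ :=
  Real.iSup_nonneg fun x => div_nonneg (abs_nonneg _) (ρ.pos x).le

theorem norm_le_of {f : WeightedBounded ρ} {C : ℝ} (hC : 0 ≤ C)
    (h : ∀ x, |f x| / ρ x ≤ C) : ‖f‖ ≤ C := Real.iSup_le h hC

theorem normedSpaceCore : NormedSpace.Core ℝ (WeightedBounded ρ) where
  norm_nonneg := norm_nonneg'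
  norm_smul c f := by
    rw [norm_def, norm_def, Real.norm_eq_abs, Real.mul_iSup_of_nonneg (abs_nonneg c)]
    congr 1
    funext x
    change |c * f x| / ρ x = _
    rw [abs_mul, mul_div_assoc]
  norm_triangle f g := by
    refine norm_le_of (add_nonneg (norm_nonneg' f) (norm_nonneg' g)) fun x => ?_
    change |f x + g x| / ρ x ≤ _
    calc |f x + g x| / ρ x ≤ (|f x| + |g x|) / ρ x :=
          div_le_div_of_nonneg_right (abs_add_le _ _) (ρ.pos x).le
      _ = |f x| / ρ x + |g x| / ρ x := add_div _ _ _
      _ ≤ ‖f‖ + ‖g‖ := add_le_add (le_norm f x) (le_norm g x)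
  norm_eq_zero_iff f := by
    constructor
    · intro h
      apply Subtype.ext
      funext x
      have h1 := le_norm f x
      rw [h] at h1
      have h2 : |f x| ≤ 0 := by
        have := (div_le_iff₀ (ρ.pos x)).1 h1
        simpa using this
      exact abs_nonpos_iff.1 h2
    · rintro rfl
      refine le_antisymm (norm_le_of le_rfl fun x => ?_) (norm_nonneg' _)
      change |(0 : ℝ)| / ρ x ≤ 0
      simp

noncomputable instance : NormedAddCommGroup (WeightedBounded ρ) :=
  NormedAddCommGroup.ofCore normedSpaceCore

noncomputable instance : NormedSpace ℝ (WeightedBounded ρ) :=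
  NormedSpace.ofCore normedSpaceCore

end WeightedBounded

/-- The bounded continuous functions, as a linear subspace of `B^ρ(E)`. -/
def boundedContinuousSubmodule (ρ : AdmissibleWeight E) : Submodule ℝ (WeightedBounded ρ) where
  carrier := {f | Continuous (f : E → ℝ) ∧ ∃ C : ℝ, ∀ x, |f x| ≤ C}
  zero_mem' := ⟨continuous_const, 0, fun x => by change |(0 : ℝ)| ≤ 0; simp⟩
  add_mem' := by
    rintro f g ⟨hf, C, hC⟩ ⟨hg, D, hD⟩
    exact ⟨hf.add hg, C + D, fun x => (abs_add_le _ _).trans (add_le_add (hC x) (hD x))⟩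
  smul_mem' := by
    rintro c f ⟨hf, C, hC⟩
    refine ⟨hf.const_smul c, |c| * C, fun x => ?_⟩
    change |c * f x| ≤ _
    rw [abs_mul]
    exact mul_le_mul_of_nonneg_left (hC x) (abs_nonneg c)

/-- On a Hausdorff space an admissible weight is bounded below by a positive constant, so every
bounded function belongs to `B^ρ(E)`; in particular `boundedContinuousSubmodule ρ` contains all of
`C_b(E)`. -/
theorem bounded_mem_weightedBounded [T2Space E] (ρ : AdmissibleWeight E) {f : E → ℝ}
    (hf : ∃ C : ℝ, ∀ x, |f x| ≤ C) : f ∈ weightedBoundedSubmodule ρ := by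
  obtain ⟨C, hC⟩ := hf
  have hlow : ∃ c : ℝ, 0 < c ∧ ∀ x, c ≤ ρ x := by
    by_contra! hcon
    let K : ℕ → Set E := fun n => {x | ρ x ≤ 1 / ((n : ℝ) + 1)}
    have hKne : ∀ n, (K n).Nonempty := fun n => by
      obtain ⟨x, hx⟩ := hcon (1 / ((n : ℝ) + 1)) (by positivity)
      exact ⟨x, hx.le⟩
    have hK : ∀ n, IsCompact (K n) := fun n => ρ.isCompact_sublevel _ (by positivity)
    have hanti : ∀ n, K (n + 1) ⊆ K n := fun n x (hx : ρ x ≤ _) =>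
      hx.trans (one_div_le_one_div_of_le (by positivity) (by push_cast; linarith))
    obtain ⟨a, ha⟩ := IsCompact.nonempty_iInter_of_sequence_nonempty_isCompact_isClosed K hanti
      hKne (hK 0) (fun n => (hK n).isClosed)
    obtain ⟨n, hn⟩ := exists_nat_one_div_lt (ρ.pos a)
    exact absurd (Set.mem_iInter.1 ha n) (not_le.2 hn)
  obtain ⟨c, hc, hρ⟩ := hlow
  refine ⟨|C| / c, fun x => ?_⟩
  have h0 : |f x| ≤ |C| := (hC x).trans (le_abs_self C)
  calc |f x| / ρ x ≤ |C| / ρ x := div_le_div_of_nonneg_right h0 (ρ.pos x).le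
    _ ≤ |C| / c := div_le_div_of_nonneg_left (abs_nonneg C) hc (hρ x)

/-- The space `𝓑^ρ(E)` of functions with growth controlled by `ρ`: the closure of `C_b(E)` in
`B^ρ(E)` with respect to `‖·‖_ρ`. -/
noncomputable abbrev controlledGrowth (ρ : AdmissibleWeight E) :
    Submodule ℝ (WeightedBounded ρ) :=
  (boundedContinuousSubmodule ρ).topologicalClosure

/-- The function `E → ℝ` underlying an element of `𝓑^ρ(E)`. -/
def growthFun {ρ : AdmissibleWeight E} (f : controlledGrowth ρ) : E → ℝ := f.1.1

/-- A generalized Feller semigroup on `𝓑^ρ(E)`. -/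
structure GeneralizedFellerSemigroup (ρ : AdmissibleWeight E) where
  op : ℝ≥0 → (controlledGrowth ρ →L[ℝ] controlledGrowth ρ)
  op_zero : op 0 = ContinuousLinearMap.id ℝ (controlledGrowth ρ)
  op_add : ∀ s t : ℝ≥0, op (t + s) = (op s).comp (op t)
  tendsto_zero : ∀ (f : controlledGrowth ρ) (x : E),
    Tendsto (fun t : ℝ≥0 => growthFun (op t f) x) (𝓝[>] 0) (𝓝 (growthFun f x))
  bounded_near_zero : ∃ ε : ℝ≥0, 0 < ε ∧ ∃ C : ℝ, ∀ t ≤ ε, ‖op t‖ ≤ C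
  positive : ∀ (t : ℝ≥0) (f : controlledGrowth ρ),
    (∀ x, 0 ≤ growthFun f x) → ∀ x, 0 ≤ growthFun (op t f) x

/-- The Baire σ-algebra: the smallest σ-algebra making all continuous real functions
measurable. -/
@[reducible] def baire (X : Type*) [TopologicalSpace X] : MeasurableSpace X :=
  ⨆ f : C(X, ℝ), MeasurableSpace.comap f inferInstance

end Spaces

section Extension

variable {E : Type*} [TopologicalSpace E] [MeasurableSpace E] {ρ : AdmissibleWeight E}

/-- `μ` is a finite Radon measure that integrates `ρ` and represents the functional
`f ↦ P(t) f (x)` on `𝓑^ρ(E)`. -/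
structure Represents (P : GeneralizedFellerSemigroup ρ) (t : ℝ≥0) (x : E) (μ : Measure E) :
    Prop where
  isFiniteMeasure : IsFiniteMeasure μ
  innerRegular : μ.InnerRegular
  integrable_weight : Integrable ρ μ
  integral_eq : ∀ f : controlledGrowth ρ, ∫ y, growthFun f y ∂μ = growthFun (P.op t f) x

open Classical in
/-- The measure `p(t)(x, ·)` representing `f ↦ P(t) f (x)`. -/
noncomputable def GeneralizedFellerSemigroup.kernel (P : GeneralizedFellerSemigroup ρ)
    (t : ℝ≥0) (x : E) : Measure E :=
  if h : ∃ μ : Measure E, Represents P t x μ then h.choose else 0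

/-- The extension of `P(t)` to more general functions: `P(t) g (x) = ∫ g(y) p(t)(x, dy)`. -/
noncomputable def GeneralizedFellerSemigroup.extend (P : GeneralizedFellerSemigroup ρ)
    (t : ℝ≥0) (g : E → ℝ) (x : E) : ℝ :=
  ∫ y, g y ∂(P.kernel t x)

end Extension

/-- The space `E ∪ {Δ}` with an isolated cemetery state `Δ = Sum.inr ()`. Its σ-algebra is the one
generated by the measurable sets of `E` and by `{Δ}`. -/
abbrev WithCemetery (E : Type*) : Type _ := E ⊕ Unit

/-- The path space `(E ∪ {Δ})^{ℝ₊}`, with the product σ-algebra. -/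
abbrev PathSpace (E : Type*) : Type _ := ℝ≥0 → WithCemetery E

/-- The canonical process `γ_t(ω) = ω(t)`. -/
def canonicalProcess (E : Type*) (t : ℝ≥0) (ω : PathSpace E) : WithCemetery E := ω t

/-- The function `P(t)(f ρ) / ρ` on `E`, extended by `0` to `Δ`. -/
noncomputable def GeneralizedFellerSemigroup.quotient {E : Type*} [TopologicalSpace E]
    [MeasurableSpace E] {ρ : AdmissibleWeight E} (P : GeneralizedFellerSemigroup ρ) (t : ℝ≥0)
    (f : WithCemetery E → ℝ) : WithCemetery E → ℝ
  | Sum.inl x => P.extend t (fun y => f (Sum.inl y) * ρ y) x / ρ x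
  | Sum.inr _ => 0

/-- Bounded Baire measurable functions on `E ∪ {Δ}`, extended to `Δ` by the convention
`f(Δ) = 0`. -/
structure IsTestFunction {E : Type*} [TopologicalSpace E] (f : WithCemetery E → ℝ) : Prop where
  bounded : ∃ C : ℝ, ∀ z, |f z| ≤ C
  measurable : Measurable[baire (WithCemetery E)] f
  cemetery : f (Sum.inr ()) = 0

/-- `f` is a function on `E ∪ {Δ}` with `f ρ ∈ 𝓑^ρ(E ∪ {Δ})`: the restriction of `f ρ` to `E` is
in `𝓑^ρ(E)`, and `f(Δ) = 0`. -/
def MulWeightMem {E : Type*} [TopologicalSpace E] (ρ : AdmissibleWeight E)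
    (f : WithCemetery E → ℝ) : Prop :=
  (∃ g : controlledGrowth ρ, ∀ x, f (Sum.inl x) * ρ x = growthFun g x) ∧ f (Sum.inr ()) = 0

/-- `γ` is an extended Feller process with respect to the filtration `𝓕` and the generalized Feller
semigroup `P`, with initial distribution `ν`, on the probability space `(Ω, ℙ)`. -/
structure IsExtendedFellerProcess {E : Type*} [TopologicalSpace E] [MeasurableSpace E]
    {ρ : AdmissibleWeight E} (P : GeneralizedFellerSemigroup ρ) (ν : Measure (WithCemetery E))
    {Ω : Type*} [mΩ : MeasurableSpace Ω] (ℙ : Measure Ω) (𝓕 : Filtration ℝ≥0 mΩ)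
    (γ : ℝ≥0 → Ω → WithCemetery E) : Prop where
  adapted : ∀ t, Measurable[𝓕 t] (γ t)
  condExp_eq : ∀ s t : ℝ≥0, s ≤ t → ∀ f : WithCemetery E → ℝ, IsTestFunction f →
    ℙ[fun ω => f (γ t ω) | 𝓕 s] =ᵐ[ℙ] fun ω => P.quotient (t - s) f (γ s ω)
  initial : ℙ.map (γ 0) = ν

/-- The natural filtration of the canonical process. -/
def naturalFiltration (E : Type*) [MeasurableSpace E] :
    Filtration ℝ≥0 (inferInstance : MeasurableSpace (PathSpace E)) where
  seq t := ⨆ r : ℝ≥0, ⨆ _ : r ≤ t, MeasurableSpace.comap (canonicalProcess E r) inferInstance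
  mono' _ _ hst := biSup_mono fun _ hr => hr.trans hst
  le' _ := iSup₂_le fun r _ => (measurable_pi_apply r).comap_le

/-- The completion of a filtration: on the completed probability space, all null sets are added
to every σ-algebra of the filtration. -/
def completedFiltration {Ω : Type*} [mΩ : MeasurableSpace Ω] (ℙ : Measure Ω)
    (𝓕 : Filtration ℝ≥0 mΩ) :
    Filtration ℝ≥0 (inferInstance : MeasurableSpace (NullMeasurableSpace Ω ℙ)) where
  seq t := @eventuallyMeasurableSpace Ω (𝓕 t) (ae ℙ) _
  mono' _ _ hst := fun _ ⟨u, hu, hsu⟩ => ⟨u, 𝓕.mono hst u hu, hsu⟩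
  le' t := fun _ ⟨u, hu, hsu⟩ => ⟨u, 𝓕.le t u hu, hsu⟩

end GeneralizedFeller

/-! On `C_b(E)` the functional `f ↦ P(t) f (x)` is positive. It is also tight: a function with
values in `[0, 1]` that vanishes on the compact set `{ρ ≤ R}` has `ρ`-norm at most `1 / R`. The
Riesz theorem on the Stone–Čech compactification therefore gives a finite Radon measure `p(t)(x,
·)`. Compact sublevel sets make `ρ` lower semicontinuous, so `∫ ρ dp(t)(x, ·)` is a supremum over
continuous `0 ≤ f ≤ ρ`, which gives `∫ ρ dp(t)(x, ·) ≤ ‖P(t)‖ ρ(x)` (`lintegral_weight_le`). This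
bound extends the representation to `𝓑^ρ(E)` by density. If `‖P(t)‖ ≤ e^{ct}`, it also says that the
transformed measures `e^{-ct} ρ(y) p(t)(x, dy) / ρ(x)` have mass at most `1`. Sending the missing
mass to `Δ` produces a Markov semigroup on `E ∪ {Δ}` (`cemeteryKernel_add`), and the contractive
case is `c = 0`.

Two obstacles stand in the way of the usual Kolmogorov extension. The functions `P(t) f` are
pointwise limits of continuous functions, so the kernels are controlled only on Baire sets, while
paths carry the Borel product σ-algebra. And `ν` is an arbitrary Borel measure, with no inner
regularity. Both are handled by keeping Borel sets at time `0` and Baire sets at all other times,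
and by embedding paths in a compact space (`PathCompact`): the start is recorded as the family of
indicators of all Borel sets, later positions as points of the Stone–Čech compactification. An
ultrafilter limit of the finite-time laws is a positive functional there, hence a regular measure.
The compact Baire sets `{ρ ≤ n} ∪ {Δ}` show that the positions lie almost surely in the original
space. The start is pulled back from indicators to points by an outer measure argument that needs no
topology (`exists_measure_map_indicators_eq`). The marginals at times `t ≠ 0` come out inner
regular, so Borel events there are Baire up to null sets, and the Markov property passes to the
Borel filtration (`exists_markov_path_measure`).

The statement for `𝓕_{s+}` needs right continuity of `f(γ_t)` in `L¹` when `f = g / ρ` with `g ∈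
𝓑^ρ(E)`. For `g = u` bounded continuous, a second moment computation reduces this to `P(t) u (x) →
u(x)` and `limsup P(t)(u² / ρ)(x) ≤ u(x)² / ρ(x)`. The latter holds because `u² / ρ` is upper
semicontinuous and bounded. Uniform approximation gives all `g`, and the class is stable under the
transition kernels, so the Markov property at `s + δ`, `t + δ` can be passed to the limit `δ ↘ 0`
(`HasTransition.setIntegral_rightCont`). -/

namespace GeneralizedFeller

open scoped BoundedContinuousFunction ENNReal

/-! ### The Baire σ-algebra, and measures determined by bounded continuous functions. -/

section Baire

variable {Y Z : Type*} [TopologicalSpace Y] [TopologicalSpace Z]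

theorem Continuous.measurable_baire {f : Y → ℝ} (hf : Continuous f) : Measurable[baire Y] f :=
  measurable_iff_comap_le.2 (le_iSup (fun f : C(Y, ℝ) => MeasurableSpace.comap f inferInstance)
    ⟨f, hf⟩)

theorem measurable_baire_iff {Ω : Type*} {m : MeasurableSpace Ω} {j : Ω → Y} :
    Measurable[m, baire Y] j ↔ ∀ f : C(Y, ℝ), Measurable[m] fun ω => f (j ω) := by
  rw [measurable_iff_comap_le, baire, MeasurableSpace.comap_iSup, iSup_le_iff]
  refine forall_congr' fun f => ?_
  rw [MeasurableSpace.comap_comp, ← measurable_iff_comap_le]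
  rfl

theorem Continuous.measurable_baire_baire {f : Y → Z} (hf : Continuous f) :
    Measurable[baire Y, baire Z] f :=
  measurable_baire_iff.2 fun g => Continuous.measurable_baire (g.continuous.comp hf)

theorem baire_le_borel [MeasurableSpace Y] [OpensMeasurableSpace Y] :
    baire Y ≤ (inferInstance : MeasurableSpace Y) :=
  iSup_le fun f => f.continuous.measurable.comap_le

/-- The set `{f > c}` is the cozero set of the truncation `min (max (f - c) 0) 1`, so bounded
functions suffice. Their cozero sets form a π-system, and indicators of cozero sets are increasing
limits of bounded continuous functions; this is what makes integrals determine measures below. -/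
theorem baire_eq_generateFrom :
    baire Y = MeasurableSpace.generateFrom (Set.range fun F : Y →ᵇ ℝ => {y | 0 < F y}) := by
  apply le_antisymm
  · refine iSup_le fun f => ?_
    rw [← measurable_iff_comap_le]
    let _ : MeasurableSpace Y :=
      MeasurableSpace.generateFrom (Set.range fun F : Y →ᵇ ℝ => {y | 0 < F y})
    refine measurable_of_Ioi fun c => ?_
    apply MeasurableSpace.measurableSet_generateFrom
    refine ⟨BoundedContinuousFunction.ofNormedAddCommGroup
      (fun y => min (max (f y - c) 0) 1) (by fun_prop) 1 fun y => ?_, ?_⟩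
    · rw [Real.norm_eq_abs, abs_of_nonneg (le_min (le_max_right _ _) zero_le_one)]
      exact min_le_right _ _
    · ext y
      simp
  · refine MeasurableSpace.generateFrom_le ?_
    rintro _ ⟨F, rfl⟩
    exact Continuous.measurable_baire F.continuous measurableSet_Ioi

theorem isPiSystem_cozero : IsPiSystem (Set.range fun F : Y →ᵇ ℝ => {y | 0 < F y}) := by
  rintro _ ⟨F, rfl⟩ _ ⟨G, rfl⟩ -
  exact ⟨F ⊓ G, by ext y; simp⟩

/-- Bounded continuous functions increasing to the indicator of `{0 < F}`. -/
noncomputable def cozeroApprox (F : Z →ᵇ ℝ) (n : ℕ) : Z →ᵇ ℝ :=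
  BoundedContinuousFunction.ofNormedAddCommGroup (fun z => min 1 (n * max (F z) 0))
    (by fun_prop) 1 fun z => by
      have h0 : 0 ≤ (n : ℝ) * max (F z) 0 := mul_nonneg n.cast_nonneg (le_max_right _ _)
      rw [Real.norm_eq_abs, abs_of_nonneg (le_min zero_le_one h0)]
      exact min_le_left _ _

theorem cozeroApprox_nonneg (F : Z →ᵇ ℝ) (n : ℕ) (z : Z) : 0 ≤ cozeroApprox F n z :=
  le_min zero_le_one (mul_nonneg n.cast_nonneg (le_max_right _ _))

theorem tendsto_integral_cozeroApprox {Ω : Type*} [MeasurableSpace Ω] {j : Ω → Z}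
    (hj : Measurable[_, baire Z] j) (μ : Measure Ω) [IsFiniteMeasure μ] (F : Z →ᵇ ℝ) :
    Tendsto (fun n => ∫ ω, cozeroApprox F n (j ω) ∂μ) atTop (𝓝 (μ.real {ω | 0 < F (j ω)})) := by
  have hjF : ∀ F : Z →ᵇ ℝ, Measurable fun ω => F (j ω) := fun F =>
    measurable_baire_iff.1 hj F.toContinuousMap
  have hm : MeasurableSet {ω | 0 < F (j ω)} := measurableSet_lt measurable_const (hjF F)
  rw [← integral_indicator_one hm]
  refine tendsto_integral_of_dominated_convergence (fun _ => 1)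
    (fun n => (hjF _).aestronglyMeasurable) (integrable_const _) (fun n => ?_) ?_
  · refine ae_of_all _ fun ω => ?_
    have h0 : 0 ≤ (n : ℝ) * max (F (j ω)) 0 := mul_nonneg n.cast_nonneg (le_max_right _ _)
    change |min 1 ((n : ℝ) * max (F (j ω)) 0)| ≤ 1
    rw [abs_of_nonneg (le_min zero_le_one h0)]
    exact min_le_left _ _
  · refine ae_of_all _ fun ω => ?_
    change Tendsto (fun n : ℕ => min 1 ((n : ℝ) * max (F (j ω)) 0)) _ _
    by_cases hω : 0 < F (j ω)
    · have : ω ∈ {ω | 0 < F (j ω)} := hω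
      rw [Set.indicator_of_mem this, Pi.one_apply]
      obtain ⟨N, hN⟩ := exists_nat_ge (1 / F (j ω))
      refine tendsto_const_nhds.congr' ?_
      filter_upwards [eventually_ge_atTop N] with n hn
      rw [max_eq_left hω.le, eq_comm, min_eq_left]
      rw [div_le_iff₀ hω] at hN
      exact hN.trans (mul_le_mul_of_nonneg_right (by exact_mod_cast hn) hω.le)
    · have : ω ∉ {ω | 0 < F (j ω)} := hω
      rw [Set.indicator_of_notMem this]
      refine tendsto_const_nhds.congr fun n => ?_
      rw [max_eq_right (not_lt.1 hω), mul_zero, min_eq_right zero_le_one]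

/-- Finite measures that integrate all bounded continuous functions of `j` in the same way agree
on the σ-algebra generated by `j` and the Baire sets. -/
theorem measure_eq_of_integral_comp_eq {Ω : Type*} [MeasurableSpace Ω] {j : Ω → Z}
    (hj : Measurable[_, baire Z] j) {μ μ' : Measure Ω} [IsFiniteMeasure μ] [IsFiniteMeasure μ']
    (h : ∀ F : Z →ᵇ ℝ, (∀ z, 0 ≤ F z) → ∫ ω, F (j ω) ∂μ = ∫ ω, F (j ω) ∂μ') {A : Set Ω}
    (hA : MeasurableSet[(baire Z).comap j] A) : μ A = μ' A := by
  have key : ∀ F : Z →ᵇ ℝ, μ {ω | 0 < F (j ω)} = μ' {ω | 0 < F (j ω)} := by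
    intro F
    have := tendsto_nhds_unique (tendsto_integral_cozeroApprox hj μ F)
      ((tendsto_integral_cozeroApprox hj μ' F).congr fun n => (h _ (cozeroApprox_nonneg F n)).symm)
    rwa [measureReal_def, measureReal_def,
      ENNReal.toReal_eq_toReal_iff' (measure_ne_top _ _) (measure_ne_top _ _)] at this
  refine ext_on_measurableSpace_of_generate_finite _
    (Set.preimage j '' (Set.range fun F : Z →ᵇ ℝ => {y | 0 < F y})) ?_
    (m := (baire Z).comap j) hj.comap_le ?_ ?_ ?_ hA
  · rintro _ ⟨_, ⟨F, rfl⟩, rfl⟩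
    exact key F
  · rw [baire_eq_generateFrom, MeasurableSpace.comap_generateFrom]
  · exact isPiSystem_cozero.comap j
  -- The whole space is the cozero set of the constant `1`, so the total masses agree.
  · simpa using key (BoundedContinuousFunction.const Z 1)

end Baire

/-- A copy of `Y` that carries the Baire σ-algebra. -/
def BaireOf (Y : Type*) : Type _ := Y

instance (Y : Type*) [TopologicalSpace Y] : MeasurableSpace (BaireOf Y) := baire Y

/-- The identity map from `Y` to its copy with the Baire σ-algebra. -/
def toBaire {Y : Type*} : Y → BaireOf Y := id

/-- The identity map from the copy of `Y` with the Baire σ-algebra to `Y`. -/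
def fromBaire {Y : Type*} : BaireOf Y → Y := id

theorem measurable_fromBaire {Y : Type*} [TopologicalSpace Y] :
    Measurable[_, baire Y] (fromBaire : BaireOf Y → Y) := fun _ h => h

theorem measurable_toBaire {Y : Type*} [TopologicalSpace Y] [MeasurableSpace Y]
    [OpensMeasurableSpace Y] : Measurable (toBaire : Y → BaireOf Y) :=
  measurable_id.mono le_rfl baire_le_borel

/-- Families of finite measures on the Baire sets are measurable as soon as the integrals of
bounded continuous functions are. -/
theorem measurable_measure_baireOf {Ω Y : Type*} [MeasurableSpace Ω] [TopologicalSpace Y]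
    {κ : Ω → Measure (BaireOf Y)} [∀ ω, IsFiniteMeasure (κ ω)]
    (h : ∀ F : Y →ᵇ ℝ, Measurable fun ω => ∫ y, F (fromBaire y) ∂(κ ω)) : Measurable κ := by
  have key : ∀ F : Y →ᵇ ℝ, Measurable fun ω => κ ω {y | 0 < F (fromBaire y)} := by
    intro F
    have hreal : Measurable fun ω => (κ ω).real {y | 0 < F (fromBaire y)} :=
      measurable_of_tendsto_metrizable (fun n => h (cozeroApprox F n))
        (tendsto_pi_nhds.2 fun ω => tendsto_integral_cozeroApprox (Ω := BaireOf Y) (j := fromBaire)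
          measurable_fromBaire (κ ω) F)
    have := hreal.ennreal_ofReal
    rwa [funext fun ω => ofReal_measureReal (measure_ne_top (κ ω) {y | 0 < F (fromBaire y)})] at this
  refine Measurable.measure_of_isPiSystem (baire_eq_generateFrom (Y := Y))
    (isPiSystem_cozero (Y := Y)) ?_ ?_
  · rintro _ ⟨F, rfl⟩
    exact key F
  · simpa using key (BoundedContinuousFunction.const Y 1)

theorem measurable_comp_fromBaire {Y : Type*} [TopologicalSpace Y] (F : Y →ᵇ ℝ) :
    Measurable fun y : BaireOf Y => F (fromBaire y) :=
  measurable_baire_iff.1 measurable_fromBaire F.toContinuousMap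

theorem measure_baireOf_ext {Y : Type*} [TopologicalSpace Y] {μ ν : Measure (BaireOf Y)}
    [IsFiniteMeasure μ] [IsFiniteMeasure ν]
    (h : ∀ F : Y →ᵇ ℝ, (∀ y, 0 ≤ F y) → ∫ y, F (fromBaire y) ∂μ = ∫ y, F (fromBaire y) ∂ν) : μ = ν :=
  Measure.ext fun A hA => measure_eq_of_integral_comp_eq measurable_fromBaire h ⟨A, hA, rfl⟩

/-! ### Baire measurability of maps into compact spaces by Stone–Weierstrass. -/

section StoneWeierstrass

variable {K Ω : Type*} [TopologicalSpace K] [CompactSpace K] [MeasurableSpace Ω]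

/-- If the continuous functions `g` with `g ∘ j` measurable separate the points of a compact
space, then `F ∘ j` is measurable for every continuous `F`. -/
theorem measurable_baire_of_separatesPoints {j : Ω → K}
    (h : ∀ x y : K, x ≠ y → ∃ g : C(K, ℝ), (Measurable fun ω => g (j ω)) ∧ g x ≠ g y) :
    Measurable[_, baire K] j := by
  -- The admissible functions form a subalgebra. It is dense by Stone–Weierstrass, and measurability
  -- survives uniform limits.
  let A : Subalgebra ℝ C(K, ℝ) :=
    { carrier := {g | Measurable fun ω => g (j ω)}
      mul_mem' := fun hf hg => hf.mul hg
      add_mem' := fun hf hg => hf.add hg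
      algebraMap_mem' := fun r => measurable_const }
  have hsep : A.SeparatesPoints := by
    intro x y hxy
    obtain ⟨g, hg, hgxy⟩ := h x y hxy
    exact ⟨g, ⟨g, hg, rfl⟩, hgxy⟩
  rw [measurable_baire_iff]
  intro F
  have hF : F ∈ closure (A : Set C(K, ℝ)) := by
    have := ContinuousMap.continuousMap_mem_subalgebra_closure_of_separatesPoints A hsep F
    exact this
  obtain ⟨u, hu, hlim⟩ := mem_closure_iff_seq_limit.1 hF
  refine measurable_of_tendsto_metrizable (fun n => hu n) (tendsto_pi_nhds.2 fun ω => ?_)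
  exact ((continuous_eval_const (j ω)).tendsto F).comp hlim

end StoneWeierstrass

/-! ### Finite Radon measures on completely regular spaces. -/

section Radon

variable {Y : Type*} [TopologicalSpace Y] [T35Space Y]

/-- No local compactness is available, so the separation takes place in the Stone–Čech
compactification, where `C` stays compact and `U` is the trace of an open set. -/
theorem exists_bcf_one_zero {C U : Set Y} (hC : IsCompact C) (hU : IsOpen U) (hCU : C ⊆ U) :
    ∃ f : Y →ᵇ ℝ, Set.EqOn f 1 C ∧ Set.EqOn f 0 Uᶜ ∧ ∀ x, f x ∈ Set.Icc (0 : ℝ) 1 := by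
  obtain ⟨V, hV, rfl⟩ := (isEmbedding_stoneCechUnit (X := Y)).isInducing.isOpen_iff.1 hU
  obtain ⟨f, hf1, hf0, -, hf⟩ := exists_continuous_one_zero_of_isCompact
    (hC.image (continuous_stoneCechUnit (α := Y))) hV.isClosed_compl
    (by
      rw [Set.disjoint_compl_right_iff_subset]
      rintro _ ⟨y, hy, rfl⟩
      exact hCU hy)
  refine ⟨(BoundedContinuousFunction.mkOfCompact f).compContinuous
    ⟨stoneCechUnit, continuous_stoneCechUnit⟩, fun y hy => ?_, fun y hy => ?_, fun y => hf _⟩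
  · exact hf1 ⟨y, hy, rfl⟩
  · exact hf0 hy

variable [MeasurableSpace Y] [BorelSpace Y]

theorem measure_isOpen_le_of_integral_eq {μ ν : Measure Y} [IsFiniteMeasure μ] [IsFiniteMeasure ν]
    [μ.InnerRegular] (h : ∀ f : Y →ᵇ ℝ, ∫ y, f y ∂μ = ∫ y, f y ∂ν) {U : Set Y} (hU : IsOpen U) :
    μ U ≤ ν U := by
  rw [hU.measurableSet.measure_eq_iSup_isCompact]
  refine iSup₂_le fun C hCU => iSup_le fun hC => ?_
  obtain ⟨f, hf1, hf0, hf⟩ := exists_bcf_one_zero hC hU hCU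
  have h1 : μ.real C ≤ ∫ y, f y ∂μ := by
    rw [← integral_indicator_one hC.measurableSet]
    refine integral_mono ((integrable_const 1).indicator hC.measurableSet) (f.integrable μ)
      fun y => ?_
    by_cases hy : y ∈ C
    · simp [hy, hf1 hy]
    · simp [hy, (hf y).1]
  have h2 : ∫ y, f y ∂ν ≤ ν.real U := by
    rw [← integral_indicator_one hU.measurableSet]
    refine integral_mono (f.integrable ν) ((integrable_const 1).indicator hU.measurableSet)
      fun y => ?_
    by_cases hy : y ∈ U
    · simp [hy, (hf y).2]
    · simp [hy, hf0 hy]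
  have h3 := h1.trans ((h f).le.trans h2)
  rwa [measureReal_def, measureReal_def,
    ENNReal.toReal_le_toReal (measure_ne_top _ _) (measure_ne_top _ _)] at h3

theorem innerRegular_ext_of_integral_eq {μ ν : Measure Y} [IsFiniteMeasure μ] [IsFiniteMeasure ν]
    [μ.InnerRegular] [ν.InnerRegular] (h : ∀ f : Y →ᵇ ℝ, ∫ y, f y ∂μ = ∫ y, f y ∂ν) : μ = ν := by
  refine ext_of_generate_finite {U | IsOpen U} (BorelSpace.measurable_eq (α := Y))
    isPiSystem_isOpen (fun U hU => ?_) ?_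
  · exact le_antisymm (measure_isOpen_le_of_integral_eq h hU)
      (measure_isOpen_le_of_integral_eq (fun f => (h f).symm) hU)
  · exact le_antisymm (measure_isOpen_le_of_integral_eq h isOpen_univ)
      (measure_isOpen_le_of_integral_eq (fun f => (h f).symm) isOpen_univ)

/-- Compact subsets exhaust `U` up to a `μ`-null set, and each is separated from the complement of
`U` by a bump function. Thus an open set is a cozero set up to null sets, although it need not be
Baire. -/
theorem exists_bcf_seq_eq_one_ae (μ : Measure Y) [IsFiniteMeasure μ] [μ.InnerRegular] {U : Set Y}
    (hU : IsOpen U) : ∃ f : ℕ → Y →ᵇ ℝ, (∀ n y, f n y ∈ Set.Icc (0 : ℝ) 1) ∧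
      (∀ n, Set.EqOn (f n) 0 Uᶜ) ∧ ∀ᵐ y ∂μ, y ∈ U → ∃ n, f n y = 1 := by
  have : ∀ n : ℕ, ∃ C ⊆ U, IsCompact C ∧ μ U < μ C + (n + 1 : ℝ≥0∞)⁻¹ := fun n =>
    hU.measurableSet.exists_isCompact_lt_add (measure_ne_top _ _) (by simp)
  choose C hCU hC hμ using this
  choose f hf1 hf0 hf using fun n => exists_bcf_one_zero (hC n) hU (hCU n)
  refine ⟨f, hf, hf0, ?_⟩
  have hmeas : MeasurableSet (⋃ n, C n) := MeasurableSet.iUnion fun n => (hC n).measurableSet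
  have hge : μ U ≤ μ (⋃ n, C n) := by
    refine ge_of_tendsto' (x := atTop)
      (f := fun n : ℕ => μ (⋃ n, C n) + (n + 1 : ℝ≥0∞)⁻¹) ?_ fun n => ?_
    · have h0 : Tendsto (fun n : ℕ => (n + 1 : ℝ≥0∞)⁻¹) atTop (𝓝 0) := by
        have := (tendsto_add_atTop_iff_nat 1).2 ENNReal.tendsto_inv_nat_nhds_zero
        simpa using this
      simpa using tendsto_const_nhds.add h0
    · exact (hμ n).le.trans (add_le_add_left (measure_mono (Set.subset_iUnion _ n)) _)
  have hae := ae_eq_of_subset_of_measure_ge (Set.iUnion_subset hCU) hge hmeas.nullMeasurableSet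
    (measure_ne_top μ _)
  filter_upwards [hae.mem_iff] with y hy hyU
  obtain ⟨n, hn⟩ := Set.mem_iUnion.1 (hy.2 hyU)
  exact ⟨n, hf1 n hn⟩

/-- For a finite Radon measure, every Borel set agrees with a Baire set up to a null set. -/
theorem borel_le_eventuallyMeasurableSpace_baire (μ : Measure Y) [IsFiniteMeasure μ]
    [μ.InnerRegular] :
    (inferInstance : MeasurableSpace Y) ≤ @eventuallyMeasurableSpace Y (baire Y) (ae μ) _ := by
  refine (BorelSpace.measurable_eq (α := Y)).le.trans ?_
  refine MeasurableSpace.generateFrom_le fun U hU => ?_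
  obtain ⟨f, hf, hf0, hf1⟩ := exists_bcf_seq_eq_one_ae μ hU
  refine ⟨⋃ n, {y | 0 < f n y}, ?_, ?_⟩
  · exact @MeasurableSet.iUnion _ _ (baire Y) _ _ fun n =>
      Continuous.measurable_baire (f n).continuous measurableSet_Ioi
  · filter_upwards [hf1] with y hy
    refine propext ⟨fun hyU => ?_, fun hyn => ?_⟩
    · obtain ⟨n, hn⟩ := hy hyU
      exact Set.mem_iUnion.2 ⟨n, by simp [hn]⟩
    · obtain ⟨n, hn⟩ := Set.mem_iUnion.1 hyn
      by_contra hyU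
      exact absurd (hf0 n hyU) (ne_of_gt hn)

/-- A nonnegative lower semicontinuous function is integrated by a finite Radon measure as the
supremum of the bounded continuous functions below it. -/
theorem lintegral_le_of_lowerSemicontinuous (μ : Measure Y) [IsFiniteMeasure μ] [μ.InnerRegular]
    {w : Y → ℝ} (hw0 : ∀ y, 0 ≤ w y) (hw : ∀ c : ℝ, 0 ≤ c → IsOpen {y | c < w y}) {c : ℝ}
    (h : ∀ f : Y →ᵇ ℝ, (∀ y, 0 ≤ f y) → (∀ y, f y ≤ w y) → ∫ y, f y ∂μ ≤ c) :
    ∫⁻ y, ENNReal.ofReal (w y) ∂μ ≤ ENNReal.ofReal c := by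
  -- Almost everywhere, `w` is the supremum of `q` times the bump functions for `{q < w}` over
  -- rational levels `q ≥ 0`. Taking `max q 0` makes every rational an admissible level.
  choose f hf hf0 hf1 using fun q : ℚ => exists_bcf_seq_eq_one_ae μ
    (hw (max q 0) (le_max_right _ _))
  obtain ⟨e, he⟩ := exists_surjective_nat (ℚ × ℕ)
  let F : ℕ → Y →ᵇ ℝ := fun k => (max ((e k).1 : ℝ) 0) • f (e k).1 (e k).2
  have hF0 : ∀ k y, 0 ≤ F k y := fun k y => mul_nonneg (le_max_right _ _) (hf _ _ y).1
  have hFw : ∀ k y, F k y ≤ w y := fun k y => by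
    change max ((e k).1 : ℝ) 0 * f (e k).1 (e k).2 y ≤ w y
    by_cases hy : y ∈ {y | max ((e k).1 : ℝ) 0 < w y}
    · exact (mul_le_of_le_one_right (le_max_right _ _) (hf _ _ y).2).trans (le_of_lt hy)
    · rw [hf0 _ _ hy]
      simpa using hw0 y
  -- Running maxima turn the countable family into an increasing sequence, ready for monotone
  -- convergence.
  let g : ℕ → Y →ᵇ ℝ := fun n => Nat.rec 0 (fun n G => G ⊔ F n) n
  have hgs : ∀ n y, g (n + 1) y = max (g n y) (F n y) := fun n y => rfl
  have hg0 : ∀ n y, 0 ≤ g n y := by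
    intro n y
    induction n with
    | zero => exact le_rfl
    | succ n ih => rw [hgs]; exact le_max_of_le_left ih
  have hgw : ∀ n y, g n y ≤ w y := by
    intro n y
    induction n with
    | zero => exact hw0 y
    | succ n ih => rw [hgs]; exact max_le ih (hFw n y)
  have hmono : Monotone fun n y => ENNReal.ofReal (g n y) :=
    monotone_nat_of_le_succ fun n y => ENNReal.ofReal_le_ofReal (by
      rw [hgs]; exact le_max_left _ _)
  have hae : ∀ᵐ y ∂μ, ENNReal.ofReal (w y) = ⨆ n, ENNReal.ofReal (g n y) := by
    filter_upwards [ae_all_iff.2 hf1] with y hy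
    refine le_antisymm (le_of_forall_lt fun a ha => ?_)
      (iSup_le fun n => ENNReal.ofReal_le_ofReal (hgw n y))
    have ha' : a.toReal < w y := by
      have := (ENNReal.lt_ofReal_iff_toReal_lt (ne_top_of_lt ha)).1 ha
      exact this
    obtain ⟨q, hq1, hq2⟩ := exists_rat_btwn ha'
    have hq0 : (0 : ℝ) ≤ q := ENNReal.toReal_nonneg.trans hq1.le
    obtain ⟨n, hn⟩ := hy q (by simpa [max_eq_left hq0] using hq2)
    obtain ⟨k, hk⟩ := he (q, n)
    have hFk : F k y = q := by
      change max ((e k).1 : ℝ) 0 * f (e k).1 (e k).2 y = q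
      rw [hk]
      simp only
      rw [hn, max_eq_left hq0, mul_one]
    refine lt_of_lt_of_le ?_ (le_iSup (fun n => ENNReal.ofReal (g n y)) (k + 1))
    rw [ENNReal.lt_ofReal_iff_toReal_lt (ne_top_of_lt ha), hgs, hFk]
    exact hq1.trans_le (le_max_right _ _)
  rw [lintegral_congr_ae hae, lintegral_iSup
    (fun n => (g n).continuous.measurable.ennreal_ofReal) hmono]
  refine iSup_le fun n => ?_
  rw [← ofReal_integral_eq_lintegral_ofReal ((g n).integrable μ) (ae_of_all _ (hg0 n))]
  exact ENNReal.ofReal_le_ofReal (h _ (hg0 n) (hgw n))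

end Radon

/-! ### Pulling a Radon measure back along an embedding whose range it charges fully. -/

section PushRadon

variable {X Y K : Type*} [TopologicalSpace X] [MeasurableSpace X] [BorelSpace X] [T2Space X]
  [TopologicalSpace Y] [MeasurableSpace Y] [BorelSpace Y]
  [TopologicalSpace K] [MeasurableSpace K] [BorelSpace K]

/-- A compact `L` inside `b ⁻¹' (i '' A)` has compact image inside `i '' A`, and an embedding pulls
that image back to a compact subset of `A`. Outside the range of `i` the value of the inverse is
irrelevant, by `hM`. -/
theorem innerRegular_map_invFun [Nonempty Y] {i : Y → X} (hi : IsEmbedding i)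
    (him : MeasurableEmbedding i) {b : K → X} (hb : Continuous b) (M : Measure K)
    [M.InnerRegular] (hM : ∀ᵐ k ∂M, b k ∈ Set.range i) :
    (M.map fun k => him.invFun (b k)).InnerRegular := by
  have hmeas : Measurable fun k => him.invFun (b k) := him.measurable_invFun.comp hb.measurable
  refine ⟨fun A hA r hr => ?_⟩
  rw [Measure.map_apply hmeas hA] at hr
  have hset : MeasurableSet (b ⁻¹' (i '' A)) := hb.measurable (him.measurableSet_image.2 hA)
  have heq : M ((fun k => him.invFun (b k)) ⁻¹' A) = M (b ⁻¹' (i '' A)) := by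
    refine measure_congr ?_
    filter_upwards [hM] with k hk
    obtain ⟨y, hy⟩ := hk
    change (him.invFun (b k) ∈ A) = (b k ∈ i '' A)
    rw [← hy, him.leftInverse_invFun y, him.injective.mem_set_image]
  rw [heq, hset.measure_eq_iSup_isCompact] at hr
  simp only [lt_iSup_iff] at hr
  obtain ⟨L, hL, hLc, hr⟩ := hr
  have hbL : b '' L ⊆ i '' A := Set.image_subset_iff.2 hL
  refine ⟨i ⁻¹' (b '' L), fun y hy => ?_, ?_, hr.trans_le ?_⟩
  · exact him.injective.mem_set_image.1 (hbL hy)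
  · rw [hi.isCompact_iff, Set.image_preimage_eq_of_subset (hbL.trans (Set.image_subset_range _ _))]
    exact hLc.image hb
  · rw [Measure.map_apply hmeas (hi.continuous.measurable (hLc.image hb).measurableSet)]
    refine measure_mono fun k hk => ?_
    obtain ⟨y, -, hy⟩ := hbL ⟨k, hk, rfl⟩
    change i (him.invFun (b k)) ∈ b '' L
    rw [← hy, him.leftInverse_invFun y, hy]
    exact ⟨k, hk, rfl⟩

end PushRadon

end GeneralizedFeller

namespace GeneralizedFeller

open scoped BoundedContinuousFunction ENNReal

/-! ### Riesz representation on compact spaces and for tight functionals. -/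

section CompactRiesz

variable {K : Type*} [TopologicalSpace K] [CompactSpace K] [T2Space K] [MeasurableSpace K]
  [BorelSpace K]

theorem exists_regular_of_functional (Λ : C(K, ℝ) →ₗ[ℝ] ℝ)
    (hΛ : ∀ F : C(K, ℝ), (∀ x, 0 ≤ F x) → 0 ≤ Λ F) :
    ∃ M : Measure K, IsFiniteMeasure M ∧ M.Regular ∧ ∀ F : C(K, ℝ), ∫ x, F x ∂M = Λ F := by
  let Λ' : CompactlySupportedContinuousMap K ℝ →ₚ[ℝ] ℝ := PositiveLinearMap.mk₀
    { toFun := fun F => Λ F.toContinuousMap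
      map_add' := fun F G => Λ.map_add F.toContinuousMap G.toContinuousMap
      map_smul' := fun c F => Λ.map_smul c F.toContinuousMap } fun F hF => hΛ _ hF
  refine ⟨RealRMK.rieszMeasure Λ', inferInstance, inferInstance, fun F => ?_⟩
  exact RealRMK.integral_rieszMeasure Λ' ⟨F, HasCompactSupport.of_compactSpace F⟩

theorem le_measureReal_of_isCompact {M : Measure K} [IsFiniteMeasure M] [M.Regular] {H : Set K}
    (hH : IsCompact H) {c : ℝ}
    (h : ∀ F : C(K, ℝ), (∀ x, F x ∈ Set.Icc (0 : ℝ) 1) → Set.EqOn F 1 H → c ≤ ∫ x, F x ∂M) :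
    c ≤ M.real H := by
  refine le_of_forall_pos_le_add fun ε hε => ?_
  obtain ⟨U, hHU, hU, hMU⟩ := H.exists_isOpen_lt_add (μ := M) (measure_ne_top _ _)
    (ε := ENNReal.ofReal ε) (by simpa using hε)
  obtain ⟨f, hf1, hf0, -, hf⟩ := exists_continuous_one_zero_of_isCompact hH hU.isClosed_compl
    (Set.disjoint_compl_right_iff_subset.2 hHU)
  refine (h f hf hf1).trans ?_
  have h2 : ∫ y, f y ∂M ≤ M.real U := by
    rw [← integral_indicator_one hU.measurableSet]
    refine integral_mono (f.continuous.integrable_of_hasCompactSupport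
      (HasCompactSupport.of_compactSpace f))
      ((integrable_const 1).indicator hU.measurableSet) fun y => ?_
    by_cases hy : y ∈ U
    · simp [hy, (hf y).2]
    · simp [hy, hf0 hy]
  refine h2.trans ?_
  have := ENNReal.toReal_mono (by finiteness) hMU.le
  rwa [ENNReal.toReal_add (measure_ne_top _ _) (by simp), ENNReal.toReal_ofReal hε.le] at this

end CompactRiesz

theorem exists_stoneCech_extension {Y : Type*} [TopologicalSpace Y] (f : Y →ᵇ ℝ) :
    ∃ F : C(StoneCech Y, ℝ), ∀ y, F (stoneCechUnit y) = f y := by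
  have hfc : ∀ y, f y ∈ Set.Icc (-‖f‖) ‖f‖ := fun y => abs_le.1 (f.norm_coe_le_norm y)
  let g : Y → Set.Icc (-‖f‖) ‖f‖ := fun y => ⟨f y, hfc y⟩
  have hg : Continuous g := f.continuous.subtype_mk _
  refine ⟨⟨fun x => (stoneCechExtend hg x : Set.Icc (-‖f‖) ‖f‖),
    continuous_subtype_val.comp (continuous_stoneCechExtend hg)⟩, fun y => ?_⟩
  change ((stoneCechExtend hg (stoneCechUnit y) : Set.Icc (-‖f‖) ‖f‖) : ℝ) = f y
  rw [stoneCechExtend_stoneCechUnit]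

section TightRiesz

variable {Y : Type*} [TopologicalSpace Y] [T35Space Y] [SigmaCompactSpace Y] [MeasurableSpace Y]
  [BorelSpace Y]

/-- By σ-compactness the range is a countable union of compact sets, hence Borel. -/
theorem measurableEmbedding_stoneCechUnit [MeasurableSpace (StoneCech Y)]
    [BorelSpace (StoneCech Y)] : MeasurableEmbedding (stoneCechUnit : Y → StoneCech Y) := by
  refine isEmbedding_stoneCechUnit.measurableEmbedding ?_
  rw [← Set.image_univ, ← iUnion_compactCovering, Set.image_iUnion]
  exact MeasurableSet.iUnion fun n =>
    ((isCompact_compactCovering Y n).image continuous_stoneCechUnit).measurableSet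

/-- Riesz representation on a completely regular σ-compact space: a tight positive functional on
the bounded continuous functions is the integral with respect to a finite Radon measure. -/
theorem exists_innerRegular_of_tight (l : (Y →ᵇ ℝ) →ₗ[ℝ] ℝ)
    (hpos : ∀ f : Y →ᵇ ℝ, (∀ y, 0 ≤ f y) → 0 ≤ l f)
    (htight : ∀ ε : ℝ, 0 < ε → ∃ C : Set Y, IsCompact C ∧
      ∀ f : Y →ᵇ ℝ, (∀ y, f y ∈ Set.Icc (0 : ℝ) 1) → Set.EqOn f 0 C → l f ≤ ε) :
    ∃ μ : Measure Y, IsFiniteMeasure μ ∧ μ.InnerRegular ∧ ∀ f : Y →ᵇ ℝ, ∫ y, f y ∂μ = l f := by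
  rcases isEmpty_or_nonempty Y with hY | hY
  · refine ⟨0, inferInstance, inferInstance, fun f => ?_⟩
    have : f = 0 := by
      ext y
      exact hY.elim y
    simp [this]
  let _ : MeasurableSpace (StoneCech Y) := borel _
  have : BorelSpace (StoneCech Y) := ⟨rfl⟩
  let ι : C(Y, StoneCech Y) := ⟨stoneCechUnit, continuous_stoneCechUnit⟩
  let res : C(StoneCech Y, ℝ) → (Y →ᵇ ℝ) := fun F =>
    (BoundedContinuousFunction.mkOfCompact F).compContinuous ι
  have hres : ∀ F y, res F y = F (ι y) := fun F y => rfl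
  let Λ : C(StoneCech Y, ℝ) →ₗ[ℝ] ℝ :=
    { toFun := fun F => l (res F)
      map_add' := fun F G => l.map_add (res F) (res G)
      map_smul' := fun c F => l.map_smul c (res F) }
  obtain ⟨M, hM, hMreg, hMint⟩ := exists_regular_of_functional Λ fun F hF =>
    hpos _ fun y => hF (ι y)
  have him := measurableEmbedding_stoneCechUnit (Y := Y)
  -- If `F = 1` on the image of the compact set `C`, then `1 - F` vanishes on `C`, so tightness
  -- bounds its integral by `ε`. Outer regularity then shows that the image of `C` carries all but
  -- `ε` of the mass.
  have hrange : ∀ᵐ k ∂M, k ∈ Set.range (stoneCechUnit : Y → StoneCech Y) := by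
    have hle : M Set.univ ≤ M (Set.range (stoneCechUnit : Y → StoneCech Y)) := by
      rw [← ENNReal.toReal_le_toReal (measure_ne_top _ _) (measure_ne_top _ _)]
      refine le_of_forall_pos_le_add fun ε hε => ?_
      obtain ⟨C, hC, hCl⟩ := htight ε hε
      have h1 := le_measureReal_of_isCompact (M := M) (hC.image continuous_stoneCechUnit)
        (c := M.real Set.univ - ε) fun F hF hF1 => by
          have h2 : Λ (1 - F) ≤ ε := hCl _ (fun y => by
            have := hF (ι y)
            simp only [hres, ContinuousMap.sub_apply, ContinuousMap.one_apply, Set.mem_Icc] at this ⊢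
            constructor <;> linarith [this.1, this.2]) fun y hy => by
            simp [hres, hF1 ⟨y, hy, rfl⟩, ι]
          rw [map_sub, ← hMint, ← hMint] at h2
          simp only [ContinuousMap.one_apply, integral_const, smul_eq_mul, mul_one] at h2
          linarith
      have h3 : M.real (stoneCechUnit '' C) ≤ M.real (Set.range (stoneCechUnit : Y → _)) :=
        measureReal_mono (Set.image_subset_range _ _)
      change M.real Set.univ ≤ M.real _ + ε
      linarith
    rw [ae_iff]
    change M (Set.range stoneCechUnit)ᶜ = 0
    rw [measure_compl him.measurableSet_range (measure_ne_top _ _), tsub_eq_zero_of_le hle]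
  have hreg := innerRegular_map_invFun isEmbedding_stoneCechUnit him continuous_id M hrange
  refine ⟨M.map fun k => him.invFun (id k), inferInstance, hreg, fun f => ?_⟩
  rw [integral_map (φ := fun k => him.invFun (id k)) him.measurable_invFun.aemeasurable
    f.continuous.measurable.aestronglyMeasurable]
  obtain ⟨F, hF⟩ := exists_stoneCech_extension f
  have h1 : ∫ k, f (him.invFun (id k)) ∂M = ∫ k, F k ∂M := by
    refine integral_congr_ae ?_
    filter_upwards [hrange] with k hk
    obtain ⟨y, rfl⟩ := hk
    rw [id, him.leftInverse_invFun y, hF]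
  rw [h1, hMint]
  change l (res F) = l f
  congr 1
  ext y
  exact hF y

end TightRiesz

end GeneralizedFeller

namespace GeneralizedFeller

open scoped BoundedContinuousFunction ENNReal

/-! ### The space `𝓑^ρ(E)`: evaluation, density of `C_b(E)`, measurability. -/

section Growth

variable {E : Type*} [TopologicalSpace E] {ρ : AdmissibleWeight E}

theorem abs_growthFun_le (f : controlledGrowth ρ) (x : E) : |growthFun f x| ≤ ‖f‖ * ρ x :=
  (div_le_iff₀ (ρ.pos x)).1 (f.1.le_norm x)

/-- Evaluation at `x` as a continuous linear functional on `𝓑^ρ(E)`. -/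
noncomputable def evalCLM (ρ : AdmissibleWeight E) (x : E) : controlledGrowth ρ →L[ℝ] ℝ :=
  LinearMap.mkContinuous
    { toFun := fun f => growthFun f x
      map_add' := fun _ _ => rfl
      map_smul' := fun _ _ => rfl } (ρ x) fun f => by
        rw [mul_comm]
        exact abs_growthFun_le f x

theorem growthFun_op_le (P : GeneralizedFellerSemigroup ρ) (t : ℝ≥0) (f : controlledGrowth ρ) (x : E) :
    growthFun (P.op t f) x ≤ ‖P.op t‖ * ‖f‖ * ρ x :=
  (le_abs_self _).trans ((abs_growthFun_le _ x).trans
    (mul_le_mul_of_nonneg_right ((P.op t).le_opNorm f) (ρ.pos x).le))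

/-- Compact sublevel sets are closed, so `ρ` is lower semicontinuous. The mass bound and the
regularity at `t = 0` both rest on this. -/
theorem AdmissibleWeight.isOpen_lt [T2Space E] (ρ : AdmissibleWeight E) {c : ℝ} (hc : 0 ≤ c) :
    IsOpen {x | c < ρ x} := by
  have := (ρ.isCompact_sublevel c hc).isClosed.isOpen_compl
  convert this using 1
  ext x
  simp

theorem AdmissibleWeight.sigmaCompactSpace (ρ : AdmissibleWeight E) : SigmaCompactSpace E :=
  ⟨⟨fun n => {x | ρ x ≤ n}, fun n => ρ.isCompact_sublevel n n.cast_nonneg,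
    Set.eq_univ_of_forall fun x => Set.mem_iUnion.2 (exists_nat_ge (ρ x))⟩⟩

variable [T2Space E]

/-- The inclusion of `C_b(E)` into `𝓑^ρ(E)`. -/
noncomputable def ofBCF (ρ : AdmissibleWeight E) : (E →ᵇ ℝ) →ₗ[ℝ] controlledGrowth ρ where
  toFun f := ⟨⟨f, bounded_mem_weightedBounded ρ ⟨‖f‖, f.norm_coe_le_norm⟩⟩,
    subset_closure ⟨f.continuous, ‖f‖, f.norm_coe_le_norm⟩⟩
  map_add' _ _ := rfl
  map_smul' _ _ := rfl

theorem norm_ofBCF_le {f : E →ᵇ ℝ} {C : ℝ} (hC : 0 ≤ C) (h : ∀ x, |f x| ≤ C * ρ x) :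
    ‖ofBCF ρ f‖ ≤ C :=
  WeightedBounded.norm_le_of hC fun x => (div_le_iff₀ (ρ.pos x)).2 (h x)

theorem exists_bcf_tendsto (f : controlledGrowth ρ) :
    ∃ u : ℕ → E →ᵇ ℝ, Tendsto (fun n => ofBCF ρ (u n)) atTop (𝓝 f) := by
  obtain ⟨u, hu, hlim⟩ := mem_closure_iff_seq_limit.1
    (show f.1 ∈ closure (boundedContinuousSubmodule ρ : Set (WeightedBounded ρ)) from f.2)
  choose hc C hC using hu
  refine ⟨fun n => BoundedContinuousFunction.ofNormedAddCommGroup (u n : E → ℝ) (hc n) (C n)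
    (hC n), tendsto_subtype_rng.2 hlim⟩

theorem measurable_baire_growthFun (f : controlledGrowth ρ) : Measurable[baire E] (growthFun f) := by
  obtain ⟨u, hu⟩ := exists_bcf_tendsto f
  let _ : MeasurableSpace E := baire E
  refine measurable_of_tendsto_metrizable (fun n => Continuous.measurable_baire (u n).continuous)
    (tendsto_pi_nhds.2 fun x => ?_)
  exact ((evalCLM ρ x).continuous.tendsto f).comp hu

theorem Represents.integral_bcf [MeasurableSpace E] {P : GeneralizedFellerSemigroup ρ} {t : ℝ≥0} {x : E}
    {μ : Measure E} (h : Represents P t x μ) (f : E →ᵇ ℝ) :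
    ∫ y, f y ∂μ = growthFun (P.op t (ofBCF ρ f)) x := h.integral_eq (ofBCF ρ f)

variable [MeasurableSpace E] [BorelSpace E]

theorem AdmissibleWeight.measurable (ρ : AdmissibleWeight E) : Measurable ρ := by
  refine measurable_of_Ioi fun c => ?_
  rcases le_or_gt 0 c with hc | hc
  · exact (ρ.isOpen_lt hc).measurableSet
  · convert MeasurableSet.univ
    exact Set.eq_univ_of_forall fun x => hc.trans (ρ.pos x)

theorem measurable_growthFun (f : controlledGrowth ρ) : Measurable (growthFun f) :=
  (measurable_baire_growthFun f).mono baire_le_borel le_rfl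

theorem integrable_growthFun {μ : Measure E} (hμ : Integrable ρ μ) (f : controlledGrowth ρ) :
    Integrable (growthFun f) μ :=
  (hμ.const_mul ‖f‖).mono' (measurable_growthFun f).aestronglyMeasurable
    (ae_of_all _ (abs_growthFun_le f))

theorem tendsto_integral_growthFun {μ : Measure E} (hμ : Integrable ρ μ) {f : controlledGrowth ρ}
    {u : ℕ → controlledGrowth ρ} (hu : Tendsto u atTop (𝓝 f)) :
    Tendsto (fun n => ∫ x, growthFun (u n) x ∂μ) atTop (𝓝 (∫ x, growthFun f x ∂μ)) := by
  obtain ⟨C, hC⟩ := hu.norm.bddAbove_range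
  refine tendsto_integral_of_dominated_convergence (fun x => C * ρ x)
    (fun n => (measurable_growthFun _).aestronglyMeasurable) (hμ.const_mul C)
    (fun n => ae_of_all _ fun x => (abs_growthFun_le _ x).trans ?_)
    (ae_of_all _ fun x => ((evalCLM ρ x).continuous.tendsto f).comp hu)
  exact mul_le_mul_of_nonneg_right (hC ⟨n, rfl⟩) (ρ.pos x).le

end Growth

/-! ### The representing measures `p(t)(x, ·)`. -/

section Representation

variable {E : Type*} [TopologicalSpace E] [T35Space E] [MeasurableSpace E] [BorelSpace E]
  {ρ : AdmissibleWeight E} (P : GeneralizedFellerSemigroup ρ)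

/-- Continuous `0 ≤ f ≤ ρ` have `ρ`-norm at most `1`, so their integrals are at most `‖P(t)‖ ρ(x)`.
Lower semicontinuity of `ρ` carries the bound over to `ρ` itself, which need not belong to `𝓑^ρ(E)`.
-/
theorem lintegral_weight_le {t : ℝ≥0} {x : E} {μ : Measure E} [IsFiniteMeasure μ] [μ.InnerRegular]
    (h : ∀ f : E →ᵇ ℝ, ∫ y, f y ∂μ = growthFun (P.op t (ofBCF ρ f)) x) :
    ∫⁻ y, ENNReal.ofReal (ρ y) ∂μ ≤ ENNReal.ofReal (‖P.op t‖ * ρ x) := by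
  refine lintegral_le_of_lowerSemicontinuous μ (fun y => (ρ.pos y).le)
    (fun c hc => ρ.isOpen_lt hc) fun f hf0 hf => ?_
  rw [h]
  refine (growthFun_op_le P t _ x).trans ?_
  refine mul_le_mul_of_nonneg_right ?_ (ρ.pos x).le
  refine mul_le_of_le_one_right (P.op t).opNorm_nonneg (norm_ofBCF_le zero_le_one fun y => ?_)
  rw [abs_of_nonneg (hf0 y), one_mul]
  exact hf y

theorem represents_of_integral_bcf {t : ℝ≥0} {x : E} {μ : Measure E} [hμ : IsFiniteMeasure μ]
    [hμr : μ.InnerRegular] (h : ∀ f : E →ᵇ ℝ, ∫ y, f y ∂μ = growthFun (P.op t (ofBCF ρ f)) x) :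
    Represents P t x μ := by
  have hint : Integrable ρ μ := by
    refine ⟨ρ.measurable.aestronglyMeasurable, ?_⟩
    rw [hasFiniteIntegral_iff_ofReal (ae_of_all _ fun y => (ρ.pos y).le)]
    exact (lintegral_weight_le P h).trans_lt ENNReal.ofReal_lt_top
  refine ⟨hμ, hμr, hint, fun f => ?_⟩
  obtain ⟨u, hu⟩ := exists_bcf_tendsto f
  refine tendsto_nhds_unique (tendsto_integral_growthFun hint hu) ?_
  have h2 : Tendsto (fun n => growthFun (P.op t (ofBCF ρ (u n))) x) atTop
      (𝓝 (growthFun (P.op t f) x)) :=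
    (((evalCLM ρ x).comp (P.op t)).continuous.tendsto f).comp hu
  exact h2.congr fun n => (h (u n)).symm

theorem exists_represents (t : ℝ≥0) (x : E) : ∃ μ : Measure E, Represents P t x μ := by
  have := ρ.sigmaCompactSpace
  let l : (E →ᵇ ℝ) →ₗ[ℝ] ℝ := (evalCLM ρ x).toLinearMap ∘ₗ (P.op t).toLinearMap ∘ₗ ofBCF ρ
  obtain ⟨μ, hμ, hμr, h⟩ := exists_innerRegular_of_tight l (fun f hf => P.positive t (ofBCF ρ f) hf x)
    fun ε hε => by
      set A := ‖P.op t‖ * ρ x with hA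
      have hA0 : 0 ≤ A := mul_nonneg (P.op t).opNorm_nonneg (ρ.pos x).le
      -- Off this set `1 ≤ ε / (A + 1) * ρ`, which gives norm at most `ε / (A + 1)`, and `P(t)`
      -- evaluated at `x` multiplies this by at most `A`. The `+ 1` covers `A = 0`.
      refine ⟨{y | ρ y ≤ (A + 1) / ε}, ρ.isCompact_sublevel _ (by positivity), fun f hf hf0 => ?_⟩
      have hn : ‖ofBCF ρ f‖ ≤ ε / (A + 1) := norm_ofBCF_le (by positivity) fun y => by
        by_cases hy : y ∈ {y | ρ y ≤ (A + 1) / ε}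
        · rw [hf0 hy]
          have := ρ.pos y
          simp only [Pi.zero_apply, abs_zero]
          positivity
        · have hy : (A + 1) / ε < ρ y := not_le.1 hy
          rw [abs_of_nonneg (hf y).1]
          refine (hf y).2.trans ?_
          rw [div_mul_eq_mul_div, le_div_iff₀ (by positivity)]
          rw [div_lt_iff₀ hε] at hy
          linarith
      change growthFun (P.op t (ofBCF ρ f)) x ≤ ε
      refine (growthFun_op_le P t _ x).trans ?_
      calc ‖P.op t‖ * ‖ofBCF ρ f‖ * ρ x = A * ‖ofBCF ρ f‖ := by rw [hA]; ring
        _ ≤ A * (ε / (A + 1)) := mul_le_mul_of_nonneg_left hn hA0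
        _ ≤ ε := by
          rw [mul_div_assoc', div_le_iff₀ (by positivity)]
          nlinarith
  exact ⟨μ, represents_of_integral_bcf P h⟩

theorem represents_kernel (t : ℝ≥0) (x : E) : Represents P t x (P.kernel t x) := by
  have h := exists_represents P t x
  rw [GeneralizedFellerSemigroup.kernel, dif_pos h]
  exact h.choose_spec

theorem Represents.eq_kernel {P : GeneralizedFellerSemigroup ρ} {t : ℝ≥0} {x : E}
    {μ : Measure E} (h : Represents P t x μ) : μ = P.kernel t x := by
  have hk := represents_kernel P t x
  have := h.isFiniteMeasure
  have := h.innerRegular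
  have := hk.isFiniteMeasure
  have := hk.innerRegular
  exact innerRegular_ext_of_integral_eq fun f => by rw [h.integral_bcf, hk.integral_bcf]

instance (t : ℝ≥0) (x : E) : IsFiniteMeasure (P.kernel t x) :=
  (represents_kernel P t x).isFiniteMeasure

theorem lintegral_weight_kernel_le (t : ℝ≥0) (x : E) :
    ∫⁻ y, ENNReal.ofReal (ρ y) ∂(P.kernel t x) ≤ ENNReal.ofReal (‖P.op t‖ * ρ x) := by
  have hk := represents_kernel P t x
  have := hk.innerRegular
  exact lintegral_weight_le P hk.integral_bcf

end Representation

end GeneralizedFeller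

namespace GeneralizedFeller

open scoped BoundedContinuousFunction ENNReal
open ProbabilityTheory

/-! ### The measures `p(t)(x, ·)` as a semigroup of kernels on Baire sets. -/

section BaireKernel

variable {E : Type*} [TopologicalSpace E] [T35Space E] [MeasurableSpace E] [BorelSpace E]
  {ρ : AdmissibleWeight E} (P : GeneralizedFellerSemigroup ρ)

omit [MeasurableSpace E] [BorelSpace E] in
theorem measurable_growthFun_fromBaire (f : controlledGrowth ρ) :
    Measurable fun y : BaireOf E => growthFun f (fromBaire y) := measurable_baire_growthFun f

/-- The measures `p(t)(x, ·)` as a kernel on the Baire sets. -/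
noncomputable def baireKernel (t : ℝ≥0) : Kernel (BaireOf E) (BaireOf E) where
  toFun x := (P.kernel t (fromBaire x)).map toBaire
  measurable' := by
    refine measurable_measure_baireOf fun F => ?_
    have : (fun x : BaireOf E => ∫ y, F (fromBaire y) ∂((P.kernel t (fromBaire x)).map toBaire)) =
        fun x => growthFun (P.op t (ofBCF ρ F)) (fromBaire x) := by
      funext x
      rw [integral_map measurable_toBaire.aemeasurable]
      · exact (represents_kernel P t _).integral_bcf F
      · exact (measurable_comp_fromBaire F).aestronglyMeasurable
    rw [this]
    exact measurable_growthFun_fromBaire _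

instance (t : ℝ≥0) (x : BaireOf E) : IsFiniteMeasure (baireKernel P t x) :=
  inferInstanceAs (IsFiniteMeasure ((P.kernel t (fromBaire x)).map toBaire))

theorem integral_baireKernel (t : ℝ≥0) (x : BaireOf E) (f : controlledGrowth ρ) :
    ∫ y, growthFun f (fromBaire y) ∂(baireKernel P t x) =
      growthFun (P.op t f) (fromBaire x) := by
  rw [← (represents_kernel P t (fromBaire x)).integral_eq]
  exact integral_map measurable_toBaire.aemeasurable
    (measurable_growthFun_fromBaire f).aestronglyMeasurable

theorem baireKernel_zero (x : BaireOf E) : baireKernel P 0 x = Measure.dirac x := by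
  refine measure_baireOf_ext fun F _ => ?_
  rw [integral_dirac' _ _ (measurable_comp_fromBaire F).stronglyMeasurable]
  have := integral_baireKernel P 0 x (ofBCF ρ F)
  rw [P.op_zero] at this
  exact this

theorem integrable_growthFun_baireKernel (t : ℝ≥0) (x : BaireOf E) (f : controlledGrowth ρ) :
    Integrable (fun y => growthFun f (fromBaire y)) (baireKernel P t x) := by
  refine (integrable_map_measure ?_ measurable_toBaire.aemeasurable).2 ?_
  · exact (measurable_growthFun_fromBaire f).aestronglyMeasurable
  · exact integrable_growthFun (represents_kernel P t (fromBaire x)).integrable_weight f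

theorem lintegral_growthFun_baireKernel (t : ℝ≥0) (x : BaireOf E) {f : controlledGrowth ρ}
    (hf : ∀ y, 0 ≤ growthFun f y) :
    ∫⁻ y, ENNReal.ofReal (growthFun f (fromBaire y)) ∂(baireKernel P t x) =
      ENNReal.ofReal (growthFun (P.op t f) (fromBaire x)) := by
  rw [← integral_baireKernel, ofReal_integral_eq_lintegral_ofReal
    (integrable_growthFun_baireKernel P t x f) (ae_of_all _ fun y => hf _)]

/-- This is the semigroup law tested on nonnegative bounded continuous functions. Lower integrals
are used because the composed measure is not yet known to be finite; its finiteness is read off from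
the constant `1`. -/
theorem baireKernel_add (s t : ℝ≥0) (x : BaireOf E) :
    baireKernel P (s + t) x = (baireKernel P s x).bind (baireKernel P t) := by
  have key : ∀ F : E →ᵇ ℝ, (∀ y, 0 ≤ F y) →
      ∫⁻ y, ENNReal.ofReal (F (fromBaire y)) ∂((baireKernel P s x).bind (baireKernel P t)) =
        ENNReal.ofReal (growthFun (P.op (s + t) (ofBCF ρ F)) (fromBaire x)) := fun F hF => by
    rw [Measure.lintegral_bind (baireKernel P t).measurable.aemeasurable
      (measurable_comp_fromBaire F).ennreal_ofReal.aemeasurable]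
    have h1 : ∀ y, ∫⁻ z, ENNReal.ofReal (F (fromBaire z)) ∂(baireKernel P t y) =
        ENNReal.ofReal (growthFun (P.op t (ofBCF ρ F)) (fromBaire y)) := fun y =>
      lintegral_growthFun_baireKernel P t y (f := ofBCF ρ F) hF
    simp_rw [h1]
    rw [lintegral_growthFun_baireKernel P s x (P.positive t (ofBCF ρ F) hF), add_comm s t, P.op_add]
    rfl
  have hfin : IsFiniteMeasure ((baireKernel P s x).bind (baireKernel P t)) := by
    constructor
    have := key (BoundedContinuousFunction.const E 1) fun _ => zero_le_one
    simp only [BoundedContinuousFunction.const_apply, ENNReal.ofReal_one, lintegral_one] at this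
    rw [this]
    exact ENNReal.ofReal_lt_top
  refine measure_baireOf_ext fun F hF => ?_
  symm
  rw [integral_eq_lintegral_of_nonneg_ae (ae_of_all _ fun y => hF _)
    (measurable_comp_fromBaire F).aestronglyMeasurable, key F hF,
    ENNReal.toReal_ofReal (P.positive _ (ofBCF ρ F) hF _)]
  exact (integral_baireKernel P (s + t) x (ofBCF ρ F)).symm

end BaireKernel

/-! ### Baire sets of `E ∪ {Δ}`. -/

section Cemetery

variable {E Z : Type*} [TopologicalSpace E] [MeasurableSpace Z]

/-- The inclusion of `E` into `E ∪ {Δ}`, with Baire σ-algebras. -/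
def baireInl : BaireOf E → BaireOf (WithCemetery E) := fun x => toBaire (Sum.inl (fromBaire x))

theorem measurable_baireInl : Measurable (baireInl : BaireOf E → _) :=
  Continuous.measurable_baire_baire (Y := E) (Z := WithCemetery E) continuous_inl

/-- Since `Δ` is isolated, a continuous function on `E` extended by `0` stays continuous, so cozero
sets map to cozero sets. The rest is induction over the generated σ-algebra, with complements taken
inside the image of `E`. -/
theorem measurableSet_baire_inl_image {A : Set E} (hA : MeasurableSet[baire E] A) :
    MeasurableSet[baire (WithCemetery E)] (Sum.inl '' A) := by
  have hcoz : ∀ F : E →ᵇ ℝ, MeasurableSet[baire (WithCemetery E)] (Sum.inl '' {x | 0 < F x}) := by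
    intro F
    have hg : Continuous (Sum.elim F fun _ => 0 : WithCemetery E → ℝ) :=
      F.continuous.sumElim continuous_const
    have : Sum.inl '' {x | 0 < F x} = (Sum.elim F fun _ => 0 : WithCemetery E → ℝ) ⁻¹' Set.Ioi 0 := by
      ext (x | x) <;> simp
    rw [this]
    exact Continuous.measurable_baire hg measurableSet_Ioi
  have huniv : MeasurableSet[baire (WithCemetery E)] (Sum.inl '' (Set.univ : Set E)) := by
    simpa using hcoz (BoundedContinuousFunction.const E 1)
  rw [baire_eq_generateFrom] at hA
  induction A, hA using MeasurableSpace.generateFrom_induction with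
  | hC A hA _ =>
    obtain ⟨F, rfl⟩ := hA
    exact hcoz F
  | empty => simp
  | compl A _ ih =>
    have : Sum.inl '' Aᶜ = (Sum.inl '' Set.univ) \ (Sum.inl '' A : Set (WithCemetery E)) := by
      rw [← Set.image_sdiff Sum.inl_injective, Set.compl_eq_univ_sdiff]
    rw [this]
    exact MeasurableSet.diff huniv ih
  | iUnion f _ ih =>
    rw [Set.image_iUnion]
    exact MeasurableSet.iUnion ih

theorem measurable_baire_withCemetery {f : BaireOf (WithCemetery E) → Z}
    (hf : Measurable fun x => f (baireInl x)) : Measurable f := by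
  intro A hA
  have h1 : MeasurableSet[baire (WithCemetery E)] (Sum.inl '' ((fun x => f (baireInl x)) ⁻¹' A)) :=
    measurableSet_baire_inl_image (hf hA)
  have h0 : MeasurableSet[baire (WithCemetery E)] (Sum.inl '' (Set.univ : Set E))ᶜ :=
    (measurableSet_baire_inl_image MeasurableSet.univ).compl
  change MeasurableSet[baire (WithCemetery E)] ((fun z : WithCemetery E => f (toBaire z)) ⁻¹' A)
  by_cases hΔ : f (toBaire (Sum.inr ())) ∈ A
  · convert MeasurableSet.union h1 h0 using 1
    ext (x | x)
    · simp [baireInl, toBaire, fromBaire, id]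
    · simpa using hΔ
  · convert h1 using 1
    ext (x | x)
    · simp [baireInl, toBaire, fromBaire, id]
    · simpa using hΔ

end Cemetery

end GeneralizedFeller

namespace GeneralizedFeller

open scoped BoundedContinuousFunction ENNReal
open ProbabilityTheory

/-! ### The kernels `e^{-ct} ρ(y) p(t)(x, dy) / ρ(x)`. -/

section WeightedKernel

variable {E : Type*} [TopologicalSpace E] [T35Space E] [MeasurableSpace E] [BorelSpace E]
  {ρ : AdmissibleWeight E} (P : GeneralizedFellerSemigroup ρ) (c : ℝ)

/-- The sub-probability measure `e^{-ct} ρ(y) p(t)(x, dy) / ρ(x)` on the Baire sets. -/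
noncomputable def weightedMeasure (t : ℝ≥0) (x : BaireOf E) : Measure (BaireOf E) :=
  ENNReal.ofReal (Real.exp (-c * t) / ρ (fromBaire x)) •
    (baireKernel P t x).withDensity fun y => ENNReal.ofReal (ρ (fromBaire y))

variable {P c} (hρ : Measurable[baire E] ρ)

include hρ in
theorem lintegral_weightedMeasure (t : ℝ≥0) (x : BaireOf E) {f : BaireOf E → ℝ≥0∞}
    (hf : Measurable f) : ∫⁻ y, f y ∂(weightedMeasure P c t x) =
      ENNReal.ofReal (Real.exp (-c * t) / ρ (fromBaire x)) *
        ∫⁻ y, ENNReal.ofReal (ρ (fromBaire y)) * f y ∂(baireKernel P t x) := by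
  have hρ' : Measurable fun y : BaireOf E => ENNReal.ofReal (ρ (fromBaire y)) :=
    (show Measurable fun y : BaireOf E => ρ (fromBaire y) from hρ).ennreal_ofReal
  rw [weightedMeasure, lintegral_smul_measure, lintegral_withDensity_eq_lintegral_mul _ hρ' hf]
  rfl

include hρ in
theorem measurable_weightedMeasure (t : ℝ≥0) : Measurable (weightedMeasure P c t) := by
  have hρ' : Measurable fun y : BaireOf E => ρ (fromBaire y) := hρ
  refine Measure.measurable_of_measurable_coe _ fun A hA => ?_
  have : (fun x => weightedMeasure P c t x A) = fun x =>
      ENNReal.ofReal (Real.exp (-c * t) / ρ (fromBaire x)) *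
        ∫⁻ y, ENNReal.ofReal (ρ (fromBaire y)) * A.indicator 1 y ∂(baireKernel P t x) := by
    funext x
    rw [← lintegral_indicator_one hA]
    exact lintegral_weightedMeasure hρ t x (measurable_one.indicator hA)
  rw [this]
  exact (measurable_const.div hρ').ennreal_ofReal.mul ((Measure.measurable_lintegral
    (hρ'.ennreal_ofReal.mul (measurable_one.indicator hA))).comp (baireKernel P t).measurable)

variable (hc : ∀ t : ℝ≥0, ‖P.op t‖ ≤ Real.exp (c * t))

include hρ hc in
-- The bound `∫ ρ dp(t)(x, ·) ≤ e^{ct} ρ(x)` cancels exactly against the normalisation. The growth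
-- assumption on `‖P(t)‖` is used here.
theorem weightedMeasure_univ_le (t : ℝ≥0) (x : BaireOf E) :
    weightedMeasure P c t x Set.univ ≤ 1 := by
  have hx := ρ.pos (fromBaire x)
  rw [← lintegral_one, lintegral_weightedMeasure hρ t x (f := fun _ => 1) measurable_const]
  simp only [mul_one]
  have h1 : ∫⁻ y, ENNReal.ofReal (ρ (fromBaire y)) ∂(baireKernel P t x) ≤
      ENNReal.ofReal (Real.exp (c * t) * ρ (fromBaire x)) := by
    refine le_trans ?_ ((lintegral_weight_kernel_le P t (fromBaire x)).trans
      (ENNReal.ofReal_le_ofReal (mul_le_mul_of_nonneg_right (hc t) hx.le)))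
    exact lintegral_map_le _ _
  calc _ ≤ ENNReal.ofReal (Real.exp (-c * t) / ρ (fromBaire x)) *
        ENNReal.ofReal (Real.exp (c * t) * ρ (fromBaire x)) := mul_le_mul_right h1 _
    _ = 1 := by
      rw [← ENNReal.ofReal_mul (by positivity)]
      have : Real.exp (-c * t) / ρ (fromBaire x) * (Real.exp (c * t) * ρ (fromBaire x)) = 1 := by
        rw [div_mul_eq_mul_div, ← mul_assoc, ← Real.exp_add, mul_div_cancel_right₀ _ hx.ne']
        simp
      rw [this, ENNReal.ofReal_one]

include hρ in
theorem weightedMeasure_zero (x : BaireOf E) : weightedMeasure P c 0 x = Measure.dirac x := by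
  have hx := ρ.pos (fromBaire x)
  have hρ' : Measurable fun y : BaireOf E => ENNReal.ofReal (ρ (fromBaire y)) :=
    (show Measurable fun y : BaireOf E => ρ (fromBaire y) from hρ).ennreal_ofReal
  refine Measure.ext_of_lintegral _ fun f hf => ?_
  have hm : Measurable fun y => ENNReal.ofReal (ρ (fromBaire y)) * f y := hρ'.mul hf
  rw [lintegral_weightedMeasure hρ 0 x hf, baireKernel_zero, lintegral_dirac' _ hm,
    lintegral_dirac' _ hf, ← mul_assoc, ← ENNReal.ofReal_mul (by positivity)]
  simp [hx.ne']

include hρ in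
-- The density `ρ(y)` of the first step cancels the factor `1 / ρ(y)` of the second and the
-- exponentials multiply, so the semigroup law of `p` is inherited.
theorem lintegral_weightedMeasure_add (s t : ℝ≥0) (x : BaireOf E) {f : BaireOf E → ℝ≥0∞}
    (hf : Measurable f) : ∫⁻ y, f y ∂(weightedMeasure P c (s + t) x) =
      ∫⁻ y, ∫⁻ z, f z ∂(weightedMeasure P c t y) ∂(weightedMeasure P c s x) := by
  have hρ' : Measurable fun y : BaireOf E => ENNReal.ofReal (ρ (fromBaire y)) :=
    (show Measurable fun y : BaireOf E => ρ (fromBaire y) from hρ).ennreal_ofReal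
  have hm : Measurable fun y => ∫⁻ z, f z ∂(weightedMeasure P c t y) :=
    (Measure.measurable_lintegral hf).comp (measurable_weightedMeasure hρ t)
  have hm1 : Measurable fun y => ENNReal.ofReal (ρ (fromBaire y)) * f y := hρ'.mul hf
  have hm2 : Measurable fun y => ∫⁻ z, ENNReal.ofReal (ρ (fromBaire z)) * f z
      ∂(baireKernel P t y) :=
    (Measure.measurable_lintegral hm1).comp (baireKernel P t).measurable
  have h1 : ∀ y, ENNReal.ofReal (ρ (fromBaire y)) * ∫⁻ z, f z ∂(weightedMeasure P c t y) =
      ENNReal.ofReal (Real.exp (-c * t)) *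
        ∫⁻ z, ENNReal.ofReal (ρ (fromBaire z)) * f z ∂(baireKernel P t y) := fun y => by
    have hy := ρ.pos (fromBaire y)
    rw [lintegral_weightedMeasure hρ t y hf, ← mul_assoc, ← ENNReal.ofReal_mul hy.le,
      mul_div_cancel₀ _ hy.ne']
  rw [lintegral_weightedMeasure hρ s x hm]
  simp_rw [h1]
  rw [lintegral_const_mul _ hm2, lintegral_weightedMeasure hρ (s + t) x hf, baireKernel_add,
    Measure.lintegral_bind (baireKernel P t).measurable.aemeasurable hm1.aemeasurable,
    ← mul_assoc, ← ENNReal.ofReal_mul (div_nonneg (Real.exp_pos _).le (ρ.pos _).le),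
    div_mul_eq_mul_div, ← Real.exp_add]
  congr 4
  push_cast
  ring

end WeightedKernel

/-! ### The Markov semigroup on `E ∪ {Δ}`. -/

section CemeteryKernel

variable {E : Type*} [TopologicalSpace E] [T35Space E] [MeasurableSpace E] [BorelSpace E]
  {ρ : AdmissibleWeight E} (P : GeneralizedFellerSemigroup ρ) (c : ℝ)
  (hρ : Measurable[baire E] ρ)

/-- The cemetery state. -/
def cemetery (E : Type*) : BaireOf (WithCemetery E) := toBaire (Sum.inr ())

/-- The transition kernel on `E ∪ {Δ}` with weighted measures on `E`, the missing mass being sent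
to `Δ`. -/
noncomputable def cemeteryKernel (t : ℝ≥0) :
    Kernel (BaireOf (WithCemetery E)) (BaireOf (WithCemetery E)) where
  toFun z := Sum.elim (fun x : E => (weightedMeasure P c t (toBaire x)).map baireInl +
    (1 - weightedMeasure P c t (toBaire x) Set.univ) • Measure.dirac (cemetery E))
    (fun _ => Measure.dirac (cemetery E)) (fromBaire z)
  measurable' := by
    refine measurable_baire_withCemetery ?_
    have hm := measurable_weightedMeasure (P := P) (c := c) hρ t
    refine Measure.measurable_of_measurable_coe _ fun A hA => ?_
    change Measurable fun x : BaireOf E => ((weightedMeasure P c t x).map baireInl +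
      (1 - weightedMeasure P c t x Set.univ) • Measure.dirac (cemetery E)) A
    simp only [Measure.add_apply, Measure.smul_apply, Measure.map_apply measurable_baireInl hA,
      smul_eq_mul]
    exact ((Measure.measurable_coe (measurable_baireInl hA)).comp hm).add
      ((measurable_const.sub ((Measure.measurable_coe MeasurableSet.univ).comp hm)).mul_const _)

theorem cemeteryKernel_baireInl (t : ℝ≥0) (x : BaireOf E) :
    cemeteryKernel P c hρ t (baireInl x) = (weightedMeasure P c t x).map baireInl +
      (1 - weightedMeasure P c t x Set.univ) • Measure.dirac (cemetery E) := rfl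

theorem cemeteryKernel_cemetery (t : ℝ≥0) :
    cemeteryKernel P c hρ t (cemetery E) = Measure.dirac (cemetery E) := rfl

omit [TopologicalSpace E] [T35Space E] [MeasurableSpace E] [BorelSpace E] in
theorem withCemetery_cases {p : BaireOf (WithCemetery E) → Prop} (h : ∀ x, p (baireInl x))
    (h0 : p (cemetery E)) (z : BaireOf (WithCemetery E)) : p z := by
  rcases z with x | x
  · exact h x
  · exact h0

variable {P c} (hc : ∀ t : ℝ≥0, ‖P.op t‖ ≤ Real.exp (c * t))

include hc in
theorem isMarkovKernel_cemeteryKernel (t : ℝ≥0) : IsMarkovKernel (cemeteryKernel P c hρ t) := by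
  refine ⟨withCemetery_cases (fun x => ⟨?_⟩) ?_⟩
  · rw [cemeteryKernel_baireInl, Measure.add_apply,
      Measure.map_apply measurable_baireInl MeasurableSet.univ, Measure.smul_apply]
    simp only [Set.preimage_univ, measure_univ, smul_eq_mul, mul_one]
    exact add_tsub_cancel_of_le (weightedMeasure_univ_le hρ hc t x)
  · rw [cemeteryKernel_cemetery]
    infer_instance

theorem lintegral_cemeteryKernel_baireInl (t : ℝ≥0) (x : BaireOf E)
    {f : BaireOf (WithCemetery E) → ℝ≥0∞} (hf : Measurable f) (hf0 : f (cemetery E) = 0) :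
    ∫⁻ z, f z ∂(cemeteryKernel P c hρ t (baireInl x)) =
      ∫⁻ y, f (baireInl y) ∂(weightedMeasure P c t x) := by
  rw [cemeteryKernel_baireInl, lintegral_add_measure, lintegral_smul_measure,
    lintegral_dirac' _ hf, hf0, lintegral_map hf measurable_baireInl]
  simp

theorem cemeteryKernel_zero (z : BaireOf (WithCemetery E)) :
    cemeteryKernel P c hρ 0 z = Measure.dirac z := by
  revert z
  refine withCemetery_cases (fun x => ?_) (cemeteryKernel_cemetery P c hρ 0)
  rw [cemeteryKernel_baireInl, weightedMeasure_zero hρ, Measure.map_dirac' measurable_baireInl]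
  simp

include hc in
theorem cemeteryKernel_add (s t : ℝ≥0) :
    cemeteryKernel P c hρ (s + t) = cemeteryKernel P c hρ t ∘ₖ cemeteryKernel P c hρ s := by
  have hM := isMarkovKernel_cemeteryKernel hρ hc
  -- On sets missing `Δ` only the weighted measures contribute. Sets containing `Δ` follow by
  -- complements, both sides being probability measures.
  have key : ∀ (z : BaireOf (WithCemetery E)) (A : Set (BaireOf (WithCemetery E))),
      MeasurableSet A → cemetery E ∉ A → cemeteryKernel P c hρ (s + t) z A =
        (cemeteryKernel P c hρ t ∘ₖ cemeteryKernel P c hρ s) z A := by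
    intro z A hA hΔ
    rw [Kernel.comp_apply' _ _ _ hA]
    have hA0 : ∀ r, cemeteryKernel P c hρ r (cemetery E) A = 0 := fun r => by
      rw [cemeteryKernel_cemetery, Measure.dirac_apply' _ hA, Set.indicator_of_notMem hΔ]
    revert z
    refine withCemetery_cases (fun x => ?_) ?_
    · have hind : Measurable (A.indicator (1 : BaireOf (WithCemetery E) → ℝ≥0∞)) :=
        measurable_one.indicator hA
      have hind0 : A.indicator (1 : BaireOf (WithCemetery E) → ℝ≥0∞) (cemetery E) = 0 :=
        Set.indicator_of_notMem hΔ _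
      rw [lintegral_cemeteryKernel_baireInl hρ s x
        (Kernel.measurable_coe _ hA) (hA0 t)]
      simp_rw [← lintegral_indicator_one hA]
      rw [lintegral_cemeteryKernel_baireInl hρ (s + t) x hind hind0,
        lintegral_weightedMeasure_add hρ s t x (f := fun y => A.indicator 1 (baireInl y))
          (hind.comp measurable_baireInl)]
      simp_rw [lintegral_cemeteryKernel_baireInl hρ t _ hind hind0]
    · rw [hA0, cemeteryKernel_cemetery, lintegral_dirac' _
        (Kernel.measurable_coe _ hA)]
      exact (hA0 t).symm
  refine Kernel.ext fun z => Measure.ext fun A hA => ?_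
  by_cases hΔ : cemetery E ∈ A
  · have h1 := key z Aᶜ hA.compl (fun h => h hΔ)
    rwa [prob_compl_eq_one_sub hA, prob_compl_eq_one_sub hA,
      ENNReal.sub_right_inj ENNReal.one_ne_top prob_le_one prob_le_one] at h1
  · exact key z A hA hΔ

include hc in
-- The mass at `Δ` does not contribute because `f(Δ) = 0`. This identifies the transition operator
-- with the quotient in the main statement.
theorem integral_cemeteryKernel (t : ℝ≥0) {f : WithCemetery E → ℝ} (hf : IsTestFunction f)
    (z : BaireOf (WithCemetery E)) :
    ∫ y, f (fromBaire y) ∂(cemeteryKernel P c hρ t z) =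
      Real.exp (-c * t) * P.quotient t f (fromBaire z) := by
  have hfm : Measurable fun y : BaireOf (WithCemetery E) => f (fromBaire y) := hf.measurable
  obtain ⟨C, hC⟩ := hf.bounded
  revert z
  refine withCemetery_cases (fun x => ?_) ?_
  · have hρ' : Measurable fun y : BaireOf E => ρ (fromBaire y) := hρ
    have hx := ρ.pos (fromBaire x)
    have hint : ∫ y, f (fromBaire (baireInl y)) ∂(weightedMeasure P c t x) =
        Real.exp (-c * t) / ρ (fromBaire x) *
          P.extend t (fun y => f (Sum.inl y) * ρ y) (fromBaire x) := by
      rw [weightedMeasure, integral_smul_measure, integral_withDensity_eq_integral_toReal_smul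
        hρ'.ennreal_ofReal (ae_of_all _ fun _ => ENNReal.ofReal_lt_top),
        ENNReal.toReal_ofReal (by positivity), smul_eq_mul]
      congr 1
      rw [GeneralizedFellerSemigroup.extend]
      have h2 : (fun y : BaireOf E => (ENNReal.ofReal (ρ (fromBaire y))).toReal •
          f (fromBaire (baireInl y))) =
          fun y => f (fromBaire (baireInl y)) * ρ (fromBaire y) := by
        funext y
        rw [ENNReal.toReal_ofReal (ρ.pos _).le, smul_eq_mul, mul_comm]
      rw [h2]
      exact integral_map measurable_toBaire.aemeasurable
        ((hfm.comp measurable_baireInl).mul hρ').aestronglyMeasurable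
    have hle := weightedMeasure_univ_le hρ hc t x
    have hfin : IsFiniteMeasure (weightedMeasure P c t x) := ⟨hle.trans_lt ENNReal.one_lt_top⟩
    have hbd : ∀ μ : Measure (BaireOf (WithCemetery E)), IsFiniteMeasure μ →
        Integrable (fun y => f (fromBaire y)) μ := fun μ _ =>
      Integrable.of_bound hfm.aestronglyMeasurable C (ae_of_all _ fun y => hC _)
    have hΔ : f (fromBaire (cemetery E)) = 0 := hf.cemetery
    have hfin2 : IsFiniteMeasure ((1 - weightedMeasure P c t x Set.univ) •
        Measure.dirac (cemetery E)) :=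
      Measure.smul_finite _ (ne_top_of_le_ne_top ENNReal.one_ne_top tsub_le_self)
    rw [cemeteryKernel_baireInl, integral_add_measure (hbd _ inferInstance) (hbd _ hfin2),
      integral_smul_measure, integral_dirac' _ _ hfm.stronglyMeasurable, hΔ, smul_zero, add_zero,
      integral_map measurable_baireInl.aemeasurable hfm.aestronglyMeasurable, hint,
      div_mul_eq_mul_div, mul_div_assoc]
    rfl
  · rw [cemeteryKernel_cemetery, integral_dirac' _ _ hfm.stronglyMeasurable]
    change f (Sum.inr ()) = _ * 0
    rw [hf.cemetery, mul_zero]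

end CemeteryKernel

end GeneralizedFeller

namespace GeneralizedFeller

open scoped BoundedContinuousFunction ENNReal
open ProbabilityTheory

/-! ### Measures that agree on a sub-σ-algebra. -/

section SigmaAlgebras

variable {Ω : Type*} {m₁ m₂ m₀ : MeasurableSpace Ω}

theorem measure_eq_on_sup {μ ν : Measure[m₀] Ω} [IsFiniteMeasure μ] (h₁ : m₁ ≤ m₀) (h₂ : m₂ ≤ m₀)
    (h : ∀ A B, MeasurableSet[m₁] A → MeasurableSet[m₂] B → μ (A ∩ B) = ν (A ∩ B)) {A : Set Ω}
    (hA : MeasurableSet[m₁ ⊔ m₂] A) : μ A = ν A := by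
  let C : Set (Set Ω) := {s | ∃ A B, MeasurableSet[m₁] A ∧ MeasurableSet[m₂] B ∧ s = A ∩ B}
  refine ext_on_measurableSpace_of_generate_finite m₀ C ?_ (sup_le h₁ h₂) ?_ ?_ ?_ hA
  · rintro _ ⟨A, B, hA, hB, rfl⟩
    exact h A B hA hB
  · apply le_antisymm
    · refine sup_le (fun A hA => ?_) fun B hB => ?_
      · exact MeasurableSpace.measurableSet_generateFrom
          ⟨A, Set.univ, hA, MeasurableSet.univ, (Set.inter_univ A).symm⟩
      · exact MeasurableSpace.measurableSet_generateFrom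
          ⟨Set.univ, B, MeasurableSet.univ, hB, (Set.univ_inter B).symm⟩
    · refine MeasurableSpace.generateFrom_le ?_
      rintro _ ⟨A, B, hA, hB, rfl⟩
      exact MeasurableSet.inter (le_sup_left (a := m₁) (b := m₂) A hA)
        (le_sup_right (a := m₁) (b := m₂) B hB)
  · rintro _ ⟨A, B, hA, hB, rfl⟩ _ ⟨A', B', hA', hB', rfl⟩ -
    exact ⟨A ∩ A', B ∩ B', hA.inter hA', hB.inter hB', Set.inter_inter_inter_comm A B A' B'⟩
  · simpa using h Set.univ Set.univ MeasurableSet.univ MeasurableSet.univ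

theorem lintegral_eq_of_measure_eq_on {μ ν : Measure[m₀] Ω} (h₁ : m₁ ≤ m₀)
    (h : ∀ A, MeasurableSet[m₁] A → μ A = ν A) {f : Ω → ℝ≥0∞} (hf : Measurable[m₁] f) :
    ∫⁻ ω, f ω ∂μ = ∫⁻ ω, f ω ∂ν := by
  rw [← lintegral_trim h₁ hf, ← lintegral_trim h₁ hf]
  congr 1
  refine @Measure.ext _ m₁ _ _ fun A hA => ?_
  rw [trim_measurableSet_eq h₁ hA, trim_measurableSet_eq h₁ hA, h A hA]

theorem setLIntegral_eq_of_measure_eq_on {μ ν : Measure[m₀] Ω} (h₁ : m₁ ≤ m₀)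
    (h : ∀ A, MeasurableSet[m₁] A → μ A = ν A) {f : Ω → ℝ≥0∞} (hf : Measurable[m₁] f)
    {A : Set Ω} (hA : MeasurableSet[m₁] A) :
    ∫⁻ ω in A, f ω ∂μ = ∫⁻ ω in A, f ω ∂ν := by
  rw [← lintegral_indicator (h₁ A hA), ← lintegral_indicator (h₁ A hA)]
  exact lintegral_eq_of_measure_eq_on h₁ h (hf.indicator hA)

/-- A transition identity for sets gives one for functions. -/
theorem setLIntegral_comp_eq_of_transition {B₁ B₂ : Type*} [MeasurableSpace B₁]
    [MeasurableSpace B₂] {μ : Measure[m₀] Ω} {A : Set Ω} {X : Ω → B₂}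
    {W : Ω → B₁} (hX : Measurable X) (hW : Measurable W) {κ : Kernel B₁ B₂}
    (h : ∀ D, MeasurableSet D → μ (A ∩ X ⁻¹' D) = ∫⁻ ω in A, κ (W ω) D ∂μ) {f : B₂ → ℝ≥0∞}
    (hf : Measurable f) :
    ∫⁻ ω in A, f (X ω) ∂μ = ∫⁻ ω in A, ∫⁻ y, f y ∂(κ (W ω)) ∂μ := by
  have hκ : Measurable fun ω => κ (W ω) := κ.measurable.comp hW
  have : (μ.restrict A).map X = (μ.restrict A).bind fun ω => κ (W ω) := by
    refine Measure.ext fun D hD => ?_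
    rw [Measure.map_apply hX hD, Measure.bind_apply hD hκ.aemeasurable,
      Measure.restrict_apply (hX hD), Set.inter_comm, h D hD]
  rw [← lintegral_map hf hX, this, Measure.lintegral_bind hκ.aemeasurable hf.aemeasurable]

/-- The sets that do not distinguish points related by `r`. -/
@[reducible] def saturatedSpace {Ω : Type*} (r : Ω → Ω → Prop) : MeasurableSpace Ω where
  MeasurableSet' A := ∀ x y, r x y → (x ∈ A ↔ y ∈ A)
  measurableSet_empty := fun _ _ _ => Iff.rfl
  measurableSet_compl := fun _ hA x y hxy => not_congr (hA x y hxy)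
  measurableSet_iUnion := fun f hf x y hxy => by
    simp only [Set.mem_iUnion]
    exact exists_congr fun n => hf n x y hxy

end SigmaAlgebras

/-! ### Finite-time Markov laws, Borel at time `0` and Baire at other times. -/

section Mixed

variable {Y : Type*} [TopologicalSpace Y] [MeasurableSpace Y]

/-- Paths in `Y`, with the Borel σ-algebra at time `0` and the Baire σ-algebra at all other
times. -/
def MixedPath (Y : Type*) : Type _ := ℝ≥0 → Y

/-- The value of a path at time `u`. -/
def ev (u : ℝ≥0) (ω : MixedPath Y) : Y := ω u

/-- The value of a path at time `u`, in the copy of `Y` with the Baire σ-algebra. -/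
def bev (u : ℝ≥0) (ω : MixedPath Y) : BaireOf Y := toBaire (ev u ω)

/-- The σ-algebra generated by the Borel sets at time `0` and the Baire sets at the times in
`J`. -/
@[reducible] def pastSigma (Y : Type*) [TopologicalSpace Y] [MeasurableSpace Y] (J : Set ℝ≥0) :
    MeasurableSpace (MixedPath Y) :=
  MeasurableSpace.comap (ev 0) inferInstance ⊔
    ⨆ u ∈ J, MeasurableSpace.comap (bev (Y := Y) u) inferInstance

theorem pastSigma_mono {J J' : Set ℝ≥0} (h : J ⊆ J') : pastSigma Y J ≤ pastSigma Y J' :=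
  sup_le_sup_left (biSup_mono h) _

theorem measurable_pastSigma_zero {J : Set ℝ≥0} :
    Measurable[pastSigma Y J] (ev (Y := Y) 0) :=
  measurable_iff_comap_le.2 le_sup_left

theorem measurable_pastSigma_of_mem {J : Set ℝ≥0} {u : ℝ≥0} (hu : u ∈ J) :
    Measurable[pastSigma Y J] (bev (Y := Y) u) :=
  measurable_iff_comap_le.2 (le_sup_of_le_right
    (le_biSup (fun u => MeasurableSpace.comap (bev (Y := Y) u) inferInstance) hu))

theorem measurable_pastSigma_toBaire [OpensMeasurableSpace Y] {J : Set ℝ≥0} {u : ℝ≥0}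
    (hu : u = 0 ∨ u ∈ J) : Measurable[pastSigma Y J] (bev (Y := Y) u) := by
  rcases hu with rfl | hu
  · exact measurable_toBaire.comp measurable_pastSigma_zero
  · exact measurable_pastSigma_of_mem hu

theorem pastSigma_le_iff {J : Set ℝ≥0} {m : MeasurableSpace (MixedPath Y)} :
    pastSigma Y J ≤ m ↔ (Measurable[m] (ev (Y := Y) 0)) ∧
      ∀ u ∈ J, Measurable[m] (bev (Y := Y) u) := by
  simp only [pastSigma, sup_le_iff, iSup_le_iff, measurable_iff_comap_le]

theorem pastSigma_insert (J : Set ℝ≥0) (t : ℝ≥0) : pastSigma Y (insert t J) =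
    pastSigma Y J ⊔ MeasurableSpace.comap (bev (Y := Y) t) inferInstance := by
  rw [pastSigma, iSup_insert, pastSigma, sup_comm (MeasurableSpace.comap _ _) (⨆ u ∈ J, _),
    sup_assoc]

/-- The generators do not separate paths agreeing at `0` and on `J`, and such sets form a σ-algebra.
Hence changing a coordinate outside `J ∪ {0}` leaves these events unaffected. -/
theorem mem_iff_of_eqOn {J : Set ℝ≥0} {A : Set (MixedPath Y)} (hA : MeasurableSet[pastSigma Y J] A)
    {ω ω' : MixedPath Y} (h0 : ev 0 ω = ev 0 ω') (h : ∀ u ∈ J, ev u ω = ev u ω') : ω ∈ A ↔ ω' ∈ A := by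
  have : pastSigma Y J ≤ saturatedSpace fun ω ω' => ev 0 ω = ev 0 ω' ∧ ∀ u ∈ J, ev u ω = ev u ω' := by
    rw [pastSigma_le_iff]
    refine ⟨fun B _ x y hxy => ?_, fun u hu B _ x y hxy => ?_⟩
    · simp only [Set.mem_preimage, hxy.1]
    · simp only [Set.mem_preimage, bev, hxy.2 u hu]
  exact this A hA ω ω' ⟨h0, h⟩

instance : MeasurableSpace (MixedPath Y) := pastSigma Y Set.univ

theorem measurable_mixedPath {Ω : Type*} [MeasurableSpace Ω] {f : Ω → MixedPath Y}
    (h0 : Measurable fun ω => ev 0 (f ω)) (h : ∀ u, Measurable fun ω => bev u (f ω)) :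
    Measurable f := by
  rw [measurable_iff_comap_le, MeasurableSpace.comap_le_iff_le_map]
  exact pastSigma_le_iff.2 ⟨h0, fun u _ => h u⟩

theorem pastSigma_le (J : Set ℝ≥0) :
    pastSigma Y J ≤ (inferInstance : MeasurableSpace (MixedPath Y)) :=
  pastSigma_mono (Set.subset_univ J)

/-- The Markov property at the times in `I` and time `0`, with transition kernels `Q`. -/
def IsMarkovOn (Q : ℝ≥0 → Kernel (BaireOf Y) (BaireOf Y)) (I : Set ℝ≥0)
    (M : Measure (MixedPath Y)) : Prop :=
  ∀ s t : ℝ≥0, (s = 0 ∨ s ∈ I) → t ∈ I → s < t → ∀ A, MeasurableSet[pastSigma Y (I ∩ Set.Iic s)] A →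
    ∀ D : Set (BaireOf Y), MeasurableSet D →
      M (A ∩ (bev (Y := Y) t) ⁻¹' D) = ∫⁻ ω in A, Q (t - s) (bev s ω) D ∂M

variable {Q : ℝ≥0 → Kernel (BaireOf Y) (BaireOf Y)}

theorem IsMarkovOn.mono {I J : Set ℝ≥0} (h : I ⊆ J) {M : Measure (MixedPath Y)}
    (hM : IsMarkovOn Q J M) : IsMarkovOn Q I M :=
  fun s t hs ht hst A hA => hM s t (hs.imp_right (@h s)) (h ht) hst A
    (pastSigma_mono (Set.inter_subset_inter_left _ h) A hA)

/-- The supremum of the empty set is `0`; for this reason time `0` is always allowed as conditioning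
time in `IsMarkovOn`. -/
theorem sup_eq_zero_or_mem (I : Finset ℝ≥0) : I.sup id = 0 ∨ I.sup id ∈ I := by
  rcases I.eq_empty_or_nonempty with rfl | h
  · exact Or.inl rfl
  · obtain ⟨i, hi, h⟩ := Finset.exists_mem_eq_sup I h id
    exact Or.inr (h ▸ hi)

variable [BorelSpace Y]

/-- The initial law and the kernels determine everything: adding a new last time `t`, the Markov
property from the preceding time expresses `M (A ∩ {X_t ∈ D})` through `M` on the past, where
induction applies. -/
theorem IsMarkovOn.measure_eq {I : Finset ℝ≥0} {M M' : Measure (MixedPath Y)}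
    [IsProbabilityMeasure M] (hM : IsMarkovOn Q I M) (hM' : IsMarkovOn Q I M')
    (h0 : ∀ A : Set Y, MeasurableSet A → M ((ev 0) ⁻¹' A) = M' ((ev 0) ⁻¹' A))
    {A : Set (MixedPath Y)} (hA : MeasurableSet[pastSigma Y I] A) : M A = M' A := by
  induction I using Finset.induction_on_max generalizing A with
  | empty =>
    have : pastSigma Y ((∅ : Finset ℝ≥0) : Set ℝ≥0) =
        MeasurableSpace.comap (ev 0) inferInstance := by simp [pastSigma]
    rw [this] at hA
    obtain ⟨B, hB, rfl⟩ := hA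
    exact h0 B hB
  | insert t I hI ih =>
    have hsub : (I : Set ℝ≥0) ⊆ (insert t I : Finset ℝ≥0) := by simp
    have ih' : ∀ A, MeasurableSet[pastSigma Y I] A → M A = M' A := fun A hA =>
      ih (hM.mono hsub) (hM'.mono hsub) hA
    rw [Finset.coe_insert, pastSigma_insert] at hA
    rcases eq_or_ne t 0 with rfl | ht
    · have hle := sup_le (le_refl (pastSigma Y I)) (measurable_iff_comap_le.1
        (measurable_pastSigma_toBaire (Y := Y) (J := I) (Or.inl rfl)))
      exact ih' A (hle A hA)
    refine measure_eq_on_sup (pastSigma_le _) ((le_sup_right.trans_eq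
      (pastSigma_insert _ t).symm).trans (pastSigma_le (insert t I))) ?_ hA
    rintro A _ hA ⟨D, hD, rfl⟩
    have hs := sup_eq_zero_or_mem I
    have hst : I.sup id < t := (Finset.sup_lt_iff (pos_iff_ne_zero.2 ht)).2 hI
    have hA' : MeasurableSet[pastSigma Y ((insert t I : Finset ℝ≥0) ∩ Set.Iic (I.sup id))] A := by
      have hsub' : (I : Set ℝ≥0) ⊆ (insert t I : Finset ℝ≥0) ∩ Set.Iic (I.sup id) :=
        fun u hu => ⟨hsub hu, Finset.le_sup (f := id) hu⟩
      exact pastSigma_mono hsub' A hA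
    rw [hM _ t (hs.imp_right (@hsub _)) (by simp) hst A hA' D hD,
      hM' _ t (hs.imp_right (@hsub _)) (by simp) hst A hA' D hD]
    exact setLIntegral_eq_of_measure_eq_on (pastSigma_le _) ih'
      ((Kernel.measurable_coe _ hD).comp (measurable_pastSigma_toBaire hs)) hA

/-- Replacing the value of a path at time `t`. -/
noncomputable def mixedUpdate (t : ℝ≥0) (p : MixedPath Y × BaireOf Y) : MixedPath Y :=
  fun u => if u = t then fromBaire p.2 else ev u p.1

omit [TopologicalSpace Y] [MeasurableSpace Y] [BorelSpace Y] in
theorem bev_mixedUpdate_self (t : ℝ≥0) (p : MixedPath Y × BaireOf Y) :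
    bev t (mixedUpdate t p) = p.2 := if_pos rfl

omit [TopologicalSpace Y] [MeasurableSpace Y] [BorelSpace Y] in
theorem ev_mixedUpdate_of_ne {t u : ℝ≥0} (h : u ≠ t) (p : MixedPath Y × BaireOf Y) :
    ev u (mixedUpdate t p) = ev u p.1 := if_neg h

omit [BorelSpace Y] in
theorem measurable_mixedUpdate {t : ℝ≥0} (ht : t ≠ 0) :
    Measurable (mixedUpdate t : MixedPath Y × BaireOf Y → MixedPath Y) := by
  refine measurable_mixedPath ?_ fun u => ?_
  · simp only [ev_mixedUpdate_of_ne ht.symm]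
    exact (measurable_pastSigma_zero (J := Set.univ)).comp measurable_fst
  · rcases eq_or_ne u t with rfl | hu
    · simp only [bev_mixedUpdate_self]
      exact measurable_snd
    · simp only [bev, ev_mixedUpdate_of_ne hu]
      exact (measurable_pastSigma_of_mem (Set.mem_univ u)).comp measurable_fst

/-- For finitely many times there is a measure with the Markov property at these times and a given
initial distribution. -/
theorem exists_isMarkovOn [∀ t, IsMarkovKernel (Q t)] (hQ : ∀ s t, Q (s + t) = Q t ∘ₖ Q s)
    (ν : Measure Y) [IsProbabilityMeasure ν] (I : Finset ℝ≥0) :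
    ∃ M : Measure (MixedPath Y), IsProbabilityMeasure M ∧ IsMarkovOn Q I M ∧
      ∀ A : Set Y, MeasurableSet A → M ((ev 0) ⁻¹' A) = ν A := by
  induction I using Finset.induction_on_max with
  | empty =>
    let k : Y → MixedPath Y := fun y _ => y
    have hm : Measurable k := measurable_mixedPath measurable_id fun u => measurable_toBaire
    refine ⟨ν.map k, Measure.isProbabilityMeasure_map hm.aemeasurable,
      fun s t _ ht => by simp at ht, fun A hA => ?_⟩
    rw [Measure.map_apply hm (pastSigma_le ∅ _ (measurable_pastSigma_zero hA))]
    rfl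
  | insert t I hI ih =>
    obtain ⟨M, hMp, hM, hν⟩ := ih
    rcases eq_or_ne t 0 with rfl | ht
    · refine ⟨M, hMp, fun s t _ ht hst => ?_, hν⟩
      rcases Finset.mem_insert.1 (Finset.mem_coe.1 ht) with rfl | ht
      · exact absurd hst not_lt_zero
      · exact absurd (hI t ht) not_lt_zero
    have htI : t ∉ I := fun h => lt_irrefl _ (hI t h)
    set s := I.sup id with hs_def
    have hs : s = 0 ∨ s ∈ I := sup_eq_zero_or_mem I
    have hst : s < t := (Finset.sup_lt_iff (pos_iff_ne_zero.2 ht)).2 hI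
    have hsm : Measurable (bev (Y := Y) s) :=
      (measurable_pastSigma_toBaire (J := I) hs).mono (pastSigma_le _) le_rfl
    -- The new coordinate at `t` is drawn from `Q (t - s)` started at the last earlier position;
    -- events before `t` keep their probability.
    let κ : Kernel (MixedPath Y) (BaireOf Y) := (Q (t - s)).comap (bev (Y := Y) s) hsm
    let up : MixedPath Y × BaireOf Y → MixedPath Y := mixedUpdate t
    have hup : Measurable up := measurable_mixedUpdate ht
    let M' : Measure (MixedPath Y) := (M ⊗ₘ κ).map up
    have hM'p : IsProbabilityMeasure M' := Measure.isProbabilityMeasure_map hup.aemeasurable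
    have hupA : ∀ A, MeasurableSet[pastSigma Y I] A → up ⁻¹' A = A ×ˢ Set.univ := by
      intro A hA
      ext ⟨ω, y⟩
      simp only [Set.mem_preimage, Set.mem_prod, Set.mem_univ, and_true]
      exact mem_iff_of_eqOn hA (ev_mixedUpdate_of_ne ht.symm _) fun u hu =>
        ev_mixedUpdate_of_ne (fun h : u = t => htI (h ▸ hu)) _
    have hMM' : ∀ A, MeasurableSet[pastSigma Y I] A → M' A = M A := by
      intro A hA
      rw [Measure.map_apply hup (pastSigma_le _ A hA), hupA A hA,
        Measure.compProd_apply_prod (pastSigma_le _ A hA) MeasurableSet.univ]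
      simp
    have hM't : ∀ A D, MeasurableSet[pastSigma Y I] A → MeasurableSet D →
        M' (A ∩ (bev (Y := Y) t) ⁻¹' D) = ∫⁻ ω in A, Q (t - s) (bev s ω) D ∂M := by
      intro A D hA hD
      have hA' := pastSigma_le _ A hA
      rw [Measure.map_apply hup (MeasurableSet.inter hA'
        (pastSigma_le _ _ (measurable_pastSigma_of_mem (Set.mem_univ t) hD))), Set.preimage_inter,
        hupA A hA]
      have : (A ×ˢ Set.univ) ∩ up ⁻¹' ((bev (Y := Y) t) ⁻¹' D) = A ×ˢ D := by
        ext ⟨ω, y⟩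
        simp [up, bev_mixedUpdate_self]
      rw [this, Measure.compProd_apply_prod hA' hD]
      rfl
    have hle : ∀ u ∈ I, u ≤ s := fun u hu => Finset.le_sup (f := id) hu
    refine ⟨M', hM'p, ?_, fun A hA => (hMM' _ (measurable_pastSigma_zero hA)).trans (hν A hA)⟩
    intro u v hu hv huv A hA D hD
    have hvt : v ≤ t := by
      rcases Finset.mem_insert.1 (Finset.mem_coe.1 hv) with rfl | hv
      · exact le_rfl
      · exact (hI v hv).le
    have huI : u = 0 ∨ u ∈ I := by
      refine hu.imp_right fun hu => ?_
      rcases Finset.mem_insert.1 (Finset.mem_coe.1 hu) with rfl | hu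
      · exact absurd (huv.trans_le hvt) (lt_irrefl _)
      · exact hu
    have hA1 : MeasurableSet[pastSigma Y (I ∩ Set.Iic u)] A := by
      suffices hsub : ((insert t I : Finset ℝ≥0) : Set ℝ≥0) ∩ Set.Iic u ⊆ I ∩ Set.Iic u from
        pastSigma_mono hsub A hA
      refine fun w hw => ⟨?_, hw.2⟩
      rcases Finset.mem_insert.1 (Finset.mem_coe.1 hw.1) with rfl | h
      · exact absurd ((hw.2.trans_lt huv).trans_le hvt) (lt_irrefl _)
      · exact h
    have hA2 : MeasurableSet[pastSigma Y I] A := pastSigma_mono Set.inter_subset_left A hA1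
    rw [setLIntegral_eq_of_measure_eq_on (f := fun ω => Q (v - u) (bev u ω) D) (pastSigma_le _) hMM'
      ((Kernel.measurable_coe _ hD).comp (measurable_pastSigma_toBaire huI)) hA2]
    rcases Finset.mem_insert.1 (Finset.mem_coe.1 hv) with rfl | hv
    · rw [hM't A D hA2 hD]
      have hus : u ≤ s := huI.elim (fun h => h ▸ zero_le) (hle u)
      rcases hus.eq_or_lt with rfl | hus
      · rfl
      · have hsI : s ∈ I := hs.resolve_left (zero_le.trans_lt hus).ne'
        -- For a conditioning time `u < s`, the induction hypothesis carries the law from `u` to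
        -- `s`, and the semigroup law merges the two transitions.
        rw [setLIntegral_comp_eq_of_transition (X := (bev (Y := Y) s)) hsm
          (W := (bev (Y := Y) u))
          ((measurable_pastSigma_toBaire huI).mono (pastSigma_le _) le_rfl)
          (fun D hD => hM u s huI hsI hus A hA1 D hD) (Kernel.measurable_coe (Q (v - s)) hD)]
        refine lintegral_congr fun ω => ?_
        rw [← Kernel.comp_apply' _ _ _ hD, ← hQ]
        congr 3
        rw [add_comm, tsub_add_tsub_cancel hst.le hus.le]
    · rw [hMM' _ (MeasurableSet.inter hA2 (measurable_pastSigma_of_mem hv hD))]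
      exact hM u v huI hv huv A hA1 D hD

end Mixed

end GeneralizedFeller

namespace GeneralizedFeller

open scoped BoundedContinuousFunction ENNReal
open ProbabilityTheory

/-! ### Pulling a measure back from families of indicators to points. -/

section Trace

variable {S : Type*} [MeasurableSpace S]

open Classical in
/-- The indicators of all measurable sets at a point. -/
noncomputable def indicators (s : S) (A : {A : Set S // MeasurableSet A}) : Bool :=
  decide (s ∈ A.1)

theorem indicators_eq_true {s : S} {A : {A : Set S // MeasurableSet A}} :
    indicators s A = true ↔ s ∈ A.1 := by simp [indicators]

theorem measurable_indicators : Measurable (indicators (S := S)) := by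
  refine measurable_pi_lambda _ fun A => measurable_to_bool ?_
  have : (fun s => indicators s A) ⁻¹' {true} = A.1 := by
    ext s
    exact indicators_eq_true
  rw [this]
  exact A.2

/-- The sets that depend on at most countably many of the coordinates in `ι`. -/
@[reducible] def countablyDependentSpace (ι T Ω : Type*) : MeasurableSpace ((ι → T) × Ω) where
  MeasurableSet' D := ∃ J : Set ι, J.Countable ∧
    ∀ x y : ι → T, (∀ i ∈ J, x i = y i) → ∀ z, (x, z) ∈ D ↔ (y, z) ∈ D
  measurableSet_empty := ⟨∅, Set.countable_empty, fun _ _ _ _ => Iff.rfl⟩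
  measurableSet_compl := fun _ ⟨J, hJ, h⟩ => ⟨J, hJ, fun x y hxy z => not_congr (h x y hxy z)⟩
  measurableSet_iUnion := fun f hf => by
    choose J hJ h using hf
    refine ⟨⋃ n, J n, Set.countable_iUnion hJ, fun x y hxy z => ?_⟩
    simp only [Set.mem_iUnion]
    exact exists_congr fun n => h n x y (fun i hi => hxy i (Set.mem_iUnion.2 ⟨n, hi⟩)) z

theorem prod_le_countablyDependentSpace {ι T Ω : Type*} [MeasurableSpace T] [MeasurableSpace Ω] :
    (inferInstance : MeasurableSpace ((ι → T) × Ω)) ≤ countablyDependentSpace ι T Ω := by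
  refine sup_le ?_ ?_
  · rw [MeasurableSpace.comap_le_iff_le_map]
    refine iSup_le fun i => ?_
    rintro _ ⟨B, -, rfl⟩
    refine ⟨{i}, Set.countable_singleton i, fun x y hxy z => ?_⟩
    simp only [Set.mem_preimage, hxy i rfl]
  · rintro _ ⟨B, -, rfl⟩
    exact ⟨∅, Set.countable_empty, fun _ _ _ _ => Iff.rfl⟩

variable {Ω' K : Type*} [MeasurableSpace Ω'] [TopologicalSpace K] [MeasurableSpace K]

/-- A measurable set that misses all points with first coordinate of the form `indicators s` is
null. -/
theorem measure_preimage_eq_zero_of_disjoint (M : Measure K) [IsFiniteMeasure M] [M.Regular]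
    {a : K → {A : Set S // MeasurableSet A} → Bool} (ha : Continuous a) (ham : Measurable a)
    {b : K → Ω'} (hb : Measurable b) {ν : Measure S} (hν : M.map a = ν.map indicators)
    {D : Set (({A : Set S // MeasurableSet A} → Bool) × Ω')} (hD : MeasurableSet D)
    (h : ∀ s z, (indicators s, z) ∉ D) : M ((fun k => (a k, b k)) ⁻¹' D) = 0 := by
  -- Only countably many indicator coordinates matter for `D`, so a compact `L` in the preimage
  -- projects to a closed, hence measurable, set of `J → Bool`. An indicator family with such a
  -- projection would give a point of `D` of the excluded form, so this set is null under the law of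
  -- `indicators`.
  obtain ⟨J, hJ, hJD⟩ := prod_le_countablyDependentSpace D hD
  rw [(ham.prodMk hb hD).measure_eq_iSup_isCompact_of_ne_top (measure_ne_top M _)]
  simp only [ENNReal.iSup_eq_zero]
  intro L hL hLc
  have : Countable J := hJ.to_subtype
  let π : ({A : Set S // MeasurableSet A} → Bool) → J → Bool := fun x i => x i
  have hπ : Continuous π := by fun_prop
  have hC : MeasurableSet (π ⁻¹' (π '' (a '' L))) :=
    measurable_pi_lambda _ (fun i => measurable_pi_apply _)
      ((hLc.image ha).image hπ).isClosed.measurableSet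
  refine measure_mono_null (fun k hk => ?_ : L ⊆ a ⁻¹' (π ⁻¹' (π '' (a '' L)))) ?_
  · exact ⟨a k, ⟨k, hk, rfl⟩, rfl⟩
  rw [← Measure.map_apply ham hC, hν, Measure.map_apply measurable_indicators hC]
  convert measure_empty (μ := ν)
  refine Set.eq_empty_of_forall_notMem fun s hs => ?_
  obtain ⟨_, ⟨k, hk, rfl⟩, hks⟩ := hs
  refine h s (b k) ((hJD _ _ (fun i hi => ?_) _).1 (hL hk))
  exact congrFun hks ⟨i, hi⟩

/-- The outer measure pulled back along `(s, z) ↦ (indicators s, z)` is a measure on the product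
σ-algebra, whatever `ν` is. Its image is the original law because the points `(indicators s, z)`
have full outer measure. -/
theorem exists_measure_map_indicators_eq (M : Measure K) [IsFiniteMeasure M] [M.Regular]
    {a : K → {A : Set S // MeasurableSet A} → Bool} (ha : Continuous a) (ham : Measurable a)
    {b : K → Ω'} (hb : Measurable b) {ν : Measure S} (hν : M.map a = ν.map indicators) :
    ∃ N : Measure (S × Ω'), N.map (fun p => (indicators p.1, p.2)) = M.map fun k => (a k, b k) := by
  let μ : Measure (({A : Set S // MeasurableSet A} → Bool) × Ω') := M.map fun k => (a k, b k)
  let θ : S × Ω' → ({A : Set S // MeasurableSet A} → Bool) × Ω' := fun p => (indicators p.1, p.2)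
  have hθ : Measurable θ := (measurable_indicators.comp measurable_fst).prodMk measurable_snd
  have habm : Measurable fun k => (a k, b k) := ham.prodMk hb
  have : IsFiniteMeasure μ := Measure.isFiniteMeasure_map M _
  let N₀ : OuterMeasure (S × Ω') := OuterMeasure.comap θ μ.toOuterMeasure
  have hcar : ∀ D, MeasurableSet D → MeasurableSet[N₀.caratheodory] (θ ⁻¹' D) := by
    intro D hD
    rw [OuterMeasure.isCaratheodory_iff]
    intro X
    simp only [N₀, OuterMeasure.comap_apply, Measure.coe_toOuterMeasure]
    rw [Set.image_inter_preimage, Set.image_sdiff_preimage]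
    exact (measure_inter_add_sdiff _ hD).symm
  have hle : (inferInstance : MeasurableSpace (S × Ω')) ≤ N₀.caratheodory := by
    refine sup_le ?_ ?_
    · rintro _ ⟨A, hA, rfl⟩
      let e : ({A : Set S // MeasurableSet A} → Bool) × Ω' → Bool := fun p => p.1 ⟨A, hA⟩
      have he : Measurable e := (measurable_pi_apply _).comp measurable_fst
      have : (Prod.fst : S × Ω' → S) ⁻¹' A = θ ⁻¹' (e ⁻¹' {true}) := by
        ext p
        exact (indicators_eq_true (s := p.1) (A := ⟨A, hA⟩)).symm
      rw [this]
      exact hcar _ (he (measurableSet_singleton true))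
    · rintro _ ⟨B, hB, rfl⟩
      exact hcar (Prod.snd ⁻¹' B) (measurable_snd hB)
  refine ⟨N₀.toMeasure hle, Measure.ext fun D hD => ?_⟩
  rw [Measure.map_apply hθ hD, toMeasure_apply _ _ (hθ hD)]
  simp only [N₀, OuterMeasure.comap_apply, Measure.coe_toOuterMeasure]
  refine le_antisymm (measure_mono (Set.image_preimage_subset θ D)) ?_
  -- What remains of `D` outside a measurable hull of `θ '' (θ ⁻¹' D)` contains no point of the
  -- range of `θ`.
  have hnull : μ (D \ toMeasurable μ (θ '' (θ ⁻¹' D))) = 0 := by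
    have hm := hD.diff (measurableSet_toMeasurable μ (θ '' (θ ⁻¹' D)))
    rw [Measure.map_apply habm hm]
    refine measure_preimage_eq_zero_of_disjoint M ha ham hb hν hm fun s z hsz => ?_
    exact hsz.2 (subset_toMeasurable _ _ ⟨(s, z), hsz.1, rfl⟩)
  calc μ D ≤ μ (toMeasurable μ (θ '' (θ ⁻¹' D))) + μ (D \ toMeasurable μ (θ '' (θ ⁻¹' D))) := by
        refine (measure_mono fun x hx => ?_).trans (measure_union_le _ _)
        exact (em _).imp id fun h => ⟨hx, h⟩
    _ = μ (θ '' (θ ⁻¹' D)) := by rw [hnull, add_zero, measure_toMeasurable]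

end Trace

end GeneralizedFeller

namespace GeneralizedFeller

open scoped BoundedContinuousFunction ENNReal
open ProbabilityTheory

/-! ### Ultrafilter limits of laws and a compactification of path space. -/

theorem integrable_comp_of_compactSpace {Ω K : Type*} [MeasurableSpace Ω] [TopologicalSpace K]
    [CompactSpace K] {j : Ω → K} (hj : Measurable[_, baire K] j) (μ : Measure Ω)
    [IsFiniteMeasure μ] (F : C(K, ℝ)) : Integrable (fun ω => F (j ω)) μ :=
  Integrable.of_bound ((measurable_baire_iff.1 hj F).aestronglyMeasurable) ‖F‖
    (ae_of_all _ fun _ => F.norm_coe_le_norm _)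

/-- Integrals of a fixed `F` stay in a compact interval, so they converge along an ultrafilter, and
limits are linear. This defines the functional on all continuous functions at once, not only on
those of finitely many coordinates. -/
theorem exists_limit_functional {ι Ω K : Type*} [MeasurableSpace Ω] [TopologicalSpace K]
    [CompactSpace K] (U : Ultrafilter ι) {j : Ω → K} (hj : Measurable[_, baire K] j)
    (M : ι → Measure Ω) [∀ i, IsProbabilityMeasure (M i)] :
    ∃ Λ : C(K, ℝ) →ₗ[ℝ] ℝ, ∀ F : C(K, ℝ),
      Tendsto (fun i => ∫ ω, F (j ω) ∂(M i)) U (𝓝 (Λ F)) := by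
  have hlim : ∀ F : C(K, ℝ), ∃ l : ℝ, Tendsto (fun i => ∫ ω, F (j ω) ∂(M i)) U (𝓝 l) := by
    intro F
    have hmem : ∀ i, ∫ ω, F (j ω) ∂(M i) ∈ Set.Icc (-‖F‖) ‖F‖ := fun i => by
      refine abs_le.1 ?_
      simpa using norm_integral_le_of_norm_le_const (μ := M i)
        (ae_of_all _ fun ω => F.norm_coe_le_norm (j ω))
    obtain ⟨l, -, hl⟩ := isCompact_Icc.ultrafilter_le_nhds'
      (U.map fun i => ∫ ω, F (j ω) ∂(M i)) (Ultrafilter.mem_map.2 (Filter.univ_mem' hmem))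
    exact ⟨l, hl⟩
  choose Λ hΛ using hlim
  refine ⟨⟨⟨Λ, fun F G => ?_⟩, fun c F => ?_⟩, hΛ⟩
  · refine tendsto_nhds_unique (hΛ (F + G)) (((hΛ F).add (hΛ G)).congr fun i => ?_)
    exact (integral_add (integrable_comp_of_compactSpace hj _ F)
      (integrable_comp_of_compactSpace hj _ G)).symm
  · refine tendsto_nhds_unique (hΛ (c • F)) (((hΛ F).const_mul c).congr fun i => ?_)
    exact (integral_const_mul c _).symm

section Compactification

variable {Y : Type*} [TopologicalSpace Y] [MeasurableSpace Y]

/-- A compact space containing the paths in `Y`: at time `0` all indicators of measurable sets are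
recorded, at other times the position in the Stone–Čech compactification. -/
def PathCompact (Y : Type*) [TopologicalSpace Y] [MeasurableSpace Y] : Type _ :=
  ({A : Set Y // MeasurableSet A} → Bool) × ({t : ℝ≥0 // t ≠ 0} → StoneCech Y)

instance : TopologicalSpace (PathCompact Y) :=
  inferInstanceAs (TopologicalSpace
    (({A : Set Y // MeasurableSet A} → Bool) × ({t : ℝ≥0 // t ≠ 0} → StoneCech Y)))

instance : CompactSpace (PathCompact Y) :=
  inferInstanceAs (CompactSpace
    (({A : Set Y // MeasurableSet A} → Bool) × ({t : ℝ≥0 // t ≠ 0} → StoneCech Y)))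

instance : T2Space (PathCompact Y) :=
  inferInstanceAs (T2Space
    (({A : Set Y // MeasurableSet A} → Bool) × ({t : ℝ≥0 // t ≠ 0} → StoneCech Y)))

instance : MeasurableSpace (PathCompact Y) := borel _

instance : BorelSpace (PathCompact Y) := ⟨rfl⟩

namespace PathCompact

/-- The recorded indicators at time `0`. -/
def start (k : PathCompact Y) : {A : Set Y // MeasurableSet A} → Bool := k.1

/-- The position at time `t`. -/
def pos (t : {t : ℝ≥0 // t ≠ 0}) (k : PathCompact Y) : StoneCech Y := k.2 t

theorem continuous_start : Continuous (start : PathCompact Y → _) := continuous_fst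

theorem continuous_pos (t : {t : ℝ≥0 // t ≠ 0}) : Continuous (pos t : PathCompact Y → _) :=
  (continuous_apply t).comp continuous_snd

theorem continuous_mk {X : Type*} [TopologicalSpace X] {f : X → PathCompact Y}
    (h : Continuous fun x => start (f x)) (h' : ∀ t, Continuous fun x => pos t (f x)) :
    Continuous f :=
  h.prodMk (continuous_pi h')

theorem measurable_start : Measurable (start : PathCompact Y → _) :=
  measurable_pi_lambda _ fun A => ((continuous_apply A).comp continuous_start).measurable

theorem ext {k k' : PathCompact Y} (h : start k = start k') (h' : ∀ t, pos t k = pos t k') :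
    k = k' :=
  Prod.ext h (funext h')

/-- The product is uncountable, so Borel measurability cannot be checked by coordinates. Baire
measurability can, since functions of one coordinate separate points. -/
theorem measurable_baire {Ω : Type*} [MeasurableSpace Ω] {j : Ω → PathCompact Y}
    (h : ∀ A, Measurable fun ω => start (j ω) A)
    (h' : ∀ t, ∀ G : C(StoneCech Y, ℝ), Measurable fun ω => G (pos t (j ω))) :
    Measurable[_, baire (PathCompact Y)] j := by
  refine measurable_baire_of_separatesPoints fun x y hxy => ?_
  by_cases hs : start x = start y
  · obtain ⟨t, ht⟩ : ∃ t, pos t x ≠ pos t y := by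
      by_contra! hcon
      exact hxy (ext hs hcon)
    obtain ⟨G, hG1, hG0, -⟩ := exists_bcf_one_zero (isCompact_singleton (x := pos t x))
      (isOpen_compl_singleton (x := pos t y)) (by simpa using Ne.symm ht)
    refine ⟨⟨fun k => G (pos t k), G.continuous.comp (continuous_pos t)⟩,
      h' t G.toContinuousMap, ?_⟩
    have h1 : G (pos t x) = 1 := hG1 rfl
    have h2 : G (pos t y) = 0 := hG0 (by simp)
    simp [h1, h2]
  · obtain ⟨A, hA⟩ := Function.ne_iff.1 hs
    let b : Bool → ℝ := fun i => if i then 1 else 0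
    have hb : Continuous b := continuous_of_discreteTopology
    refine ⟨⟨fun k => b (start k A), hb.comp ((continuous_apply A).comp continuous_start)⟩,
      (measurable_of_countable b).comp (h A), fun hb => hA ?_⟩
    change b (start x A) = b (start y A) at hb
    revert hb
    cases start x A <;> cases start y A <;> simp [b]

open Classical in
/-- Replacing the positions at the times outside `J` by a constant. -/
noncomputable def keep (J : Finset ℝ≥0) (y : Y) (k : PathCompact Y) : PathCompact Y :=
  (start k, fun t => if t.1 ∈ J then pos t k else stoneCechUnit y)

theorem continuous_keep (J : Finset ℝ≥0) (y : Y) : Continuous (keep J y) := by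
  refine continuous_mk continuous_start fun t => ?_
  change Continuous fun k => if t.1 ∈ J then pos t k else stoneCechUnit y
  by_cases h : t.1 ∈ J
  · simpa only [if_pos h] using continuous_pos t
  · simpa only [if_neg h] using continuous_const

end PathCompact

open PathCompact

/-- The inclusion of the paths in the compact space. -/
noncomputable def compactify (ω : MixedPath Y) : PathCompact Y :=
  (indicators (ev 0 ω), fun t => stoneCechUnit (ev t.1 ω))

theorem measurable_compactify [OpensMeasurableSpace Y] :
    Measurable[_, baire (PathCompact Y)] (compactify (Y := Y)) := by
  refine measurable_baire (fun A => ?_) fun t G => ?_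
  · exact ((measurable_pi_apply A).comp measurable_indicators).comp
      (measurable_pastSigma_zero (J := Set.univ))
  · have hG : Measurable fun y : BaireOf Y => G (stoneCechUnit (fromBaire y)) :=
      (Continuous.measurable_baire (G.continuous.comp continuous_stoneCechUnit)).comp
        measurable_fromBaire
    exact hG.comp (measurable_pastSigma_of_mem (Set.mem_univ t.1))

open Classical in
/-- Replacing the values at the nonzero times outside `J` by a constant. -/
noncomputable def keepPath (J : Finset ℝ≥0) (y : Y) (ω : MixedPath Y) : MixedPath Y :=
  fun u => if u = 0 ∨ u ∈ J then ev u ω else y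

omit [TopologicalSpace Y] [MeasurableSpace Y] in
theorem ev_keepPath {J : Finset ℝ≥0} {u : ℝ≥0} (hu : u = 0 ∨ u ∈ J) (y : Y) (ω : MixedPath Y) :
    ev u (keepPath J y ω) = ev u ω := if_pos hu

omit [TopologicalSpace Y] [MeasurableSpace Y] in
theorem ev_keepPath_of_not {J : Finset ℝ≥0} {u : ℝ≥0} (hu : ¬(u = 0 ∨ u ∈ J)) (y : Y)
    (ω : MixedPath Y) : ev u (keepPath J y ω) = y := if_neg hu

theorem measurable_keepPath [OpensMeasurableSpace Y] (J : Finset ℝ≥0) (y : Y) :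
    Measurable[pastSigma Y J] (keepPath J y) := by
  let _ : MeasurableSpace (MixedPath Y) := pastSigma Y J
  refine measurable_iff_comap_le.2 (MeasurableSpace.comap_le_iff_le_map.2
    (pastSigma_le_iff.2 ⟨?_, fun u _ => ?_⟩))
  · change Measurable[pastSigma Y J] fun ω => ev 0 (keepPath J y ω)
    simp only [ev_keepPath (J := J) (Or.inl rfl)]
    exact measurable_pastSigma_zero
  · change Measurable[pastSigma Y J] fun ω => toBaire (ev u (keepPath J y ω))
    by_cases hu : u = 0 ∨ u ∈ J
    · simp only [ev_keepPath hu]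
      exact measurable_pastSigma_toBaire hu
    · simp only [ev_keepPath_of_not hu]
      exact measurable_const

/-- Forgetting the times outside `J` is continuous on the compact space. Hence `F ∘ keep J y` is a
continuous function whose value on a path depends only on time `0` and the times in `J`. -/
theorem keep_compactify (J : Finset ℝ≥0) (y : Y) (ω : MixedPath Y) :
    keep J y (compactify ω) = compactify (keepPath J y ω) := by
  refine PathCompact.ext ?_ fun t => ?_
  · change indicators (ev 0 ω) = indicators (ev 0 (keepPath J y ω))
    rw [ev_keepPath (Or.inl rfl)]
  · change (if t.1 ∈ J then stoneCechUnit (ev t.1 ω) else stoneCechUnit y) =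
      stoneCechUnit (ev t.1 (keepPath J y ω))
    by_cases ht : t.1 ∈ J
    · rw [if_pos ht, ev_keepPath (Or.inr ht)]
    · rw [if_neg ht, ev_keepPath_of_not (by simp [ht, t.2])]

theorem measurable_compactify_keepPath [OpensMeasurableSpace Y] (J : Finset ℝ≥0) (y : Y) :
    Measurable[pastSigma Y J, baire (PathCompact Y)] fun ω => compactify (keepPath J y ω) :=
  Measurable.comp measurable_compactify (measurable_keepPath J y)

/-- Borel events at time `0` are read off from an indicator coordinate, and cozero sets at later
times from Stone–Čech extensions. Laws on `pastSigma Y J` can therefore be compared on continuous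
functions of the truncated path. -/
theorem pastSigma_le_comap_compactify [OpensMeasurableSpace Y] (J : Finset ℝ≥0) (y : Y) :
    pastSigma Y J ≤ (baire (PathCompact Y)).comap fun ω => compactify (keepPath J y ω) := by
  have hJ : Measurable[(baire (PathCompact Y)).comap fun ω => compactify (keepPath J y ω),
      baire (PathCompact Y)] fun ω => compactify (keepPath J y ω) := comap_measurable _
  have hF := measurable_baire_iff.1 hJ
  have h0 : Measurable[(baire (PathCompact Y)).comap fun ω => compactify (keepPath J y ω)]
      (ev (Y := Y) 0) := by
    intro A hA
    let b : Bool → ℝ := fun i => if i then 1 else 0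
    have hb : Continuous b := continuous_of_discreteTopology
    let F : C(PathCompact Y, ℝ) :=
      ⟨fun k => b (start k ⟨A, hA⟩), hb.comp ((continuous_apply _).comp continuous_start)⟩
    convert hF F (measurableSet_singleton 1) using 1
    ext ω
    have : start (compactify (keepPath J y ω)) ⟨A, hA⟩ = true ↔ ev 0 ω ∈ A := by
      rw [← ev_keepPath (J := J) (Or.inl rfl) y ω]
      exact indicators_eq_true
    change ev 0 ω ∈ A ↔ b (start (compactify (keepPath J y ω)) ⟨A, hA⟩) = 1
    rw [← this]
    cases start (compactify (keepPath J y ω)) ⟨A, hA⟩ <;> simp [b]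
  refine pastSigma_le_iff.2 ⟨h0, fun u hu => ?_⟩
  rcases eq_or_ne u 0 with rfl | hu0
  · exact measurable_toBaire.comp h0
  refine measurable_iff_comap_le.2 ?_
  change MeasurableSpace.comap (fun ω : MixedPath Y => ev u ω) (baire Y) ≤ _
  rw [baire_eq_generateFrom, MeasurableSpace.comap_generateFrom]
  refine MeasurableSpace.generateFrom_le ?_
  rintro _ ⟨_, ⟨f, rfl⟩, rfl⟩
  obtain ⟨G, hG⟩ := exists_stoneCech_extension f
  convert hF ⟨fun k => G (pos ⟨u, hu0⟩ k), G.continuous.comp (continuous_pos _)⟩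
    (measurableSet_Ioi (a := 0)) using 1
  ext ω
  change 0 < f (ev u ω) ↔ 0 < G (stoneCechUnit (ev u (keepPath J y ω)))
  rw [ev_keepPath (Or.inr hu), hG]

/-- The inclusion in the compact space of the paths whose start is given by indicators. -/
noncomputable def includePath
    (p : ({A : Set Y // MeasurableSet A} → Bool) × ({t : ℝ≥0 // t ≠ 0} → Y)) : PathCompact Y :=
  (p.1, fun t => stoneCechUnit (p.2 t))

theorem measurable_includePath [OpensMeasurableSpace Y] :
    Measurable[_, baire (PathCompact Y)] (includePath (Y := Y)) := by
  refine measurable_baire (fun A => ?_) fun t G => ?_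
  · exact (measurable_pi_apply A).comp measurable_fst
  · exact (G.continuous.comp continuous_stoneCechUnit).measurable.comp
      ((measurable_pi_apply t).comp measurable_snd)

open Classical in
/-- The path with a given start and given values at the nonzero times. -/
noncomputable def assemblePath (p : Y × ({t : ℝ≥0 // t ≠ 0} → Y)) (t : ℝ≥0) : Y :=
  if h : t = 0 then p.1 else p.2 ⟨t, h⟩

omit [TopologicalSpace Y] [MeasurableSpace Y] in
theorem assemblePath_zero (p : Y × ({t : ℝ≥0 // t ≠ 0} → Y)) : assemblePath p 0 = p.1 :=
  dif_pos rfl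

omit [TopologicalSpace Y] [MeasurableSpace Y] in
theorem assemblePath_of_ne (p : Y × ({t : ℝ≥0 // t ≠ 0} → Y)) {t : ℝ≥0} (h : t ≠ 0) :
    assemblePath p t = p.2 ⟨t, h⟩ :=
  dif_neg h

omit [TopologicalSpace Y] in
theorem measurable_assemblePath : Measurable (assemblePath (Y := Y)) := by
  refine measurable_pi_lambda _ fun t => ?_
  rcases eq_or_ne t 0 with rfl | ht
  · simpa only [assemblePath_zero] using measurable_fst
  · simp only [assemblePath_of_ne _ ht]
    exact (measurable_pi_apply _).comp measurable_snd

/-- The identity, with a smaller σ-algebra on the target. -/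
def toMixed (ω : ℝ≥0 → Y) : MixedPath Y := ω

theorem measurable_toMixed [OpensMeasurableSpace Y] : Measurable (toMixed (Y := Y)) :=
  measurable_mixedPath (measurable_pi_apply 0) fun u =>
    measurable_toBaire.comp (measurable_pi_apply u)

theorem compactify_toMixed_assemblePath (p : Y × ({t : ℝ≥0 // t ≠ 0} → Y)) :
    compactify (toMixed (assemblePath p)) = includePath (indicators p.1, p.2) := by
  refine PathCompact.ext ?_ fun t => ?_
  · change indicators (assemblePath p 0) = indicators p.1
    rw [assemblePath_zero]
  · change stoneCechUnit (assemblePath p t.1) = stoneCechUnit (p.2 t)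
    rw [assemblePath_of_ne p t.2]

end Compactification

end GeneralizedFeller

namespace GeneralizedFeller

open scoped BoundedContinuousFunction ENNReal
open ProbabilityTheory

/-! ### From consistent finite-time laws to a measure on all paths. -/

theorem integral_eq_of_measure_eq_on {Ω : Type*} {m₁ m₀ : MeasurableSpace Ω}
    {μ ν : Measure[m₀] Ω} (h₁ : m₁ ≤ m₀) (h : ∀ A, MeasurableSet[m₁] A → μ A = ν A) {f : Ω → ℝ}
    (hf : Measurable[m₁] f) : ∫ ω, f ω ∂μ = ∫ ω, f ω ∂ν := by
  rw [integral_trim h₁ hf.stronglyMeasurable, integral_trim h₁ hf.stronglyMeasurable]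
  congr 1
  refine @Measure.ext _ m₁ _ _ fun A hA => ?_
  rw [trim_measurableSet_eq h₁ hA, trim_measurableSet_eq h₁ hA, h A hA]

theorem measurable_id_pi_bool {ι : Type*} :
    Measurable[_, baire (ι → Bool)] (id : (ι → Bool) → ι → Bool) := by
  refine measurable_baire_of_separatesPoints fun x y hxy => ?_
  obtain ⟨i, hi⟩ := Function.ne_iff.1 hxy
  let b : Bool → ℝ := fun i => if i then 1 else 0
  have hb : Continuous b := continuous_of_discreteTopology
  refine ⟨⟨fun x => b (x i), hb.comp (continuous_apply i)⟩,
    (measurable_of_countable b).comp (measurable_pi_apply i), fun hxy => hi ?_⟩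
  change b (x i) = b (y i) at hxy
  revert hxy
  cases x i <;> cases y i <;> simp [b]

theorem pi_bool_le_baire {ι : Type*} :
    (inferInstance : MeasurableSpace (ι → Bool)) ≤ baire (ι → Bool) := by
  refine iSup_le fun i => measurable_iff_comap_le.1 ?_
  refine @measurable_to_bool _ (baire (ι → Bool)) _ ?_
  let b : Bool → ℝ := fun i => if i then 1 else 0
  have hb : Continuous b := continuous_of_discreteTopology
  have hbi : Continuous fun x : ι → Bool => b (x i) := hb.comp (continuous_apply i)
  convert Continuous.measurable_baire hbi (measurableSet_singleton (1 : ℝ)) using 1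
  ext x
  change x i = true ↔ b (x i) = 1
  cases x i <;> simp [b]

/-- On `{0, 1}^ι` the product σ-algebra coincides with the Baire one even for uncountable `ι`, so
continuous functions determine finite measures. -/
theorem measure_pi_bool_ext {ι : Type*} {μ μ' : Measure (ι → Bool)} [IsFiniteMeasure μ]
    [IsFiniteMeasure μ'] (h : ∀ F : C(ι → Bool, ℝ), ∫ x, F x ∂μ = ∫ x, F x ∂μ') : μ = μ' :=
  Measure.ext fun A hA => measure_eq_of_integral_comp_eq measurable_id_pi_bool
    (fun F _ => h F.toContinuousMap) (MeasurableSpace.comap_id.symm ▸ pi_bool_le_baire A hA)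

section Extension

variable {Y : Type*} [TopologicalSpace Y] [T35Space Y] [MeasurableSpace Y] [BorelSpace Y]

open PathCompact

/-- Consistent measures on the past σ-algebras of finite sets of times extend to a measure on the
space of all paths, whose values at nonzero times have inner regular distributions. -/
theorem exists_measure_of_consistent [Nonempty Y] {C : ℕ → Set Y} (hCmono : Monotone C)
    (hCc : ∀ n, IsCompact (C n)) (hCm : ∀ n, MeasurableSet[baire Y] (C n))
    (hCu : ⋃ n, C n = Set.univ) (M : Finset ℝ≥0 → Measure (MixedPath Y))
    [∀ I, IsProbabilityMeasure (M I)]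
    (hM : ∀ I J : Finset ℝ≥0, I ⊆ J → ∀ A, MeasurableSet[pastSigma Y I] A → M J A = M I A) :
    ∃ Pr : Measure (ℝ≥0 → Y), IsProbabilityMeasure Pr ∧
      (∀ J : Finset ℝ≥0, ∀ A, MeasurableSet[pastSigma Y J] A → Pr (toMixed ⁻¹' A) = M J A) ∧
      ∀ t : ℝ≥0, t ≠ 0 → (Pr.map fun ω => ω t).InnerRegular := by
  have : SigmaCompactSpace Y := SigmaCompactSpace_iff_exists_compact_covering.2 ⟨C, hCc, hCu⟩
  let _ : MeasurableSpace (StoneCech Y) := borel _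
  have : BorelSpace (StoneCech Y) := ⟨rfl⟩
  have him : MeasurableEmbedding (stoneCechUnit : Y → StoneCech Y) :=
    measurableEmbedding_stoneCechUnit
  let y₀ : Y := Classical.arbitrary Y
  -- Being finer than `atTop`, it eventually contains any given finite set of times; by consistency
  -- the limit is then constant on functions of those times.
  let U : Ultrafilter (Finset ℝ≥0) := Ultrafilter.of atTop
  have hU : ∀ J : Finset ℝ≥0, ∀ᶠ I in (U : Filter (Finset ℝ≥0)), J ⊆ I := fun J =>
    (Ultrafilter.of_le atTop) (eventually_ge_atTop J)
  have hcpt := measurable_compactify (Y := Y)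
  obtain ⟨Λ, hΛ⟩ := exists_limit_functional U hcpt M
  obtain ⟨V, hVf, hVr, hV⟩ := exists_regular_of_functional Λ fun F hF =>
    ge_of_tendsto' (hΛ F) fun I => integral_nonneg fun ω => hF _
  -- functionals of finitely many coordinates
  have hΛJ : ∀ (J : Finset ℝ≥0) (F : C(PathCompact Y, ℝ)),
      (Measurable[pastSigma Y J] fun ω => F (compactify ω)) →
      ∫ k, F k ∂V = ∫ ω, F (compactify ω) ∂(M J) := by
    intro J F hF
    rw [hV]
    refine tendsto_nhds_unique (hΛ F) (tendsto_const_nhds.congr' ?_)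
    filter_upwards [hU J] with I hI
    exact (integral_eq_of_measure_eq_on (pastSigma_le J) (hM J I hI) hF).symm
  have hVp : V.real Set.univ = 1 := by
    have := hΛJ ∅ 1 measurable_const
    simpa using this
  have hstart : V.map start = ((M ∅).map (ev 0)).map indicators := by
    have hev : Measurable (ev (Y := Y) 0) := measurable_pastSigma_zero (J := Set.univ)
    rw [Measure.map_map measurable_indicators hev]
    have : IsFiniteMeasure (V.map start) := Measure.isFiniteMeasure_map V _
    have hi : Measurable (indicators ∘ ev (Y := Y) 0) := measurable_indicators.comp hev
    have : IsFiniteMeasure ((M ∅).map (indicators ∘ ev 0)) := Measure.isFiniteMeasure_map _ _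
    refine measure_pi_bool_ext fun F => ?_
    have hF : Measurable F := measurable_baire_iff.1 measurable_id_pi_bool F
    rw [integral_map measurable_start.aemeasurable hF.aestronglyMeasurable,
      integral_map hi.aemeasurable hF.aestronglyMeasurable]
    exact hΛJ ∅ ⟨fun k => F (start k), F.continuous.comp continuous_start⟩
      ((hF.comp measurable_indicators).comp measurable_pastSigma_zero)
  -- the positions are in `Y`
  have hrange : ∀ t : {t : ℝ≥0 // t ≠ 0}, ∀ᵐ k ∂V,
      pos t k ∈ Set.range (stoneCechUnit : Y → StoneCech Y) := by
    intro t
    have hbt : ∀ n, MeasurableSet[pastSigma Y ({t.1} : Finset ℝ≥0)]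
        ((ev (Y := Y) t.1) ⁻¹' C n) := fun n =>
      measurable_pastSigma_of_mem (J := (({t.1} : Finset ℝ≥0) : Set ℝ≥0)) (u := t.1) (by simp)
        (measurable_fromBaire (hCm n))
    have hbt' : ∀ n, MeasurableSet ((ev (Y := Y) t.1) ⁻¹' C n) := fun n =>
      pastSigma_le _ _ (hbt n)
    -- A continuous `F` equal to `1` where the position is in `C n` eventually has integral at least
    -- the probability of `C n`; outer regularity of `V` gives the inequality for the set. The sets
    -- `C n` must be Baire, since the finite-time laws see nothing finer at `t`.
    have hle : ∀ n, (M {t.1}).real ((ev (Y := Y) t.1) ⁻¹' C n) ≤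
        V.real (pos t ⁻¹' Set.range (stoneCechUnit : Y → StoneCech Y)) := by
      intro n
      have hcomp : IsCompact (pos t ⁻¹' (stoneCechUnit '' C n) : Set (PathCompact Y)) :=
        (((hCc n).image continuous_stoneCechUnit).isClosed.preimage (continuous_pos t)).isCompact
      refine (le_measureReal_of_isCompact hcomp fun F hF hF1 => ?_).trans
        (measureReal_mono (Set.preimage_mono (Set.image_subset_range _ _)))
      rw [hV]
      refine ge_of_tendsto (hΛ F) ?_
      filter_upwards [hU {t.1}] with I hI
      rw [measureReal_def, ← hM _ I hI _ (hbt n), ← measureReal_def, ← integral_indicator_one (hbt' n)]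
      refine integral_mono ((integrable_const (1 : ℝ)).indicator (hbt' n))
        (integrable_comp_of_compactSpace hcpt _ F) fun ω => ?_
      by_cases hω : ω ∈ (ev (Y := Y) t.1) ⁻¹' C n
      · rw [Set.indicator_of_mem hω]
        exact (hF1 (x := compactify ω) ⟨ev t.1 ω, hω, rfl⟩).ge
      · rw [Set.indicator_of_notMem hω]
        exact (hF _).1
    have hlim : Tendsto (fun n => (M {t.1}).real ((ev (Y := Y) t.1) ⁻¹' C n)) atTop (𝓝 1) := by
      have := tendsto_measure_iUnion_atTop (μ := M {t.1})
        (s := fun n => (ev (Y := Y) t.1) ⁻¹' C n) fun i j hij => Set.preimage_mono (hCmono hij)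
      rw [← Set.preimage_iUnion, hCu, Set.preimage_univ, measure_univ] at this
      exact (ENNReal.tendsto_toReal ENNReal.one_ne_top).comp this
    have hms : MeasurableSet (pos t ⁻¹' Set.range (stoneCechUnit : Y → StoneCech Y)) :=
      (continuous_pos t).measurable him.measurableSet_range
    have h1 := le_of_tendsto' hlim hle
    rw [ae_iff]
    change V (pos t ⁻¹' Set.range (stoneCechUnit : Y → StoneCech Y))ᶜ = 0
    rw [← measureReal_eq_zero_iff, measureReal_compl hms, hVp]
    exact le_antisymm (by linarith) (by
      rw [← hVp, ← measureReal_compl hms]; exact measureReal_nonneg)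
  let b : PathCompact Y → {t : ℝ≥0 // t ≠ 0} → Y := fun k t => him.invFun (pos t k)
  have hb : Measurable b := measurable_pi_lambda _ fun t =>
    him.measurable_invFun.comp (continuous_pos t).measurable
  obtain ⟨N, hN⟩ := exists_measure_map_indicators_eq V continuous_start measurable_start hb hstart
  let Pr : Measure (ℝ≥0 → Y) := N.map assemblePath
  have hθ : Measurable fun p : Y × ({t : ℝ≥0 // t ≠ 0} → Y) => (indicators p.1, p.2) :=
    (measurable_indicators.comp measurable_fst).prodMk measurable_snd
  have hNp : IsProbabilityMeasure N := by
    refine ⟨?_⟩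
    have := congrArg (fun μ => μ Set.univ) hN
    simp only [Measure.map_apply hθ MeasurableSet.univ,
      Measure.map_apply (measurable_start.prodMk hb) MeasurableSet.univ, Set.preimage_univ] at this
    rw [this, ← ENNReal.ofReal_toReal (measure_ne_top V _), ← measureReal_def, hVp,
      ENNReal.ofReal_one]
  have hPr : IsProbabilityMeasure Pr :=
    Measure.isProbabilityMeasure_map measurable_assemblePath.aemeasurable
  refine ⟨Pr, hPr, fun J A hA => ?_, fun t ht => ?_⟩
  · have : IsProbabilityMeasure (Pr.map toMixed) :=
      Measure.isProbabilityMeasure_map measurable_toMixed.aemeasurable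
    have hck := (measurable_compactify_keepPath J y₀).mono (pastSigma_le J) le_rfl
    rw [← Measure.map_apply measurable_toMixed (pastSigma_le J A hA)]
    refine measure_eq_of_integral_comp_eq hck (fun F _ => ?_)
      (pastSigma_le_comap_compactify J y₀ A hA)
    -- The test function is written as a continuous function on the compact space depending only on
    -- time `0` and `J`, where `V` and `M J` agree.
    let G : C(PathCompact Y, ℝ) := ⟨fun k => F (keep J y₀ k), F.continuous.comp (continuous_keep J y₀)⟩
    have hG : ∀ ω, F (compactify (keepPath J y₀ ω)) = G (compactify ω) := fun ω =>
      congrArg F (keep_compactify J y₀ ω).symm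
    have hGm : Measurable[pastSigma Y J] fun ω => G (compactify ω) := by
      simp only [← hG]
      exact measurable_baire_iff.1 (measurable_compactify_keepPath J y₀) F.toContinuousMap
    simp only [hG]
    rw [← hΛJ J G hGm, integral_map measurable_toMixed.aemeasurable
      ((hGm.mono (pastSigma_le J) le_rfl).aestronglyMeasurable),
      integral_map (f := fun x : ℝ≥0 → Y => G (compactify (toMixed x)))
        measurable_assemblePath.aemeasurable
        (((hGm.mono (pastSigma_le J) le_rfl).comp measurable_toMixed).aestronglyMeasurable)]
    have hGi : Measurable fun x => G (includePath x) :=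
      measurable_baire_iff.1 (measurable_includePath (Y := Y)) G
    simp only [compactify_toMixed_assemblePath]
    rw [← integral_map (f := fun x => G (includePath x)) hθ.aemeasurable hGi.aestronglyMeasurable,
      hN, integral_map (measurable_start.prodMk hb).aemeasurable hGi.aestronglyMeasurable]
    refine integral_congr_ae ?_
    -- Only the finitely many positions seen by `G` need to lie in `Y`; simultaneity over all times
    -- would be out of reach.
    have hall : ∀ᵐ k ∂V, ∀ t ∈ J, ∀ ht : t ≠ 0,
        pos ⟨t, ht⟩ k ∈ Set.range (stoneCechUnit : Y → StoneCech Y) := by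
      refine (eventually_all_finset J).2 fun t _ => ?_
      by_cases ht : t = 0
      · exact ae_of_all _ fun k h => absurd ht h
      · filter_upwards [hrange ⟨t, ht⟩] with k hk _ using hk
    filter_upwards [hall] with k hk
    refine congrArg F (PathCompact.ext rfl fun t => ?_)
    change (if t.1 ∈ J then stoneCechUnit (b k t) else stoneCechUnit y₀) =
      if t.1 ∈ J then pos t k else stoneCechUnit y₀
    by_cases ht : t.1 ∈ J
    · rw [if_pos ht, if_pos ht]
      obtain ⟨y, hy⟩ := hk t.1 ht t.2
      change stoneCechUnit (him.invFun (pos t k)) = pos t k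
      rw [← hy, him.leftInverse_invFun]
    · rw [if_neg ht, if_neg ht]
  · have h1 : (Pr.map fun ω => ω t) = V.map fun k => him.invFun (pos ⟨t, ht⟩ k) := by
      rw [Measure.map_map (measurable_pi_apply t) measurable_assemblePath]
      have h2 : (fun ω : ℝ≥0 → Y => ω t) ∘ assemblePath =
          (fun x : ({A : Set Y // MeasurableSet A} → Bool) × ({t : ℝ≥0 // t ≠ 0} → Y) =>
            x.2 ⟨t, ht⟩) ∘ fun p => (indicators p.1, p.2) :=
        funext fun p => assemblePath_of_ne p ht
      have h3 : Measurable
          (fun x : ({A : Set Y // MeasurableSet A} → Bool) × ({t : ℝ≥0 // t ≠ 0} → Y) =>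
            x.2 ⟨t, ht⟩) := (measurable_pi_apply _).comp measurable_snd
      rw [h2, ← Measure.map_map h3 hθ, hN, Measure.map_map h3 (measurable_start.prodMk hb)]
      rfl
    rw [h1]
    exact innerRegular_map_invFun isEmbedding_stoneCechUnit him (continuous_pos _) V
      (hrange ⟨t, ht⟩)

end Extension

end GeneralizedFeller

namespace GeneralizedFeller

open scoped BoundedContinuousFunction ENNReal
open ProbabilityTheory

/-! ### The Markov property for the full Borel past. -/

section MarkovPath

variable {Y : Type*} [TopologicalSpace Y] [MeasurableSpace Y]

theorem measurable_bev (u : ℝ≥0) : Measurable (bev (Y := Y) u) :=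
  measurable_pastSigma_of_mem (Set.mem_univ u)

/-- The past σ-algebra of infinitely many times is generated by those of the finite subsets. -/
theorem pastSigma_eq_generateFrom (S : Set ℝ≥0) : pastSigma Y S = MeasurableSpace.generateFrom
    {A | ∃ J : Finset ℝ≥0, (J : Set ℝ≥0) ⊆ S ∧ MeasurableSet[pastSigma Y J] A} := by
  apply le_antisymm
  · refine pastSigma_le_iff.2 ⟨fun A hA => ?_, fun u hu D hD => ?_⟩
    · exact MeasurableSpace.measurableSet_generateFrom
        ⟨∅, by simp, measurable_pastSigma_zero hA⟩
    · exact MeasurableSpace.measurableSet_generateFrom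
        ⟨{u}, by simpa using hu, measurable_pastSigma_of_mem (by simp) hD⟩
  · refine MeasurableSpace.generateFrom_le ?_
    rintro A ⟨J, hJ, hA⟩
    exact pastSigma_mono hJ A hA

theorem isPiSystem_finite_past (S : Set ℝ≥0) : IsPiSystem
    {A : Set (MixedPath Y) | ∃ J : Finset ℝ≥0, (J : Set ℝ≥0) ⊆ S ∧ MeasurableSet[pastSigma Y J] A} := by
  classical
  rintro A ⟨J, hJ, hA⟩ A' ⟨J', hJ', hA'⟩ -
  refine ⟨J ∪ J', by simp [hJ, hJ'], ?_⟩
  exact MeasurableSet.inter (pastSigma_mono (by simp) A hA) (pastSigma_mono (by simp) A' hA')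

variable {Q : ℝ≥0 → Kernel (BaireOf Y) (BaireOf Y)}

/-- A measure with the Markov property for all finite sets of times has the Markov property for
all times. -/
theorem isMarkovOn_univ_of_finite [∀ t, IsMarkovKernel (Q t)] {M : Measure (MixedPath Y)}
    [IsProbabilityMeasure M] (hM : ∀ I : Finset ℝ≥0, IsMarkovOn Q I M) :
    IsMarkovOn Q Set.univ M := by
  classical
  intro s t _ _ hst A hA D hD
  rw [Set.univ_inter] at hA
  have hbt : MeasurableSet ((bev (Y := Y) t) ⁻¹' D) := measurable_bev t hD
  have hA0 : MeasurableSet A := pastSigma_le _ A hA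
  have key : ∀ A, (∃ J : Finset ℝ≥0, (J : Set ℝ≥0) ⊆ Set.Iic s ∧ MeasurableSet[pastSigma Y J] A) →
      M (A ∩ (bev (Y := Y) t) ⁻¹' D) = ∫⁻ ω in A, Q (t - s) (bev s ω) D ∂M := by
    rintro A ⟨J, hJ, hA⟩
    have hsub : (J : Set ℝ≥0) ⊆ (insert s (insert t J) : Finset ℝ≥0) ∩ Set.Iic s :=
      fun u hu => ⟨by simp [Finset.mem_coe.1 hu], hJ hu⟩
    exact hM (insert s (insert t J)) s t (Or.inr (by simp)) (by simp) hst A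
      (pastSigma_mono hsub A hA) D hD
  have := ext_on_measurableSpace_of_generate_finite
    (μ := M.restrict ((bev (Y := Y) t) ⁻¹' D)) (ν := M.withDensity fun ω => Q (t - s) (bev s ω) D)
    inferInstance _ ?_ (pastSigma_le (Set.Iic s)) (pastSigma_eq_generateFrom _)
    (isPiSystem_finite_past _) ?_ hA
  · rwa [Measure.restrict_apply hA0, withDensity_apply _ hA0] at this
  · intro A hA
    have hA0 : MeasurableSet A := by
      obtain ⟨J, -, hA⟩ := hA
      exact pastSigma_le _ A hA
    rw [Measure.restrict_apply hA0, withDensity_apply _ hA0]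
    exact key A hA
  · rw [Measure.restrict_apply MeasurableSet.univ, withDensity_apply _ MeasurableSet.univ]
    exact key _ ⟨∅, by simp, MeasurableSet.univ⟩

variable [BorelSpace Y] [T35Space Y]

/-- A Borel past is, up to null sets, contained in the Baire past, when all marginals at nonzero
times are inner regular. -/
theorem exists_pastSigma_ae_eq {M : Measure (ℝ≥0 → Y)} [IsFiniteMeasure M]
    (hM : ∀ t : ℝ≥0, t ≠ 0 → (M.map fun ω => ω t).InnerRegular) {s : ℝ≥0} {A : Set (ℝ≥0 → Y)}
    (hA : MeasurableSet[⨆ r : ℝ≥0, ⨆ _ : r ≤ s,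
      MeasurableSpace.comap (fun ω : ℝ≥0 → Y => ω r) inferInstance] A) :
    ∃ A', MeasurableSet[pastSigma Y (Set.Iic s)] A' ∧ A =ᵐ[M] toMixed ⁻¹' A' := by
  suffices h : (⨆ r : ℝ≥0, ⨆ _ : r ≤ s,
      MeasurableSpace.comap (fun ω : ℝ≥0 → Y => ω r) inferInstance) ≤
      @eventuallyMeasurableSpace _ ((pastSigma Y (Set.Iic s)).comap toMixed) (ae M) _ by
    obtain ⟨_, ⟨A', hA', rfl⟩, h⟩ := h A hA
    exact ⟨A', hA', h⟩
  refine iSup₂_le fun r hr => ?_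
  rintro _ ⟨B, hB, rfl⟩
  -- Time `0` is already recorded with Borel sets, so no regularity of the initial distribution is
  -- needed.
  rcases eq_or_ne r 0 with rfl | hr0
  · exact ⟨_, ⟨_, measurable_pastSigma_zero hB, rfl⟩, ae_eq_refl _⟩
  · have := hM r hr0
    have : IsFiniteMeasure (M.map fun ω => ω r) := Measure.isFiniteMeasure_map _ _
    obtain ⟨B', hB', h⟩ := borel_le_eventuallyMeasurableSpace_baire (M.map fun ω => ω r) B hB
    refine ⟨_, ⟨(bev (Y := Y) r) ⁻¹' B', measurable_pastSigma_of_mem hr hB', rfl⟩, ?_⟩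
    exact ((measurable_pi_apply r).quasiMeasurePreserving M).preimage_ae_eq h

/-- A Markov process on the space of all paths with given transition kernels for the Baire
σ-algebra and a given initial distribution. -/
theorem exists_markov_path_measure [Nonempty Y] {C : ℕ → Set Y} (hCmono : Monotone C)
    (hCc : ∀ n, IsCompact (C n)) (hCm : ∀ n, MeasurableSet[baire Y] (C n))
    (hCu : ⋃ n, C n = Set.univ) [∀ t, IsMarkovKernel (Q t)]
    (hQ0 : Q 0 = Kernel.id) (hQ : ∀ s t, Q (s + t) = Q t ∘ₖ Q s) (ν : Measure Y)
    [IsProbabilityMeasure ν] :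
    ∃ M : Measure (ℝ≥0 → Y), IsProbabilityMeasure M ∧ (M.map fun ω => ω 0) = ν ∧
      ∀ s t : ℝ≥0, s ≤ t → ∀ A, MeasurableSet[⨆ r : ℝ≥0, ⨆ _ : r ≤ s,
        MeasurableSpace.comap (fun ω : ℝ≥0 → Y => ω r) inferInstance] A →
        ∀ D : Set (BaireOf Y), MeasurableSet D →
          M (A ∩ (fun ω => toBaire (ω t)) ⁻¹' D) =
            ∫⁻ ω in A, Q (t - s) (toBaire (ω s)) D ∂M := by
  choose N hNp hN hN0 using exists_isMarkovOn hQ ν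
  obtain ⟨M, hMp, hM, hMr⟩ := exists_measure_of_consistent hCmono hCc hCm hCu N
    fun I J hIJ A hA => ((hN J).mono (Finset.coe_subset.2 hIJ)).measure_eq (hN I)
      (fun A hA => (hN0 J A hA).trans (hN0 I A hA).symm) hA
  have hMp' : IsProbabilityMeasure (M.map toMixed) :=
    Measure.isProbabilityMeasure_map measurable_toMixed.aemeasurable
  have hMN : ∀ (J : Finset ℝ≥0) (A : Set (MixedPath Y)), MeasurableSet[pastSigma Y J] A →
      M.map toMixed A = N J A := fun J A hA => by
    rw [Measure.map_apply measurable_toMixed (pastSigma_le _ A hA), hM J A hA]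
  have hmarkov : IsMarkovOn Q Set.univ (M.map toMixed) := by
    refine isMarkovOn_univ_of_finite fun I s t hs ht hst A hA D hD => ?_
    have hA' : MeasurableSet[pastSigma Y I] A := pastSigma_mono Set.inter_subset_left A hA
    rw [hMN I _ (MeasurableSet.inter hA' (measurable_pastSigma_of_mem ht hD)),
      setLIntegral_eq_of_measure_eq_on (f := fun ω => Q (t - s) (bev s ω) D) (pastSigma_le _)
        (hMN I) ((Kernel.measurable_coe _ hD).comp (measurable_pastSigma_toBaire hs)) hA']
    exact hN I s t hs ht hst A hA D hD
  refine ⟨M, hMp, Measure.ext fun A hA => ?_, fun s t hst A hA D hD => ?_⟩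
  · rw [Measure.map_apply (measurable_pi_apply 0) hA, ← hN0 ∅ A hA]
    exact hM ∅ _ (measurable_pastSigma_zero hA)
  have hbt : ∀ t, Measurable fun ω : ℝ≥0 → Y => toBaire (ω t) := fun t =>
    measurable_toBaire.comp (measurable_pi_apply t)
  -- `IsMarkovOn` concerns strictly later times only; at `s = t` the claim is `Q 0 = Kernel.id`.
  rcases hst.eq_or_lt with rfl | hst
  · rw [tsub_self, hQ0]
    simp only [Kernel.id_apply, Measure.dirac_apply' _ hD]
    rw [Set.inter_comm, ← Measure.restrict_apply (hbt s hD), ← lintegral_indicator_one (hbt s hD)]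
    rfl
  · obtain ⟨A', hA', hAA'⟩ := exists_pastSigma_ae_eq hMr hA
    have hA0 : MeasurableSet A' := pastSigma_le _ A' hA'
    rw [measure_congr (hAA'.inter (ae_eq_refl ((fun ω => toBaire (ω t)) ⁻¹' D))),
      setLIntegral_congr hAA']
    have := hmarkov s t (Or.inr trivial) trivial hst A' (by rwa [Set.univ_inter]) D hD
    rw [Measure.map_apply measurable_toMixed (hA0.inter (measurable_bev t hD)),
      setLIntegral_map (f := fun ω => Q (t - s) (bev s ω) D) hA0
        ((Kernel.measurable_coe _ hD).comp (measurable_bev s))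
        measurable_toMixed] at this
    exact this

end MarkovPath

end GeneralizedFeller

namespace GeneralizedFeller

open scoped BoundedContinuousFunction ENNReal
open ProbabilityTheory

/-! ### Conditional expectations and right limits of the filtration. -/

section Transition

variable {Ω B : Type*} {mΩ : MeasurableSpace Ω} [MeasurableSpace B]

/-- The Markov property with respect to the filtration `𝓕`, with transition kernels `Q`. -/
def HasTransition (𝓕 : Filtration ℝ≥0 mΩ) (X : ℝ≥0 → Ω → B) (Q : ℝ≥0 → Kernel B B)
    (M : Measure Ω) : Prop :=
  ∀ s t : ℝ≥0, s ≤ t → ∀ A, MeasurableSet[𝓕 s] A → ∀ D, MeasurableSet D →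
    M (A ∩ X t ⁻¹' D) = ∫⁻ ω in A, Q (t - s) (X s ω) D ∂M

variable {𝓕 : Filtration ℝ≥0 mΩ} {X : ℝ≥0 → Ω → B} {Q : ℝ≥0 → Kernel B B}
  [∀ t, IsMarkovKernel (Q t)] {M : Measure Ω} [IsProbabilityMeasure M]

/-- The transition identity is applied to `A ∩ {X_s ∈ B}`, still an event of `𝓕 s`. The joint law is
needed later to integrate `|f(X_t) - f(X_s)|`. -/
theorem HasTransition.map_prodMk (h : HasTransition 𝓕 X Q M) (hX : ∀ t, Measurable[𝓕 t] (X t))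
    {s t : ℝ≥0} (hst : s ≤ t) {A : Set Ω} (hA : MeasurableSet[𝓕 s] A) :
    (M.restrict A).map (fun ω => (X s ω, X t ω)) = (M.restrict A).map (X s) ⊗ₘ Q (t - s) := by
  have hXm : ∀ t, Measurable (X t) := fun t => (hX t).mono (𝓕.le t) le_rfl
  have hA0 := 𝓕.le s A hA
  refine Measure.ext_prod fun {B D} hB hD => ?_
  rw [Measure.map_apply ((hXm s).prodMk (hXm t)) (hB.prod hD), Measure.compProd_apply_prod hB hD,
    setLIntegral_map hB (Kernel.measurable_coe _ hD) (hXm s),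
    Measure.restrict_restrict (hXm s hB), Set.inter_comm _ A,
    ← h s t hst _ (MeasurableSet.inter hA (hX s hB)) D hD,
    Measure.restrict_apply ((hXm s).prodMk (hXm t) (hB.prod hD)), Set.mk_preimage_prod,
    Set.inter_comm _ A, Set.inter_assoc]

theorem HasTransition.setIntegral_pair (h : HasTransition 𝓕 X Q M)
    (hX : ∀ t, Measurable[𝓕 t] (X t)) {s t : ℝ≥0} (hst : s ≤ t) {A : Set Ω}
    (hA : MeasurableSet[𝓕 s] A) {g : B × B → ℝ} (hg : Measurable g) {C : ℝ} (hC : ∀ p, |g p| ≤ C) :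
    ∫ ω in A, g (X s ω, X t ω) ∂M = ∫ ω in A, ∫ y, g (X s ω, y) ∂(Q (t - s) (X s ω)) ∂M := by
  have hXm : ∀ t, Measurable (X t) := fun t => (hX t).mono (𝓕.le t) le_rfl
  have : IsFiniteMeasure ((M.restrict A).map (X s)) := Measure.isFiniteMeasure_map _ _
  have hm : StronglyMeasurable fun x => ∫ y, g (x, y) ∂(Q (t - s) x) :=
    hg.stronglyMeasurable.integral_kernel_prod_right'
  rw [← integral_map (f := fun x => ∫ y, g (x, y) ∂(Q (t - s) x)) (hXm s).aemeasurable
    hm.aestronglyMeasurable, ← Measure.integral_compProd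
    (Integrable.of_bound hg.aestronglyMeasurable C (ae_of_all _ hC)), ← h.map_prodMk hX hst hA,
    integral_map ((hXm s).prodMk (hXm t)).aemeasurable hg.aestronglyMeasurable]

theorem HasTransition.setIntegral (h : HasTransition 𝓕 X Q M) (hX : ∀ t, Measurable[𝓕 t] (X t))
    {s t : ℝ≥0} (hst : s ≤ t) {A : Set Ω} (hA : MeasurableSet[𝓕 s] A) {f : B → ℝ}
    (hf : Measurable f) {C : ℝ} (hC : ∀ y, |f y| ≤ C) :
    ∫ ω in A, f (X t ω) ∂M = ∫ ω in A, ∫ y, f y ∂(Q (t - s) (X s ω)) ∂M :=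
  h.setIntegral_pair hX hst hA (g := fun p => f p.2) (hf.comp measurable_snd) fun p => hC p.2

theorem measurable_integral_kernel {κ : Kernel B B} [IsMarkovKernel κ] {f : B → ℝ}
    (hf : Measurable f) : Measurable fun x => ∫ y, f y ∂(κ x) :=
  (StronglyMeasurable.integral_kernel_prod_right' (κ := κ)
    (hf.comp measurable_snd : Measurable fun p : B × B => f p.2).stronglyMeasurable).measurable

theorem abs_integral_kernel_le {κ : Kernel B B} [IsMarkovKernel κ] {f : B → ℝ} {C : ℝ}
    (hC : ∀ y, |f y| ≤ C) (x : B) : |∫ y, f y ∂(κ x)| ≤ C := by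
  have hC' : ∀ y, ‖f y‖ ≤ C := hC
  simpa using norm_integral_le_of_norm_le_const (μ := κ x) (ae_of_all _ hC')

theorem HasTransition.condExp_eq (h : HasTransition 𝓕 X Q M) (hX : ∀ t, Measurable[𝓕 t] (X t))
    {s t : ℝ≥0} (hst : s ≤ t) {f : B → ℝ} (hf : Measurable f) {C : ℝ} (hC : ∀ y, |f y| ≤ C) :
    M[fun ω => f (X t ω) | 𝓕 s] =ᵐ[M] fun ω => ∫ y, f y ∂(Q (t - s) (X s ω)) := by
  have hXm : ∀ t, Measurable (X t) := fun t => (hX t).mono (𝓕.le t) le_rfl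
  have hQ := measurable_integral_kernel (κ := Q (t - s)) hf
  symm
  refine ae_eq_condExp_of_forall_setIntegral_eq (𝓕.le s) ?_ (fun A _ _ => ?_)
    (fun A hA _ => (h.setIntegral hX hst hA hf hC).symm)
    (hQ.comp (hX s)).stronglyMeasurable.aestronglyMeasurable
  · exact Integrable.of_bound (hf.comp (hXm t)).aestronglyMeasurable C (ae_of_all _ fun ω => hC _)
  · exact (Integrable.of_bound (hQ.comp (hXm s)).aestronglyMeasurable C
      (ae_of_all _ fun ω => abs_integral_kernel_le hC _)).integrableOn

/-- Bounded measurable functions whose mean oscillation over the kernels `Q u` vanishes as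
`u ↘ 0`. -/
structure IsRightRegular (Q : ℝ≥0 → Kernel B B) (f : B → ℝ) : Prop where
  measurable : Measurable f
  bounded : ∃ C, ∀ y, |f y| ≤ C
  tendsto : ∀ x, Tendsto (fun u => ∫ y, |f y - f x| ∂(Q u x)) (𝓝[>] 0) (𝓝 0)

theorem tendsto_one_div_nhdsGT :
    Tendsto (fun n : ℕ => (1 / ((n : ℝ≥0) + 1))) atTop (𝓝[>] 0) := by
  refine tendsto_nhdsWithin_iff.2 ⟨?_, Eventually.of_forall fun n => ?_⟩
  · exact tendsto_one_div_add_atTop_nhds_zero_nat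
  · exact (by positivity : (0 : ℝ≥0) < 1 / ((n : ℝ≥0) + 1))

/-- Conditioning on `X s` turns the expectation into the mean oscillation of `f` over `Q u`, which
tends to `0` pointwise and boundedly. -/
theorem HasTransition.tendsto_integral_abs_sub (h : HasTransition 𝓕 X Q M)
    (hX : ∀ t, Measurable[𝓕 t] (X t)) {f : B → ℝ} (hf : IsRightRegular Q f) (s : ℝ≥0) :
    Tendsto (fun n : ℕ => ∫ ω, |f (X (s + 1 / ((n : ℝ≥0) + 1)) ω) - f (X s ω)| ∂M) atTop (𝓝 0) := by
  obtain ⟨C, hC⟩ := hf.bounded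
  have hXm : ∀ t, Measurable (X t) := fun t => (hX t).mono (𝓕.le t) le_rfl
  have hg : Measurable fun p : B × B => |f p.2 - f p.1| := by
    exact ((hf.measurable.comp measurable_snd).sub (hf.measurable.comp measurable_fst)).abs
  have hgC : ∀ p : B × B, |(|f p.2 - f p.1|)| ≤ C + C := fun p => by
    rw [abs_abs]
    exact (abs_sub _ _).trans (add_le_add (hC _) (hC _))
  have heq : ∀ n : ℕ, ∫ ω, |f (X (s + 1 / ((n : ℝ≥0) + 1)) ω) - f (X s ω)| ∂M =
      ∫ ω, ∫ y, |f y - f (X s ω)| ∂(Q (1 / ((n : ℝ≥0) + 1)) (X s ω)) ∂M := by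
    intro n
    have := h.setIntegral_pair hX (le_self_add : s ≤ s + 1 / ((n : ℝ≥0) + 1)) MeasurableSet.univ
      hg hgC
    simpa only [setIntegral_univ, add_tsub_cancel_left] using this
  simp only [heq]
  rw [← integral_zero Ω ℝ (μ := M)]
  refine tendsto_integral_of_dominated_convergence (fun _ => C + C) (fun n => ?_)
    (integrable_const _) (fun n => ae_of_all _ fun ω => ?_) (ae_of_all _ fun ω => ?_)
  · exact ((StronglyMeasurable.integral_kernel_prod_right' (κ := Q (1 / ((n : ℝ≥0) + 1)))
      hg.stronglyMeasurable).measurable.comp (hXm s)).aestronglyMeasurable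
  · exact abs_integral_kernel_le (κ := Q (1 / ((n : ℝ≥0) + 1)))
      (f := fun y => |f y - f (X s ω)|) (fun y => hgC (X s ω, y)) (X s ω)
  · exact (hf.tendsto (X s ω)).comp tendsto_one_div_nhdsGT

theorem HasTransition.tendsto_setIntegral (h : HasTransition 𝓕 X Q M)
    (hX : ∀ t, Measurable[𝓕 t] (X t)) {f : B → ℝ} (hf : IsRightRegular Q f) (s : ℝ≥0) (A : Set Ω) :
    Tendsto (fun n : ℕ => ∫ ω in A, f (X (s + 1 / ((n : ℝ≥0) + 1)) ω) ∂M) atTop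
      (𝓝 (∫ ω in A, f (X s ω) ∂M)) := by
  obtain ⟨C, hC⟩ := hf.bounded
  have hXm : ∀ t, Measurable (X t) := fun t => (hX t).mono (𝓕.le t) le_rfl
  have hint : ∀ t, Integrable (fun ω => f (X t ω)) M := fun t =>
    Integrable.of_bound (hf.measurable.comp (hXm t)).aestronglyMeasurable C
      (ae_of_all _ fun ω => hC _)
  rw [tendsto_iff_norm_sub_tendsto_zero]
  refine squeeze_zero (fun n => norm_nonneg _) (fun n => ?_) (h.tendsto_integral_abs_sub hX hf s)
  rw [← integral_sub (hint _).integrableOn (hint _).integrableOn]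
  refine (norm_integral_le_integral_norm _).trans ?_
  exact setIntegral_le_integral ((hint _).sub (hint _)).norm (ae_of_all _ fun ω => norm_nonneg _)

/-- An event of the right limit belongs to `𝓕 (s + δ)` for every `δ > 0`. The Markov property
between `s + δ` and `t + δ` involves the same kernel `Q (t - s)`, and `δ ↘ 0` is taken on both
sides; hence regularity is required of `f` and of its image under the kernel. -/
theorem HasTransition.setIntegral_rightCont (h : HasTransition 𝓕 X Q M)
    (hX : ∀ t, Measurable[𝓕 t] (X t)) {s t : ℝ≥0} (hst : s ≤ t) {f : B → ℝ}
    (hf : IsRightRegular Q f) (hQf : IsRightRegular Q fun x => ∫ y, f y ∂(Q (t - s) x))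
    {A : Set Ω} (hA : MeasurableSet[𝓕.rightCont s] A) :
    ∫ ω in A, f (X t ω) ∂M = ∫ ω in A, ∫ y, f y ∂(Q (t - s) (X s ω)) ∂M := by
  obtain ⟨C, hC⟩ := hf.bounded
  rw [Filtration.rightCont_eq] at hA
  refine tendsto_nhds_unique (h.tendsto_setIntegral hX hf t A)
    ((h.tendsto_setIntegral hX hQf s A).congr fun n => ?_)
  have hpos : (0 : ℝ≥0) < 1 / ((n : ℝ≥0) + 1) := by positivity
  have hA' : MeasurableSet[𝓕 (s + 1 / ((n : ℝ≥0) + 1))] A :=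
    iInf₂_le (f := fun j (_ : j > s) => 𝓕 j) _ (lt_add_of_pos_right s hpos) A hA
  rw [h.setIntegral hX (add_le_add_left hst _) hA' hf.measurable hC, add_tsub_add_eq_tsub_right]

theorem HasTransition.condExp_rightCont (h : HasTransition 𝓕 X Q M)
    (hX : ∀ t, Measurable[𝓕 t] (X t)) {s t : ℝ≥0} (hst : s ≤ t) {f : B → ℝ}
    (hf : IsRightRegular Q f) (hQf : IsRightRegular Q fun x => ∫ y, f y ∂(Q (t - s) x)) :
    M[fun ω => f (X t ω) | 𝓕.rightCont s] =ᵐ[M] fun ω => ∫ y, f y ∂(Q (t - s) (X s ω)) := by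
  have hXm : ∀ t, Measurable (X t) := fun t => (hX t).mono (𝓕.le t) le_rfl
  obtain ⟨C, hC⟩ := hf.bounded
  have hQ := measurable_integral_kernel (κ := Q (t - s)) hf.measurable
  symm
  refine ae_eq_condExp_of_forall_setIntegral_eq (𝓕.rightCont.le s) ?_ (fun A _ _ => ?_)
    (fun A hA _ => (h.setIntegral_rightCont hX hst hf hQf hA).symm)
    ((hQ.comp (hX s)).mono (𝓕.le_rightCont s) le_rfl
      ).stronglyMeasurable.aestronglyMeasurable
  · exact Integrable.of_bound (hf.measurable.comp (hXm t)).aestronglyMeasurable C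
      (ae_of_all _ fun ω => hC _)
  · exact (Integrable.of_bound (hQ.comp (hXm s)).aestronglyMeasurable C
      (ae_of_all _ fun ω => abs_integral_kernel_le hC _)).integrableOn

end Transition

/-! ### Passing to the completed filtration. -/

section Completion

variable {Ω : Type*} {mΩ : MeasurableSpace Ω}

/-- The identity from the completed space. -/
def fromCompletion (M : Measure Ω) (ω : NullMeasurableSpace Ω M) : Ω := ω

theorem measurable_fromCompletion (M : Measure Ω) : Measurable (fromCompletion M) :=
  fun _ hA => MeasurableSet.nullMeasurableSet hA

theorem map_fromCompletion (M : Measure Ω) : M.completion.map (fromCompletion M) = M :=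
  Measure.ext fun _ hA => Measure.map_apply (measurable_fromCompletion M) hA

/-- Each event of the completed σ-algebra equals almost everywhere an event of `𝓖 s`, so the
integrals defining the conditional expectation do not change. -/
theorem condExp_completion {M : Measure Ω} [IsProbabilityMeasure M] (𝓖 : Filtration ℝ≥0 mΩ)
    (s : ℝ≥0) {f g : Ω → ℝ} (hf : Integrable f M) (hg : Integrable g M)
    (hgm : Measurable[𝓖 s] g) (h : M[f | 𝓖 s] =ᵐ[M] g) :
    M.completion[fun ω => f (fromCompletion M ω) | completedFiltration M 𝓖 s] =ᵐ[M]
      fun ω => g ω := by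
  have hmp : MeasurePreserving (fromCompletion M) M.completion M :=
    ⟨measurable_fromCompletion M, map_fromCompletion M⟩
  have : IsProbabilityMeasure M.completion := ⟨measure_univ (μ := M)⟩
  have hset : ∀ (k : Ω → ℝ), Integrable k M → ∀ A A' : Set Ω, MeasurableSet A' → A =ᵐ[M] A' →
      ∫ ω in A, k (fromCompletion M ω) ∂M.completion = ∫ ω in A', k ω ∂M := by
    intro k hk A A' hA' hAA'
    have h1 : (A : Set (NullMeasurableSpace Ω M)) =ᵐ[M.completion] fromCompletion M ⁻¹' A' := hAA'
    have h2 : AEStronglyMeasurable k (M.completion.map (fromCompletion M)) := by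
      rw [map_fromCompletion]
      exact hk.aestronglyMeasurable
    have h3 := setIntegral_map hA' h2 (measurable_fromCompletion M).aemeasurable
    rw [map_fromCompletion] at h3
    rw [setIntegral_congr_set h1, h3]
  have key := ae_eq_condExp_of_forall_setIntegral_eq (μ := M.completion)
    (f := fun ω => f (fromCompletion M ω)) (g := fun ω => g (fromCompletion M ω))
    ((completedFiltration M 𝓖).le s) (hmp.integrable_comp_of_integrable hf)
    (fun A _ _ => (hmp.integrable_comp_of_integrable hg).integrableOn) ?_ ?_
  · exact key.symm
  · rintro A ⟨A', hA', hAA'⟩ -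
    rw [hset g hg A A' (𝓖.le s A' hA') hAA', hset f hf A A' (𝓖.le s A' hA') hAA',
      ← setIntegral_condExp (𝓖.le s) hf hA']
    exact setIntegral_congr_ae (𝓖.le s A' hA') (h.mono fun ω hω _ => hω.symm)
  · have hm : Measurable[completedFiltration M 𝓖 s] fun ω => g (fromCompletion M ω) :=
      fun D hD => ⟨g ⁻¹' D, hgm hD, EventuallyEq.rfl⟩
    exact hm.stronglyMeasurable.aestronglyMeasurable

end Completion

end GeneralizedFeller

namespace GeneralizedFeller

open scoped BoundedContinuousFunction ENNReal
open ProbabilityTheory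

/-! ### Complete regularity and Borel sets of a disjoint sum. -/

section Sum

variable {α β : Type*} [TopologicalSpace α] [TopologicalSpace β]

instance [T35Space α] [T35Space β] : T35Space (α ⊕ β) where
  completely_regular := by
    rintro (x | x) K hK hx
    · obtain ⟨f, hf, hfx, hfK⟩ := CompletelyRegularSpace.completely_regular x (Sum.inl ⁻¹' K)
        (hK.preimage continuous_inl) hx
      refine ⟨Sum.elim f fun _ => 1, hf.sumElim continuous_const, hfx, ?_⟩
      rintro (y | y) hy
      · exact hfK hy
      · rfl
    · obtain ⟨f, hf, hfx, hfK⟩ := CompletelyRegularSpace.completely_regular x (Sum.inr ⁻¹' K)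
        (hK.preimage continuous_inr) hx
      refine ⟨Sum.elim (fun _ => 1) f, continuous_const.sumElim hf, hfx, ?_⟩
      rintro (y | y) hy
      · rfl
      · exact hfK hy

instance [MeasurableSpace α] [BorelSpace α] [MeasurableSpace β] [BorelSpace β] :
    BorelSpace (α ⊕ β) where
  measurable_eq := by
    apply le_antisymm
    · intro A hA
      rw [measurableSet_sum_iff] at hA
      let _ : MeasurableSpace (α ⊕ β) := borel _
      have : BorelSpace (α ⊕ β) := ⟨rfl⟩
      rw [← Set.image_preimage_inl_union_image_preimage_inr A]
      exact ((IsOpenEmbedding.inl.measurableEmbedding).measurableSet_image.2 hA.1).union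
        ((IsOpenEmbedding.inr.measurableEmbedding).measurableSet_image.2 hA.2)
    · refine MeasurableSpace.generateFrom_le fun U hU => measurableSet_sum_iff.2 ⟨?_, ?_⟩
      · exact (hU.preimage continuous_inl).measurableSet
      · exact (hU.preimage continuous_inr).measurableSet

end Sum

/-! ### Criteria for right regularity. -/

section RightRegular

variable {B : Type*} [MeasurableSpace B] {Q : ℝ≥0 → Kernel B B} [∀ t, IsMarkovKernel (Q t)]

theorem isRightRegular_of_sq {f : B → ℝ} (hf : Measurable f) {C : ℝ} (hC : ∀ y, |f y| ≤ C)
    (h : ∀ x, Tendsto (fun u => ∫ y, (f y - f x) ^ 2 ∂(Q u x)) (𝓝[>] 0) (𝓝 0)) :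
    IsRightRegular Q f := by
  refine ⟨hf, ⟨C, hC⟩, fun x => tendsto_order.2 ⟨fun a ha => ?_, fun a ha => ?_⟩⟩
  · exact Eventually.of_forall fun u => ha.trans_le (integral_nonneg fun y => abs_nonneg _)
  have hb : ∀ y, |f y - f x| ≤ C + C := fun y =>
    (abs_sub _ _).trans (add_le_add (hC y) (hC x))
  have hsub : Measurable fun y => f y - f x := hf.sub_const _
  have ha2 : 0 < a / 2 := by positivity
  filter_upwards [(tendsto_order.1 (h x)).2 ((a / 2) ^ 2) (by positivity)] with u hu
  have hi2 : Integrable (fun y => (f y - f x) ^ 2) (Q u x) :=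
    Integrable.of_bound (hsub.pow_const 2).aestronglyMeasurable ((C + C) ^ 2)
      (ae_of_all _ fun y => by
        rw [Real.norm_eq_abs, abs_pow]
        exact pow_le_pow_left₀ (abs_nonneg _) (hb y) 2)
  -- For `b = a / 2` one has `|d| ≤ b + d² / b`, whichever of `|d|` and `b` is larger; the second
  -- moment is below `b²`, so the sum is below `2 b = a`.
  calc ∫ y, |f y - f x| ∂(Q u x)
      ≤ ∫ y, (a / 2 + (f y - f x) ^ 2 / (a / 2)) ∂(Q u x) := by
        refine integral_mono (Integrable.of_bound hsub.abs.aestronglyMeasurable (C + C)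
          (ae_of_all _ fun y => by simpa using hb y)) ((integrable_const _).add (hi2.div_const _))
          fun y => ?_
        have h1 : 0 ≤ (f y - f x) ^ 2 / (a / 2) := by positivity
        rcases le_total |f y - f x| (a / 2) with h2 | h2
        · exact h2.trans (le_add_of_nonneg_right h1)
        · refine le_add_of_nonneg_of_le ha2.le ?_
          rw [le_div_iff₀ ha2, ← sq_abs, sq]
          exact mul_le_mul_of_nonneg_left h2 (abs_nonneg _)
    _ = a / 2 + (∫ y, (f y - f x) ^ 2 ∂(Q u x)) / (a / 2) := by
        rw [integral_add (integrable_const _) (hi2.div_const _), integral_const,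
          probReal_univ, one_smul, integral_div]
    _ < a / 2 + (a / 2) ^ 2 / (a / 2) := by gcongr
    _ = a := by
        field_simp
        ring

theorem isRightRegular_of_uniform {f : B → ℝ} (hf : Measurable f)
    (h : ∀ ε : ℝ, 0 < ε → ∃ f', IsRightRegular Q f' ∧ ∀ y, |f y - f' y| ≤ ε) :
    IsRightRegular Q f := by
  have hbdd : ∃ C, ∀ y, |f y| ≤ C := by
    obtain ⟨f', hf', hd⟩ := h 1 one_pos
    obtain ⟨C, hC⟩ := hf'.bounded
    refine ⟨1 + C, fun y => ?_⟩
    calc |f y| = |(f y - f' y) + f' y| := by rw [sub_add_cancel]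
      _ ≤ _ := (abs_add_le _ _).trans (add_le_add (hd y) (hC y))
  refine ⟨hf, hbdd, fun x => tendsto_order.2 ⟨fun a ha => ?_, fun a ha => ?_⟩⟩
  · exact Eventually.of_forall fun u => ha.trans_le (integral_nonneg fun y => abs_nonneg _)
  -- The approximation error enters twice, at `y` and at `x`, for a total of `a / 2`.
  obtain ⟨f', hf', hd⟩ := h (a / 4) (by positivity)
  obtain ⟨C, hC⟩ := hbdd
  obtain ⟨C', hC'⟩ := hf'.bounded
  have hi : ∀ {k : B → ℝ} {D : ℝ} (u : ℝ≥0), Measurable k → (∀ y, |k y| ≤ D) →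
      Integrable (fun y => |k y - k x|) (Q u x) := fun {k D} u hk hD =>
    Integrable.of_bound (hk.sub_const _).abs.aestronglyMeasurable (D + D) (ae_of_all _ fun y => by
      rw [Real.norm_eq_abs, abs_abs]
      exact (abs_sub _ _).trans (add_le_add (hD y) (hD x)))
  filter_upwards [(tendsto_order.1 (hf'.tendsto x)).2 (a / 2) (by positivity)] with u hu
  calc ∫ y, |f y - f x| ∂(Q u x) ≤ ∫ y, (|f' y - f' x| + a / 2) ∂(Q u x) := by
        refine integral_mono (hi u hf hC) ((hi u hf'.measurable hC').add (integrable_const _))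
          fun y => ?_
        have h1 := abs_le.1 (hd y)
        have h2 := abs_le.1 (hd x)
        have h3 := abs_le.1 (le_refl |f' y - f' x|)
        exact abs_le.2 ⟨by linarith, by linarith⟩
    _ = (∫ y, |f' y - f' x| ∂(Q u x)) + a / 2 := by
        rw [integral_add (hi u hf'.measurable hC') (integrable_const _)]
        simp
    _ < a := by linarith

end RightRegular

end GeneralizedFeller

namespace GeneralizedFeller

open scoped BoundedContinuousFunction ENNReal
open ProbabilityTheory

/-! ### Right regularity of `g / ρ` for `g ∈ 𝓑^ρ(E)`. -/

section Regularity

variable {E : Type*} [TopologicalSpace E] [T35Space E] {ρ : AdmissibleWeight E}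

/-- The function `g / ρ` on `E`, extended by `0`. -/
noncomputable def divWeight (ρ : AdmissibleWeight E) (g : E → ℝ) : WithCemetery E → ℝ :=
  Sum.elim (fun x => g x / ρ x) fun _ => 0

omit [T35Space E] in
theorem divWeight_inl (g : E → ℝ) (x : E) : divWeight ρ g (Sum.inl x) = g x / ρ x := rfl

omit [T35Space E] in
theorem eq_divWeight {f : WithCemetery E → ℝ} {g : E → ℝ} (h : ∀ x, f (Sum.inl x) * ρ x = g x)
    (h0 : f (Sum.inr ()) = 0) : f = divWeight ρ g := by
  funext z
  rcases z with x | x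
  · exact (eq_div_iff (ρ.pos x).ne').2 (h x)
  · exact h0

omit [T35Space E] in
theorem measurable_divWeight (hρ : Measurable[baire E] ρ) {g : E → ℝ} (hg : Measurable[baire E] g) :
    Measurable fun y : BaireOf (WithCemetery E) => divWeight ρ g (fromBaire y) := by
  have hρ' : Measurable fun y : BaireOf E => ρ (fromBaire y) := hρ
  have hg' : Measurable fun y : BaireOf E => g (fromBaire y) := hg
  exact measurable_baire_withCemetery (hg'.div hρ')

omit [T35Space E] in
theorem isTestFunction_divWeight (hρ : Measurable[baire E] ρ) {g : E → ℝ}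
    (hg : Measurable[baire E] g) {C : ℝ} (hC : ∀ x, |g x| ≤ C * ρ x) :
    IsTestFunction (divWeight ρ g) where
  bounded := by
    refine ⟨|C|, ?_⟩
    rintro (x | x)
    · rw [divWeight_inl, abs_div, abs_of_pos (ρ.pos x)]
      exact ((div_le_iff₀ (ρ.pos x)).2 (hC x)).trans (le_abs_self C)
    · exact (abs_zero (α := ℝ)).trans_le (abs_nonneg C)
  measurable := measurable_divWeight hρ hg
  cemetery := rfl

theorem isTestFunction_divWeight_growthFun (hρ : Measurable[baire E] ρ) (g : controlledGrowth ρ) :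
    IsTestFunction (divWeight ρ (growthFun g)) :=
  isTestFunction_divWeight hρ (measurable_baire_growthFun g) (abs_growthFun_le g)

/-- The quotient `u² / ρ` is upper semicontinuous because `ρ` is lower semicontinuous: the
inequality holds exactly when some level `q ≥ 0` lies strictly between `u² / a` and `ρ`. -/
theorem isOpen_sq_lt_mul_weight (u : E →ᵇ ℝ) {a : ℝ} (ha : 0 < a) :
    IsOpen {y | u y ^ 2 / ρ y < a} := by
  have : {y | u y ^ 2 / ρ y < a} =
      ⋃ q ∈ Set.Ici (0 : ℝ), {y | u y ^ 2 < a * q} ∩ {y | q < ρ y} := by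
    ext y
    simp only [Set.mem_ofPred, Set.mem_iUnion, Set.mem_inter_iff, Set.mem_Ici, exists_prop]
    rw [div_lt_iff₀ (ρ.pos y)]
    constructor
    · intro h
      obtain ⟨q, hq, hq'⟩ := exists_between ((div_lt_iff₀' ha).2 h)
      exact ⟨q, (by positivity : 0 ≤ u y ^ 2 / a).trans hq.le, (div_lt_iff₀' ha).1 hq, hq'⟩
    · rintro ⟨q, -, hq, hq'⟩
      exact hq.trans (mul_lt_mul_of_pos_left hq' ha)
  rw [this]
  refine isOpen_biUnion fun q hq => IsOpen.inter ?_ (ρ.isOpen_lt hq)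
  exact isOpen_lt (u.continuous.pow 2) continuous_const

variable [MeasurableSpace E] [BorelSpace E] (P : GeneralizedFellerSemigroup ρ)

theorem tendsto_integral_bcf_kernel (u : E →ᵇ ℝ) (x : E) :
    Tendsto (fun t => ∫ y, u y ∂(P.kernel t x)) (𝓝[>] 0) (𝓝 (u x)) := by
  simp only [(represents_kernel P _ x).integral_bcf]
  exact P.tendsto_zero (ofBCF ρ u) x

omit [MeasurableSpace E] [BorelSpace E] in
theorem exists_sq_div_weight_le (u : E →ᵇ ℝ) : ∃ C : ℝ, 0 ≤ C ∧ ∀ y, u y ^ 2 / ρ y ≤ C := by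
  obtain ⟨C, hC⟩ := bounded_mem_weightedBounded ρ (f := fun y => u y ^ 2)
    ⟨‖u‖ ^ 2, fun y => by
      rw [abs_pow]
      exact pow_le_pow_left₀ (abs_nonneg _) (u.norm_coe_le_norm y) 2⟩
  refine ⟨|C|, abs_nonneg C, fun y => ((le_abs_self _).trans_eq ?_).trans ((hC y).trans (le_abs_self C))⟩
  rw [abs_div, abs_of_pos (ρ.pos y)]

/-- The upper semicontinuous function `u² / ρ` satisfies one half of continuity at `t = 0`. -/
theorem eventually_integral_sq_div_weight_lt (u : E →ᵇ ℝ) (x : E) {ε : ℝ} (hε : 0 < ε) :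
    ∀ᶠ t in 𝓝[>] (0 : ℝ≥0), ∫ y, u y ^ 2 / ρ y ∂(P.kernel t x) < u x ^ 2 / ρ x + ε := by
  obtain ⟨C, hC0, hC⟩ := exists_sq_div_weight_le (ρ := ρ) u
  have h0 : ∀ y, 0 ≤ u y ^ 2 / ρ y := fun y => div_nonneg (sq_nonneg _) (ρ.pos y).le
  set a := u x ^ 2 / ρ x + ε / 2 with ha
  have ha0 : 0 < a := add_pos_of_nonneg_of_pos (h0 x) (half_pos hε)
  obtain ⟨χ, hχ1, hχ0, hχ⟩ := exists_bcf_one_zero (isCompact_singleton (x := x))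
    (isOpen_sq_lt_mul_weight (ρ := ρ) u ha0) (by
      rw [Set.singleton_subset_iff]
      exact lt_add_of_pos_right _ (half_pos hε))
  -- A continuous majorant of `u² / ρ` with value `a` at `x`: it is at least `a` everywhere and
  -- equals `a + C` where `u² / ρ` may exceed `a`.
  let F : E →ᵇ ℝ := BoundedContinuousFunction.const E (a + C) - C • χ
  have hF : ∀ y, F y = a + C - C * χ y := fun y => rfl
  have hFx : F x = a := by
    have : χ x = 1 := hχ1 rfl
    rw [hF, this]
    ring
  have hle : ∀ y, u y ^ 2 / ρ y ≤ F y := by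
    intro y
    rw [hF]
    by_cases hy : u y ^ 2 / ρ y < a
    · have := mul_le_mul_of_nonneg_left (hχ y).2 hC0
      linarith
    · have : χ y = 0 := hχ0 hy
      rw [this]
      linarith [hC y]
  have hlim := (tendsto_order.1 (tendsto_integral_bcf_kernel P F x)).2 (u x ^ 2 / ρ x + ε) (by
    rw [hFx, ha]
    linarith)
  filter_upwards [hlim] with t ht
  refine lt_of_le_of_lt (integral_mono ?_ (F.integrable _) hle) ht
  refine Integrable.of_bound ((u.continuous.pow 2).measurable.div ρ.measurable).aestronglyMeasurable
    C (ae_of_all _ fun y => ?_)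
  rw [Real.norm_eq_abs, abs_of_nonneg (h0 y)]
  exact hC y

variable {P} {c : ℝ} (hρ : Measurable[baire E] ρ) (hc : ∀ t : ℝ≥0, ‖P.op t‖ ≤ Real.exp (c * t))

omit [T35Space E] [BorelSpace E] in
theorem quotient_divWeight_inl (t : ℝ≥0) (g : E → ℝ) (x : E) :
    P.quotient t (divWeight ρ g) (Sum.inl x) = (∫ y, g y ∂(P.kernel t x)) / ρ x := by
  have : ∀ y, divWeight ρ g (Sum.inl y) * ρ y = g y := fun y =>
    div_mul_cancel₀ _ (ρ.pos y).ne'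
  simp only [GeneralizedFellerSemigroup.quotient, GeneralizedFellerSemigroup.extend, this]

theorem quotient_divWeight_growthFun (t : ℝ≥0) (g : controlledGrowth ρ) :
    P.quotient t (divWeight ρ (growthFun g)) = divWeight ρ (growthFun (P.op t g)) := by
  funext z
  rcases z with x | x
  · rw [quotient_divWeight_inl, (represents_kernel P t x).integral_eq]
    rfl
  · rfl

include hc in
-- Since `(u / ρ)² = (u² / ρ) / ρ`, the second moment around `h = u(x) / ρ(x)` expands into `P(t)(u²
-- / ρ)(x)`, `P(t) u (x)` and constants. The cross term converges, and semicontinuity bounds the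
-- square from above, which suffices for a nonnegative quantity.
theorem isRightRegular_bcf (u : E →ᵇ ℝ) :
    IsRightRegular (cemeteryKernel P c hρ) fun z => divWeight ρ u (fromBaire z) := by
  have := isMarkovKernel_cemeteryKernel hρ hc
  have hu : IsTestFunction (divWeight ρ u) := isTestFunction_divWeight_growthFun hρ (ofBCF ρ u)
  obtain ⟨C, hC0, hC⟩ := exists_sq_div_weight_le (ρ := ρ) u
  have hu2 : IsTestFunction (divWeight ρ fun y => u y ^ 2 / ρ y) := by
    have hum : Measurable[baire E] u := Continuous.measurable_baire u.continuous
    obtain ⟨D, hD⟩ := bounded_mem_weightedBounded ρ (f := fun y => u y ^ 2 / ρ y)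
      ⟨C, fun y => by
        rw [abs_of_nonneg (div_nonneg (sq_nonneg _) (ρ.pos y).le)]
        exact hC y⟩
    refine isTestFunction_divWeight hρ ?_ fun y => (div_le_iff₀ (ρ.pos y)).1 (hD y)
    exact Measurable.div (Measurable.pow_const hum 2) hρ
  have hsq : ∀ z, divWeight ρ (fun y => u y ^ 2 / ρ y) z = divWeight ρ u z ^ 2 := by
    rintro (y | y)
    · rw [divWeight_inl, divWeight_inl, div_pow, div_div, sq (ρ y)]
    · change (0 : ℝ) = 0 ^ 2
      simp
  obtain ⟨D, hD⟩ := hu.bounded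
  refine isRightRegular_of_sq hu.measurable (fun y => hD _) (withCemetery_cases (fun x => ?_) ?_)
  swap
  · refine tendsto_const_nhds.congr fun t => ?_
    rw [cemeteryKernel_cemetery, integral_dirac']
    · simp
    · exact ((hu.measurable.sub_const _).pow_const 2).stronglyMeasurable
  set h := u (fromBaire x) / ρ (fromBaire x) with hh
  have hx := ρ.pos (fromBaire x)
  have hval : divWeight ρ u (fromBaire (baireInl x)) = h := rfl
  have hint : ∀ (t : ℝ≥0), ∫ y, (divWeight ρ u (fromBaire y) - h) ^ 2
      ∂(cemeteryKernel P c hρ t (baireInl x)) =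
      Real.exp (-c * t) * ((∫ y, u y ^ 2 / ρ y ∂(P.kernel t (fromBaire x))) / ρ (fromBaire x)) -
        2 * h * (Real.exp (-c * t) *
          ((∫ y, u y ∂(P.kernel t (fromBaire x))) / ρ (fromBaire x))) + h ^ 2 := by
    intro t
    have e1 := integral_cemeteryKernel hρ hc t hu (baireInl x)
    have e2 := integral_cemeteryKernel hρ hc t hu2 (baireInl x)
    have hi1 : Integrable (fun y => divWeight ρ u (fromBaire y))
        (cemeteryKernel P c hρ t (baireInl x)) :=
      Integrable.of_bound hu.measurable.aestronglyMeasurable D (ae_of_all _ fun y => hD _)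
    obtain ⟨D2, hD2⟩ := hu2.bounded
    have hi2 : Integrable (fun y => divWeight ρ (fun y => u y ^ 2 / ρ y) (fromBaire y))
        (cemeteryKernel P c hρ t (baireInl x)) :=
      Integrable.of_bound hu2.measurable.aestronglyMeasurable D2 (ae_of_all _ fun y => hD2 _)
    have e3 : ∀ y, (divWeight ρ u (fromBaire y) - h) ^ 2 =
        divWeight ρ (fun y => u y ^ 2 / ρ y) (fromBaire y) -
          2 * h * divWeight ρ u (fromBaire y) + h ^ 2 := fun y => by
      rw [hsq]
      ring
    simp only [e3]
    have hi3 : Integrable (fun y => divWeight ρ (fun y => u y ^ 2 / ρ y) (fromBaire y) -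
        2 * h * divWeight ρ u (fromBaire y)) (cemeteryKernel P c hρ t (baireInl x)) :=
      hi2.sub (hi1.const_mul (2 * h))
    rw [integral_add hi3 (integrable_const _),
      integral_sub hi2 (hi1.const_mul (2 * h)), integral_const_mul, e1, e2, integral_const, probReal_univ,
      one_smul]
    change _ * P.quotient t (divWeight ρ _) (Sum.inl (fromBaire x)) - _ * (_ *
      P.quotient t (divWeight ρ _) (Sum.inl (fromBaire x))) + _ = _
    rw [quotient_divWeight_inl, quotient_divWeight_inl]
  simp only [hval, hint]
  refine tendsto_order.2 ⟨fun a ha => Eventually.of_forall fun t => ?_, fun a ha => ?_⟩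
  · rw [← hint]
    exact ha.trans_le (integral_nonneg fun y => sq_nonneg _)
  have hexp : Tendsto (fun t : ℝ≥0 => Real.exp (-c * t)) (𝓝[>] 0) (𝓝 1) := by
    have : Continuous fun t : ℝ≥0 => Real.exp (-c * t) := by fun_prop
    simpa using (this.tendsto 0).mono_left nhdsWithin_le_nhds
  -- After division by `ρ(x)` this tolerance contributes `a / 2`.
  have hε : 0 < a * ρ (fromBaire x) / 2 := by positivity
  have hlim : Tendsto (fun t : ℝ≥0 => Real.exp (-c * t) *
      ((u (fromBaire x) ^ 2 / ρ (fromBaire x) + a * ρ (fromBaire x) / 2) / ρ (fromBaire x)) -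
        2 * h * (Real.exp (-c * t) *
          ((∫ y, u y ∂(P.kernel t (fromBaire x))) / ρ (fromBaire x))) + h ^ 2) (𝓝[>] 0)
      (𝓝 (1 * ((u (fromBaire x) ^ 2 / ρ (fromBaire x) + a * ρ (fromBaire x) / 2) /
        ρ (fromBaire x)) - 2 * h * (1 * (u (fromBaire x) / ρ (fromBaire x))) + h ^ 2)) :=
    ((hexp.mul_const _).sub ((hexp.mul ((tendsto_integral_bcf_kernel P u _).div_const _)).const_mul
      _)).add_const _
  have hlt : 1 * ((u (fromBaire x) ^ 2 / ρ (fromBaire x) + a * ρ (fromBaire x) / 2) /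
        ρ (fromBaire x)) - 2 * h * (1 * (u (fromBaire x) / ρ (fromBaire x))) + h ^ 2 < a := by
    have : 1 * ((u (fromBaire x) ^ 2 / ρ (fromBaire x) + a * ρ (fromBaire x) / 2) /
        ρ (fromBaire x)) - 2 * h * (1 * (u (fromBaire x) / ρ (fromBaire x))) + h ^ 2 = a / 2 := by
      rw [hh]
      field_simp
      ring
    rw [this]
    linarith
  filter_upwards [(tendsto_order.1 hlim).2 a hlt,
    eventually_integral_sq_div_weight_lt P u (fromBaire x) hε] with t ht ht'
  refine lt_of_le_of_lt ?_ ht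
  gcongr

include hc in
-- Convergence in `‖·‖_ρ` is uniform convergence after division by `ρ`, so the bounded continuous
-- case extends by approximation.
theorem isRightRegular_growthFun (g : controlledGrowth ρ) :
    IsRightRegular (cemeteryKernel P c hρ) fun z => divWeight ρ (growthFun g) (fromBaire z) := by
  have := isMarkovKernel_cemeteryKernel hρ hc
  refine isRightRegular_of_uniform (isTestFunction_divWeight_growthFun hρ g).measurable
    fun ε hε => ?_
  obtain ⟨u, hu⟩ := exists_bcf_tendsto g
  obtain ⟨n, hn⟩ := ((tendsto_iff_norm_sub_tendsto_zero.1 hu).eventually_lt_const hε).exists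
  refine ⟨_, isRightRegular_bcf hρ hc (u n), withCemetery_cases (fun x => ?_) ?_⟩
  · change |growthFun g (fromBaire x) / ρ (fromBaire x) - u n (fromBaire x) / ρ (fromBaire x)| ≤ ε
    rw [← sub_div, abs_div, abs_of_pos (ρ.pos _), div_le_iff₀ (ρ.pos _), abs_sub_comm]
    exact (abs_growthFun_le (ofBCF ρ (u n) - g) (fromBaire x)).trans
      (mul_le_mul_of_nonneg_right hn.le (ρ.pos _).le)
  · change |(0 : ℝ) - 0| ≤ ε
    simpa using hε.le

include hc in
-- The kernel sends `g / ρ` to `e^{-ct} P(t) g / ρ`, again a quotient of a function in `𝓑^ρ(E)`.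
theorem isRightRegular_integral_growthFun (t : ℝ≥0) (g : controlledGrowth ρ) :
    IsRightRegular (cemeteryKernel P c hρ) fun z =>
      ∫ y, divWeight ρ (growthFun g) (fromBaire y) ∂(cemeteryKernel P c hρ t z) := by
  convert isRightRegular_growthFun hρ hc (Real.exp (-c * t) • P.op t g) using 2 with z
  rw [integral_cemeteryKernel hρ hc t (isTestFunction_divWeight_growthFun hρ g),
    quotient_divWeight_growthFun]
  revert z
  refine withCemetery_cases (fun x => ?_) ?_
  · exact (mul_div_assoc _ _ _).symm
  · exact mul_zero _

end Regularity

end GeneralizedFeller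

/-! ### Assembly of the process on `E ∪ {Δ}` and its conditional expectations. -/

namespace GeneralizedFeller

open ProbabilityTheory

variable {E : Type*} [TopologicalSpace E] [T35Space E] [MeasurableSpace E] [BorelSpace E]
  {ρ : AdmissibleWeight E} {P : GeneralizedFellerSemigroup ρ} {c : ℝ}

omit [T35Space E] in
theorem measurable_toBaire_canonicalProcess (t : ℝ≥0) :
    Measurable[naturalFiltration E t] fun ω => toBaire (canonicalProcess E t ω) := by
  have h : Measurable[naturalFiltration E t] (canonicalProcess E t) := measurable_iff_comap_le.2
    (le_iSup₂ (f := fun r (_ : r ≤ t) =>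
      MeasurableSpace.comap (canonicalProcess E r) inferInstance) t le_rfl)
  exact measurable_toBaire.comp h

/-- The process on `E ∪ {Δ}` with transition kernels `e^{-ct} ρ(y) p(t)(x, dy) / ρ(x)` on `E`. -/
theorem exists_hasTransition_cemeteryKernel (hρ : Measurable[baire E] ρ)
    (hc : ∀ t : ℝ≥0, ‖P.op t‖ ≤ Real.exp (c * t)) (ν : Measure (WithCemetery E))
    [IsProbabilityMeasure ν] :
    ∃ M : Measure (PathSpace E), IsProbabilityMeasure M ∧ M.map (canonicalProcess E 0) = ν ∧
      HasTransition (naturalFiltration E) (fun t ω => toBaire (canonicalProcess E t ω))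
        (cemeteryKernel P c hρ) M := by
  have := isMarkovKernel_cemeteryKernel hρ hc
  -- This exhaustion is compact by admissibility and Baire by measurability of `ρ`, as the extension
  -- theorem demands.
  let C : ℕ → Set (WithCemetery E) := fun n => Sum.inl '' {x | ρ x ≤ n} ∪ {Sum.inr ()}
  have hCmono : Monotone C := fun m n hmn => Set.union_subset_union_left _
    (Set.image_mono fun x (hx : ρ x ≤ m) => hx.trans (Nat.cast_le.2 hmn))
  have hCc : ∀ n, IsCompact (C n) := fun n =>
    ((ρ.isCompact_sublevel n n.cast_nonneg).image continuous_inl).union isCompact_singleton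
  have hCm : ∀ n, MeasurableSet[baire (WithCemetery E)] (C n) := fun n => by
    refine MeasurableSet.union (measurableSet_baire_inl_image (hρ measurableSet_Iic)) ?_
    have : ({Sum.inr ()} : Set (WithCemetery E)) = (Sum.inl '' Set.univ)ᶜ := by
      ext (x | x) <;> simp
    rw [this]
    exact MeasurableSet.compl (measurableSet_baire_inl_image MeasurableSet.univ)
  have hCu : ⋃ n, C n = Set.univ := by
    refine Set.eq_univ_of_forall ?_
    rintro (x | x)
    · obtain ⟨n, hn⟩ := exists_nat_ge (ρ x)
      exact Set.mem_iUnion.2 ⟨n, Or.inl ⟨x, hn, rfl⟩⟩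
    · exact Set.mem_iUnion.2 ⟨0, Or.inr rfl⟩
  have : Nonempty (WithCemetery E) := ⟨Sum.inr ()⟩
  exact exists_markov_path_measure hCmono hCc hCm hCu
    (Kernel.ext fun z => (cemeteryKernel_zero hρ z).trans (Kernel.id_apply z).symm)
    (cemeteryKernel_add hρ hc) ν

variable {M : Measure (PathSpace E)} [IsProbabilityMeasure M] {hρ : Measurable[baire E] ρ}

theorem condExp_of_isTestFunction (hc : ∀ t : ℝ≥0, ‖P.op t‖ ≤ Real.exp (c * t))
    (hM : HasTransition (naturalFiltration E) (fun t ω => toBaire (canonicalProcess E t ω))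
      (cemeteryKernel P c hρ) M) {f : WithCemetery E → ℝ} (hf : IsTestFunction f) {s t : ℝ≥0}
    (hst : s ≤ t) :
    M[fun ω => f (canonicalProcess E t ω) | naturalFiltration E s] =ᵐ[M]
      fun ω => Real.exp (-c * ((t : ℝ) - s)) * P.quotient (t - s) f (canonicalProcess E s ω) := by
  have := isMarkovKernel_cemeteryKernel hρ hc
  obtain ⟨C, hC⟩ := hf.bounded
  have hfm : Measurable fun y : BaireOf (WithCemetery E) => f (fromBaire y) := hf.measurable
  refine (hM.condExp_eq measurable_toBaire_canonicalProcess hst hfm fun y => hC _).trans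
    (EventuallyEq.of_eq (funext fun ω => ?_))
  rw [integral_cemeteryKernel hρ hc _ hf, NNReal.coe_sub hst]
  rfl

theorem condExp_of_mulWeightMem (hc : ∀ t : ℝ≥0, ‖P.op t‖ ≤ Real.exp (c * t))
    (hM : HasTransition (naturalFiltration E) (fun t ω => toBaire (canonicalProcess E t ω))
      (cemeteryKernel P c hρ) M) {f : WithCemetery E → ℝ} (hf : MulWeightMem ρ f) {s t : ℝ≥0}
    (hst : s ≤ t) :
    (M[fun ω => f (canonicalProcess E t ω) | (naturalFiltration E).rightCont s] =ᵐ[M]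
      fun ω => Real.exp (-c * ((t : ℝ) - s)) *
        P.quotient (t - s) f (canonicalProcess E s ω)) ∧
    (M.completion[fun ω => f (canonicalProcess E t ω) |
        completedFiltration M (naturalFiltration E).rightCont s] =ᵐ[M]
      fun ω => Real.exp (-c * ((t : ℝ) - s)) *
        P.quotient (t - s) f (canonicalProcess E s ω)) := by
  have := isMarkovKernel_cemeteryKernel hρ hc
  obtain ⟨⟨g, hg⟩, h0⟩ := hf
  obtain rfl := eq_divWeight hg h0
  have hf := isTestFunction_divWeight_growthFun hρ g
  have hfm : Measurable fun y : BaireOf (WithCemetery E) =>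
    divWeight ρ (growthFun g) (fromBaire y) := hf.measurable
  obtain ⟨C, hC⟩ := hf.bounded
  have hX := measurable_toBaire_canonicalProcess (E := E)
  have heq : ∀ ω, ∫ y, divWeight ρ (growthFun g) (fromBaire y)
      ∂(cemeteryKernel P c hρ (t - s) (toBaire (canonicalProcess E s ω))) =
      Real.exp (-c * ((t : ℝ) - s)) *
        P.quotient (t - s) (divWeight ρ (growthFun g)) (canonicalProcess E s ω) := fun ω => by
    rw [integral_cemeteryKernel hρ hc _ hf, NNReal.coe_sub hst]
    rfl
  have hQm := (measurable_integral_kernel (κ := cemeteryKernel P c hρ (t - s)) hfm).comp (hX s)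
  have hQm' : Measurable[naturalFiltration E s] fun ω => Real.exp (-c * ((t : ℝ) - s)) *
      P.quotient (t - s) (divWeight ρ (growthFun g)) (canonicalProcess E s ω) := by
    simp only [← heq]
    exact hQm
  have key : M[fun ω => divWeight ρ (growthFun g) (canonicalProcess E t ω) |
      (naturalFiltration E).rightCont s] =ᵐ[M] fun ω => Real.exp (-c * ((t : ℝ) - s)) *
        P.quotient (t - s) (divWeight ρ (growthFun g)) (canonicalProcess E s ω) :=
    (hM.condExp_rightCont hX hst (isRightRegular_growthFun hρ hc g)
      (isRightRegular_integral_growthFun hρ hc (t - s) g)).trans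
      (EventuallyEq.of_eq (funext heq))
  refine ⟨key, condExp_completion (naturalFiltration E).rightCont s ?_ ?_
    (hQm'.mono ((naturalFiltration E).le_rightCont s) le_rfl) key⟩
  · exact Integrable.of_bound
      ((hfm.comp ((hX t).mono ((naturalFiltration E).le t) le_rfl)).aestronglyMeasurable) C
      (ae_of_all _ fun ω => hC _)
  · refine Integrable.of_bound
      ((hQm'.mono ((naturalFiltration E).le s) le_rfl).aestronglyMeasurable) C
      (ae_of_all _ fun ω => ?_)
    rw [← heq]
    exact abs_integral_kernel_le (fun y => hC _) _

end GeneralizedFeller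

open GeneralizedFeller in
theorem mainTheorem3 {E : Type*} [TopologicalSpace E] [T35Space E] [MeasurableSpace E]
    [BorelSpace E] (ρ : AdmissibleWeight E) (hρ : Measurable[baire E] ρ)
    (P : GeneralizedFellerSemigroup ρ) :
    -- the measures `p(t)(x, ·)` defining `P(t) g (x) = ∫ g dp(t)(x, ·)` exist and are unique
    (∀ (t : ℝ≥0) (x : E), Represents P t x (P.kernel t x) ∧
      ∀ μ : Measure E, Represents P t x μ → μ = P.kernel t x) ∧
    -- the contractive case
    ((∀ t, ‖P.op t‖ ≤ 1) →
      ∀ ν : Measure (WithCemetery E), IsProbabilityMeasure ν →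
        ∃ ℙ : Measure (PathSpace E), IsProbabilityMeasure ℙ ∧
          IsExtendedFellerProcess P ν ℙ (naturalFiltration E) (canonicalProcess E) ∧
          ∀ f : WithCemetery E → ℝ, MulWeightMem ρ f → ∀ s t : ℝ≥0, s ≤ t →
            (ℙ[fun ω => f (canonicalProcess E t ω) | (naturalFiltration E).rightCont s]
              =ᵐ[ℙ] fun ω => P.quotient (t - s) f (canonicalProcess E s ω)) ∧
            (ℙ.completion[fun ω => f (canonicalProcess E t ω) |
                completedFiltration ℙ (naturalFiltration E).rightCont s]
              =ᵐ[ℙ] fun ω => P.quotient (t - s) f (canonicalProcess E s ω))) ∧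
    -- the quasi-contractive case
    (∀ c : ℝ, (∀ t : ℝ≥0, ‖P.op t‖ ≤ Real.exp (c * t)) →
      ∀ ν : Measure (WithCemetery E), IsProbabilityMeasure ν →
        ∃ ℙ : Measure (PathSpace E), IsProbabilityMeasure ℙ ∧
          ℙ.map (canonicalProcess E 0) = ν ∧
          (∀ f : WithCemetery E → ℝ, IsTestFunction f → ∀ s t : ℝ≥0, s ≤ t →
            ℙ[fun ω => f (canonicalProcess E t ω) | naturalFiltration E s]
              =ᵐ[ℙ] fun ω => Real.exp (-c * ((t : ℝ) - s)) *
                P.quotient (t - s) f (canonicalProcess E s ω)) ∧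
          ∀ f : WithCemetery E → ℝ, MulWeightMem ρ f → ∀ s t : ℝ≥0, s ≤ t →
            (ℙ[fun ω => f (canonicalProcess E t ω) | (naturalFiltration E).rightCont s]
              =ᵐ[ℙ] fun ω => Real.exp (-c * ((t : ℝ) - s)) *
                P.quotient (t - s) f (canonicalProcess E s ω)) ∧
            (ℙ.completion[fun ω => f (canonicalProcess E t ω) |
                completedFiltration ℙ (naturalFiltration E).rightCont s]
              =ᵐ[ℙ] fun ω => Real.exp (-c * ((t : ℝ) - s)) *
                P.quotient (t - s) f (canonicalProcess E s ω))) := by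
  refine ⟨fun t x => ⟨represents_kernel P t x, fun μ hμ => hμ.eq_kernel⟩, fun hP ν hν => ?_,
    fun c hc ν hν => ?_⟩
  · have hc : ∀ t : ℝ≥0, ‖P.op t‖ ≤ Real.exp (0 * t) := fun t => by simpa using hP t
    obtain ⟨M, hMp, hM0, hM⟩ := exists_hasTransition_cemeteryKernel hρ hc ν
    refine ⟨M, hMp, ⟨fun t => ?_, fun s t hst f hf => ?_, hM0⟩, fun f hf s t hst => ?_⟩
    · exact measurable_iff_comap_le.2 (le_iSup₂ (f := fun r (_ : r ≤ t) =>
        MeasurableSpace.comap (canonicalProcess E r) inferInstance) t le_rfl)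
    · simpa using condExp_of_isTestFunction hc hM hf hst
    · simpa using condExp_of_mulWeightMem hc hM hf hst
  · obtain ⟨M, hMp, hM0, hM⟩ := exists_hasTransition_cemeteryKernel hρ hc ν
    exact ⟨M, hMp, hM0, fun f hf s t hst => condExp_of_isTestFunction hc hM hf hst,
      fun f hf s t hst => condExp_of_mulWeightMem hc hM hf hst⟩
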